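/- Let $X$ be a topological space (for instance a manifold), and let $K(X)$ be the Grothendieck ring of (finite rank) complex vector bundles on $X$. Let $n\ge 1$, let $S_n$ act on $X^n$ by $\sigma(x_1,\dots,x_n)=(x_{\sigma^{-1}(1)},\dots,x_{\sigma^{-1}(n)})$, and let $\sigma_n=(1\,2\,\cdots\,n)\in S_n$ be the standard $n$-cycle. Let $i:X\to X^n$, $i(x)=(x,\dots,x)$, be the diagonal embedding. For a complex vector bundle $E$ on $X$, let $E^{\boxtimes n}=p_1^*E\otimes\cdots\otimes p_n^*E$ be the external tensor power, an $S_n$-equivariant vector bundle on $X^n$ through $\sigma(v_1\otimes\cdots\otimes v_n)=v_{\sigma^{-1}(1)}\otimes\cdots\otimes v_{\sigma^{-1}(n)}$. For a finite group $G$, a $G$-equivariant complex vector bundle $F$ on a $G$-space $M$ and $g\in G$, put $$\phi_g(F)=\sum_{\xi}\xi\,[F_\xi]\in K(M^g)\otimes\mathbb C ,$$ where $M^g$ is the fixed point set of $g$, and $F_\xi\subset F|_{M^g}$ is the subbundle whose fibres are the eigenspaces of $g$ for the eigenvalue $\xi\in\mathbb C$. Let $\psi^n$ be the $n$-th Adams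 operation: $\psi^n(E)\in K(X)$ is the value at $[\Lambda^1E],\dots,[\Lambda^nE]$ of the polynomial which expresses the $n$-th power sum through the elementary symmetric functions (so that $\psi^n(L_1\oplus\cdots\oplus L_r)=\sum_j [L_j^{\otimes n}]$ for line bundles $L_j$). Then $(X^n)^{\sigma_n}=i(X)$, and for every complex vector bundle $E$ on $X$, $$i^*\phi_{\sigma_n}(E^{\boxtimes n})=\psi^n(E)\qquad\text{in } K(X)\otimes\mathbb C ,$$ where $i^*:K((X^n)^{\sigma_n})\otimes\mathbb C\to K(X)\otimes\mathbb C$ is induced by $i:X\to (X^n)^{\sigma_n}$, and $\psi^n(E)$ stands for $\psi^n(E)\otimes 1$. -/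

import Mathlib

open scoped TensorProduct

namespace BundleK

universe u v w

/-! ### Complex vector bundles

A complex vector bundle on `X` is a family of complex vector spaces `E x` together with an atlas of
local frames (equivalently, local trivialisations): the frames are defined over open sets which
cover `X`, each one is a finite family of local sections which is a basis in every fibre, and the
transition matrices between frames of the atlas are continuous.  The rank may vary from one
component of `X` to another. -/

/-- A finite local frame over an open set of a family of complex vector spaces. -/
structure LocalFrame {X : Type u} [TopologicalSpace X] (E : X → Type)
    [∀ x, AddCommGroup (E x)] [∀ x, Module ℂ (E x)] where
  dom : Set X
  isOpen_dom : IsOpen dom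
  ι : Type
  [finite_ι : Finite ι]
  basis : ∀ x ∈ dom, Module.Basis ι ℂ (E x)

attribute [instance] LocalFrame.finite_ι

namespace LocalFrame

section basics

variable {X : Type u} [TopologicalSpace X]
  {E : X → Type} [∀ x, AddCommGroup (E x)] [∀ x, Module ℂ (E x)]
  {F : X → Type} [∀ x, AddCommGroup (F x)] [∀ x, Module ℂ (F x)]
  {H : X → Type} [∀ x, AddCommGroup (H x)] [∀ x, Module ℂ (H x)]

/-- The fibrewise linear map `f` has continuous matrix entries in the frames `φ` (of its source) and
`ψ` (of its target), over the common domain of the two frames. -/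
def MatrixContinuous (φ : LocalFrame E) (ψ : LocalFrame F) (f : ∀ x, E x →ₗ[ℂ] F x) : Prop :=
  ∀ (i : ψ.ι) (j : φ.ι), Continuous fun x : ↥(φ.dom ∩ ψ.dom) =>
    (ψ.basis x x.2.2).repr (f x (φ.basis x x.2.1 j)) i

/-- The restriction of a frame to a smaller open set. -/
abbrev restrict (φ : LocalFrame E) (W : Set X) (hW : IsOpen W) : LocalFrame E where
  dom := φ.dom ∩ W
  isOpen_dom := φ.isOpen_dom.inter hW
  ι := φ.ι
  basis x hx := φ.basis x hx.1

lemma MatrixContinuous.restrict {φ : LocalFrame E} {ψ : LocalFrame F} {f : ∀ x, E x →ₗ[ℂ] F x}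
    (h : φ.MatrixContinuous ψ f) (W : Set X) (hW : IsOpen W) :
    (φ.restrict W hW).MatrixContinuous ψ f := fun i j =>
  (h i j).comp (continuous_inclusion
    (show (φ.restrict W hW).dom ∩ ψ.dom ⊆ φ.dom ∩ ψ.dom from fun _ hx => ⟨hx.1.1, hx.2⟩))

lemma MatrixContinuous.comp {φ : LocalFrame E} {ψ : LocalFrame F} {χ : LocalFrame H}
    {f : ∀ x, E x →ₗ[ℂ] F x} {g : ∀ x, F x →ₗ[ℂ] H x}
    (hf : φ.MatrixContinuous ψ f) (hg : ψ.MatrixContinuous χ g)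
    (hsub : φ.dom ∩ χ.dom ⊆ ψ.dom) :
    φ.MatrixContinuous χ (fun x => g x ∘ₗ f x) := by
  intro i j
  have := Fintype.ofFinite ψ.ι
  have key : (fun x : ↥(φ.dom ∩ χ.dom) =>
      (χ.basis x x.2.2).repr ((g x ∘ₗ f x) (φ.basis x x.2.1 j)) i) =
      fun x : ↥(φ.dom ∩ χ.dom) => ∑ k : ψ.ι,
        (ψ.basis x (hsub x.2)).repr (f x (φ.basis x x.2.1 j)) k *
        (χ.basis x x.2.2).repr (g x (ψ.basis x (hsub x.2) k)) i := by
    funext x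
    rw [LinearMap.comp_apply]
    conv_lhs => rw [← (ψ.basis x (hsub x.2)).sum_repr (f x (φ.basis x x.2.1 j))]
    rw [map_sum, map_sum, Finsupp.finsetSum_apply]
    simp only [map_smul, Finsupp.smul_apply, smul_eq_mul]
  rw [key]
  refine continuous_finsetSum _ fun k _ => ?_
  exact ((hf k j).comp (continuous_inclusion
      (show φ.dom ∩ χ.dom ⊆ φ.dom ∩ ψ.dom from fun x hx => ⟨hx.1, hsub hx⟩))).mul
    ((hg i k).comp (continuous_inclusion
      (show φ.dom ∩ χ.dom ⊆ ψ.dom ∩ χ.dom from fun x hx => ⟨hsub hx, hx.2⟩)))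

lemma matrixContinuous_of_local {φ : LocalFrame E} {ψ : LocalFrame F} {f : ∀ x, E x →ₗ[ℂ] F x}
    (h : ∀ x ∈ φ.dom ∩ ψ.dom, ∃ (W : Set X) (hW : IsOpen W), x ∈ W ∧
      (φ.restrict W hW).MatrixContinuous ψ f) : φ.MatrixContinuous ψ f := by
  intro i j
  rw [continuous_iff_continuousAt]
  rintro ⟨x, hx⟩
  obtain ⟨W, hW, hxW, hc⟩ := h x hx
  have hsub : (φ.restrict W hW).dom ∩ ψ.dom ⊆ φ.dom ∩ ψ.dom := fun _ hx => ⟨hx.1.1, hx.2⟩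
  have hemb : Topology.IsOpenEmbedding (Set.inclusion hsub) := by
    refine Topology.IsOpenEmbedding.mk (Topology.IsEmbedding.inclusion hsub) ?_
    rw [Set.range_inclusion]
    exact (((φ.restrict W hW).isOpen_dom).inter ψ.isOpen_dom).preimage continuous_subtype_val
  have h2 := (hc i j).continuousAt (x := ⟨x, ⟨hx.1, hxW⟩, hx.2⟩)
  exact (hemb.continuousAt_iff (x := ⟨x, ⟨hx.1, hxW⟩, hx.2⟩)
    (g := fun x : ↥(φ.dom ∩ ψ.dom) =>
      (ψ.basis x x.2.2).repr (f x (φ.basis x x.2.1 j)) i)).1 h2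

lemma MatrixContinuous.add {φ : LocalFrame E} {ψ : LocalFrame F} {f g : ∀ x, E x →ₗ[ℂ] F x}
    (hf : φ.MatrixContinuous ψ f) (hg : φ.MatrixContinuous ψ g) :
    φ.MatrixContinuous ψ (fun x => f x + g x) := fun i j => by
  simpa [Pi.add_def] using (hf i j).add (hg i j)

lemma MatrixContinuous.smul {φ : LocalFrame E} {ψ : LocalFrame F} {f : ∀ x, E x →ₗ[ℂ] F x}
    (c : ℂ) (hf : φ.MatrixContinuous ψ f) :
    φ.MatrixContinuous ψ (fun x => c • f x) := fun i j => by
  simpa using (hf i j).const_mul c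

lemma MatrixContinuous.zero (φ : LocalFrame E) (ψ : LocalFrame F) :
    φ.MatrixContinuous ψ (fun _ => 0) := fun i j => by
  simpa using continuous_const

lemma matrixContinuous_of_basis {φ : LocalFrame E} {ψ : LocalFrame F} {f : ∀ x, E x →ₗ[ℂ] F x}
    (e : φ.ι → ψ.ι)
    (h : ∀ x (hx : x ∈ φ.dom) (hx' : x ∈ ψ.dom) j, f x (φ.basis x hx j) = ψ.basis x hx' (e j)) :
    φ.MatrixContinuous ψ f := fun i j => by
  have : (fun x : ↥(φ.dom ∩ ψ.dom) => (ψ.basis x x.2.2).repr (f x (φ.basis x x.2.1 j)) i) =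
      fun _ => Finsupp.single (e j) (1 : ℂ) i := by
    funext x
    rw [h x x.2.1 x.2.2, Module.Basis.repr_self]
  rw [this]
  exact continuous_const

end basics

section constructions

variable {X : Type u} [TopologicalSpace X]
  {E : X → Type} [∀ x, AddCommGroup (E x)] [∀ x, Module ℂ (E x)]
  {F : X → Type} [∀ x, AddCommGroup (F x)] [∀ x, Module ℂ (F x)]
  {E' : X → Type} [∀ x, AddCommGroup (E' x)] [∀ x, Module ℂ (E' x)]
  {F' : X → Type} [∀ x, AddCommGroup (F' x)] [∀ x, Module ℂ (F' x)]

/-- The frame `(e_i, 0), (0, f_j)` of a fibrewise direct sum. -/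
noncomputable abbrev prod (φ : LocalFrame E) (ψ : LocalFrame F) :
    LocalFrame (fun x => E x × F x) where
  dom := φ.dom ∩ ψ.dom
  isOpen_dom := φ.isOpen_dom.inter ψ.isOpen_dom
  ι := φ.ι ⊕ ψ.ι
  basis x hx := (φ.basis x hx.1).prod (ψ.basis x hx.2)

/-- The frame `e_i ⊗ f_j` of a fibrewise tensor product. -/
noncomputable abbrev tensor (φ : LocalFrame E) (ψ : LocalFrame F) :
    LocalFrame (fun x => E x ⊗[ℂ] F x) where
  dom := φ.dom ∩ ψ.dom
  isOpen_dom := φ.isOpen_dom.inter ψ.isOpen_dom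
  ι := φ.ι × ψ.ι
  basis x hx := (φ.basis x hx.1).tensorProduct (ψ.basis x hx.2)

/-- The frame `e_{i₁} ∧ ⋯ ∧ e_{iₖ}` (`i₁ < ⋯ < iₖ` for some numbering of the indices) of a
fibrewise exterior power. -/
noncomputable abbrev exteriorPower (k : ℕ) (φ : LocalFrame E) :
    LocalFrame (fun x => ⋀[ℂ]^k (E x)) where
  dom := φ.dom
  isOpen_dom := φ.isOpen_dom
  ι := Set.powersetCard (Fin (Nat.card φ.ι)) k
  basis x hx := ((φ.basis x hx).reindex (Finite.equivFin φ.ι)).exteriorPower k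

/-- The pullback of a frame along a continuous map. -/
abbrev pullback {Y : Type v} [TopologicalSpace Y] (f : C(Y, X)) (φ : LocalFrame E) :
    LocalFrame (fun y => E (f y)) where
  dom := f ⁻¹' φ.dom
  isOpen_dom := φ.isOpen_dom.preimage f.continuous
  ι := φ.ι
  basis y hy := φ.basis (f y) hy

lemma MatrixContinuous.prodMap {φ : LocalFrame E} {ψ : LocalFrame F}
    {φ' : LocalFrame E'} {ψ' : LocalFrame F'}
    {f : ∀ x, E x →ₗ[ℂ] E' x} {g : ∀ x, F x →ₗ[ℂ] F' x}
    (hf : φ.MatrixContinuous φ' f) (hg : ψ.MatrixContinuous ψ' g) :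
    (φ.prod ψ).MatrixContinuous (φ'.prod ψ') (fun x => (f x).prodMap (g x)) := by
  have s1 : (φ.prod ψ).dom ∩ (φ'.prod ψ').dom ⊆ φ.dom ∩ φ'.dom :=
    fun x hx => ⟨hx.1.1, hx.2.1⟩
  have s2 : (φ.prod ψ).dom ∩ (φ'.prod ψ').dom ⊆ ψ.dom ∩ ψ'.dom :=
    fun x hx => ⟨hx.1.2, hx.2.2⟩
  rintro (i | i) (j | j)
  · simpa [LocalFrame.prod, Function.comp_def] using (hf i j).comp (continuous_inclusion s1)
  · simpa [LocalFrame.prod] using continuous_const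
  · simpa [LocalFrame.prod] using continuous_const
  · simpa [LocalFrame.prod, Function.comp_def] using (hg i j).comp (continuous_inclusion s2)

lemma MatrixContinuous.tensorMap {φ : LocalFrame E} {ψ : LocalFrame F}
    {φ' : LocalFrame E'} {ψ' : LocalFrame F'}
    {f : ∀ x, E x →ₗ[ℂ] E' x} {g : ∀ x, F x →ₗ[ℂ] F' x}
    (hf : φ.MatrixContinuous φ' f) (hg : ψ.MatrixContinuous ψ' g) :
    (φ.tensor ψ).MatrixContinuous (φ'.tensor ψ') (fun x => TensorProduct.map (f x) (g x)) := by
  have s1 : (φ.tensor ψ).dom ∩ (φ'.tensor ψ').dom ⊆ φ.dom ∩ φ'.dom :=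
    fun x hx => ⟨hx.1.1, hx.2.1⟩
  have s2 : (φ.tensor ψ).dom ∩ (φ'.tensor ψ').dom ⊆ ψ.dom ∩ ψ'.dom :=
    fun x hx => ⟨hx.1.2, hx.2.2⟩
  rintro ⟨i, i'⟩ ⟨j, j'⟩
  refine (((hf i j).comp (continuous_inclusion s1)).mul
    ((hg i' j').comp (continuous_inclusion s2))).congr fun x => ?_
  rw [Module.Basis.tensorProduct_apply, TensorProduct.map_tmul,
    Module.Basis.tensorProduct_repr_tmul_apply, smul_eq_mul, mul_comm]
  rfl

lemma MatrixContinuous.exteriorPowerMap (k : ℕ) {φ : LocalFrame E} {φ' : LocalFrame E'}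
    {f : ∀ x, E x →ₗ[ℂ] E' x} (hf : φ.MatrixContinuous φ' f) :
    (φ.exteriorPower k).MatrixContinuous (φ'.exteriorPower k)
      (fun x => _root_.exteriorPower.map k (f x)) := by
  intro s t
  have key : (fun x : ↥((φ.exteriorPower k).dom ∩ (φ'.exteriorPower k).dom) =>
      ((φ'.exteriorPower k).basis x x.2.2).repr
        (_root_.exteriorPower.map k (f x) ((φ.exteriorPower k).basis x x.2.1 t)) s) =
      fun x : ↥(φ.dom ∩ φ'.dom) => (Matrix.of fun a b : Fin k =>
        (φ'.basis x x.2.2).repr (f x (φ.basis x x.2.1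
          ((Finite.equivFin φ.ι).symm (Set.powersetCard.ofFinEmbEquiv.symm t a))))
          ((Finite.equivFin φ'.ι).symm (Set.powersetCard.ofFinEmbEquiv.symm s b))).det := by
    funext x
    simp only [LocalFrame.exteriorPower]
    rw [_root_.exteriorPower.basis_repr_apply, _root_.exteriorPower.basis_apply,
      _root_.exteriorPower.ιMulti_family, _root_.exteriorPower.map_apply_ιMulti,
      _root_.exteriorPower.ιMultiDual_apply_ιMulti]
    congr 1
    ext a b
    simp
  rw [key]
  refine Continuous.matrix_det ?_
  refine continuous_matrix fun a b => ?_
  exact hf _ _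

lemma MatrixContinuous.pullback {Y : Type v} [TopologicalSpace Y] (p : C(Y, X))
    {φ : LocalFrame E} {φ' : LocalFrame E'}
    {f : ∀ x, E x →ₗ[ℂ] E' x} (hf : φ.MatrixContinuous φ' f) :
    (φ.pullback p).MatrixContinuous (φ'.pullback p) (fun y => f (p y)) := fun i j =>
  (hf i j).comp (f := fun y : ↥((φ.pullback p).dom ∩ (φ'.pullback p).dom) =>
    (⟨p y, y.2⟩ : ↥(φ.dom ∩ φ'.dom)))
    ((p.continuous.comp continuous_subtype_val).subtype_mk _)

end constructions

end LocalFrame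

/-- A (topological, finite rank) complex vector bundle on `X`. -/
structure ComplexVectorBundle (X : Type u) [TopologicalSpace X] where
  fiber : X → Type
  [addCommGroup : ∀ x, AddCommGroup (fiber x)]
  [module : ∀ x, Module ℂ (fiber x)]
  atlas : Set (LocalFrame fiber)
  covers : ∀ x, ∃ φ ∈ atlas, x ∈ φ.dom
  compatible : ∀ φ ∈ atlas, ∀ ψ ∈ atlas, φ.MatrixContinuous ψ (fun _ => LinearMap.id)

namespace ComplexVectorBundle

attribute [instance] ComplexVectorBundle.addCommGroup ComplexVectorBundle.module

section maps

variable {X : Type u} [TopologicalSpace X]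

/-- A family of linear maps between the fibres of two bundles is a bundle map if its matrix
entries in the frames of the two atlases are continuous. -/
def IsBundleMap (E F : ComplexVectorBundle X) (f : ∀ x, E.fiber x →ₗ[ℂ] F.fiber x) : Prop :=
  ∀ φ ∈ E.atlas, ∀ ψ ∈ F.atlas, φ.MatrixContinuous ψ f

variable {E F H : ComplexVectorBundle X}

lemma isBundleMap_of_local {f : ∀ x, E.fiber x →ₗ[ℂ] F.fiber x}
    (h : ∀ x, ∃ φ ∈ E.atlas, ∃ ψ ∈ F.atlas, x ∈ φ.dom ∧ x ∈ ψ.dom ∧ φ.MatrixContinuous ψ f) :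
    IsBundleMap E F f := by
  intro φ hφ ψ hψ
  refine LocalFrame.matrixContinuous_of_local fun x _ => ?_
  obtain ⟨φ', hφ', ψ', hψ', hx, hx', hc⟩ := h x
  refine ⟨φ'.dom ∩ ψ'.dom, φ'.isOpen_dom.inter ψ'.isOpen_dom, ⟨hx, hx'⟩, ?_⟩
  have h1 := ((E.compatible φ hφ φ' hφ').restrict (φ'.dom ∩ ψ'.dom)
    (φ'.isOpen_dom.inter ψ'.isOpen_dom)).comp hc (fun y hy => hy.1.2.1)
  exact h1.comp (F.compatible ψ' hψ' ψ hψ) (fun y hy => hy.1.2.2)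

lemma isBundleMap_id (E : ComplexVectorBundle X) : IsBundleMap E E (fun _ => LinearMap.id) :=
  fun φ hφ ψ hψ => E.compatible φ hφ ψ hψ

lemma IsBundleMap.comp {f : ∀ x, E.fiber x →ₗ[ℂ] F.fiber x} {g : ∀ x, F.fiber x →ₗ[ℂ] H.fiber x}
    (hf : IsBundleMap E F f) (hg : IsBundleMap F H g) :
    IsBundleMap E H (fun x => g x ∘ₗ f x) := by
  intro φ hφ ψ hψ
  refine LocalFrame.matrixContinuous_of_local fun x _ => ?_
  obtain ⟨χ, hχ, hx⟩ := F.covers x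
  exact ⟨χ.dom, χ.isOpen_dom, hx,
    ((hf φ hφ χ hχ).restrict χ.dom χ.isOpen_dom).comp (hg χ hχ ψ hψ) fun y hy => hy.1.2⟩

/-- Two bundles are isomorphic if there is a fibrewise linear isomorphism between them which is a
bundle map in both directions. -/
def Iso (E F : ComplexVectorBundle X) : Prop :=
  ∃ f : ∀ x, E.fiber x ≃ₗ[ℂ] F.fiber x,
    IsBundleMap E F (fun x => (f x).toLinearMap) ∧
    IsBundleMap F E (fun x => (f x).symm.toLinearMap)

lemma iso_of_basis (f : ∀ x, E.fiber x ≃ₗ[ℂ] F.fiber x)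
    (h : ∀ x, ∃ φ ∈ E.atlas, ∃ ψ ∈ F.atlas, x ∈ φ.dom ∧ x ∈ ψ.dom ∧ ∃ e : φ.ι ≃ ψ.ι,
      ∀ y (hy : y ∈ φ.dom) (hy' : y ∈ ψ.dom) j, f y (φ.basis y hy j) = ψ.basis y hy' (e j)) :
    Iso E F := by
  refine ⟨f, isBundleMap_of_local fun x => ?_, isBundleMap_of_local fun x => ?_⟩
  · obtain ⟨φ, hφ, ψ, hψ, hx, hx', e, he⟩ := h x
    exact ⟨φ, hφ, ψ, hψ, hx, hx', LocalFrame.matrixContinuous_of_basis e he⟩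
  · obtain ⟨φ, hφ, ψ, hψ, hx, hx', e, he⟩ := h x
    refine ⟨ψ, hψ, φ, hφ, hx', hx, LocalFrame.matrixContinuous_of_basis e.symm ?_⟩
    intro y hy hy' j
    have := he y hy' hy (e.symm j)
    rw [Equiv.apply_symm_apply] at this
    rw [← this]
    simp

lemma Iso.refl (E : ComplexVectorBundle X) : Iso E E :=
  ⟨fun _ => LinearEquiv.refl ℂ _, isBundleMap_id E, isBundleMap_id E⟩

lemma Iso.symm (h : Iso E F) : Iso F E := by
  obtain ⟨f, h1, h2⟩ := h
  exact ⟨fun x => (f x).symm, h2, h1⟩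

lemma Iso.trans (h : Iso E F) (h' : Iso F H) : Iso E H := by
  obtain ⟨f, h1, h2⟩ := h
  obtain ⟨g, h3, h4⟩ := h'
  exact ⟨fun x => (f x).trans (g x), h1.comp h3, h4.comp h2⟩

instance setoid (X : Type u) [TopologicalSpace X] : Setoid (ComplexVectorBundle X) where
  r := Iso
  iseqv := ⟨Iso.refl, Iso.symm, Iso.trans⟩

end maps

section constructions

variable {X : Type u} [TopologicalSpace X]

/-- The zero bundle. -/
noncomputable def zero (X : Type u) [TopologicalSpace X] : ComplexVectorBundle X where
  fiber _ := PUnit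
  atlas := {{ dom := Set.univ, isOpen_dom := isOpen_univ, ι := Empty,
              basis := fun _ _ => Module.Basis.empty PUnit }}
  covers x := ⟨_, rfl, Set.mem_univ x⟩
  compatible := by
    rintro φ rfl ψ rfl i
    exact i.elim

/-- The trivial line bundle. -/
noncomputable def one (X : Type u) [TopologicalSpace X] : ComplexVectorBundle X where
  fiber _ := ℂ
  atlas := {{ dom := Set.univ, isOpen_dom := isOpen_univ, ι := Unit,
              basis := fun _ _ => Module.Basis.singleton Unit ℂ }}
  covers x := ⟨_, rfl, Set.mem_univ x⟩
  compatible := by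
    rintro φ rfl ψ rfl
    exact LocalFrame.matrixContinuous_of_basis id fun _ _ _ _ => rfl

/-- The direct sum (Whitney sum) `E ⊕ F`. -/
noncomputable def directSum (E F : ComplexVectorBundle X) : ComplexVectorBundle X where
  fiber x := E.fiber x × F.fiber x
  atlas := Set.image2 LocalFrame.prod E.atlas F.atlas
  covers x := by
    obtain ⟨φ, hφ, hx⟩ := E.covers x
    obtain ⟨ψ, hψ, hx'⟩ := F.covers x
    exact ⟨_, ⟨φ, hφ, ψ, hψ, rfl⟩, hx, hx'⟩
  compatible := by
    rintro _ ⟨φ, hφ, ψ, hψ, rfl⟩ _ ⟨φ', hφ', ψ', hψ', rfl⟩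
    have := (E.compatible φ hφ φ' hφ').prodMap (F.compatible ψ hψ ψ' hψ')
    simpa only [LinearMap.prodMap_id] using this

/-- The tensor product `E ⊗ F`. -/
noncomputable def tensor (E F : ComplexVectorBundle X) : ComplexVectorBundle X where
  fiber x := E.fiber x ⊗[ℂ] F.fiber x
  atlas := Set.image2 LocalFrame.tensor E.atlas F.atlas
  covers x := by
    obtain ⟨φ, hφ, hx⟩ := E.covers x
    obtain ⟨ψ, hψ, hx'⟩ := F.covers x
    exact ⟨_, ⟨φ, hφ, ψ, hψ, rfl⟩, hx, hx'⟩
  compatible := by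
    rintro _ ⟨φ, hφ, ψ, hψ, rfl⟩ _ ⟨φ', hφ', ψ', hψ', rfl⟩
    have := (E.compatible φ hφ φ' hφ').tensorMap (F.compatible ψ hψ ψ' hψ')
    simpa only [TensorProduct.map_id] using this

/-- The exterior power `Λ^k E`. -/
noncomputable def exteriorPower (k : ℕ) (E : ComplexVectorBundle X) : ComplexVectorBundle X where
  fiber x := ⋀[ℂ]^k (E.fiber x)
  atlas := LocalFrame.exteriorPower k '' E.atlas
  covers x := by
    obtain ⟨φ, hφ, hx⟩ := E.covers x
    exact ⟨_, ⟨φ, hφ, rfl⟩, hx⟩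
  compatible := by
    rintro _ ⟨φ, hφ, rfl⟩ _ ⟨φ', hφ', rfl⟩
    have := (E.compatible φ hφ φ' hφ').exteriorPowerMap k
    simpa only [_root_.exteriorPower.map_id] using this

/-- The pullback `f^* E`. -/
def pullback {Y : Type v} [TopologicalSpace Y] (f : C(Y, X)) (E : ComplexVectorBundle X) :
    ComplexVectorBundle Y where
  fiber y := E.fiber (f y)
  atlas := LocalFrame.pullback f '' E.atlas
  covers y := by
    obtain ⟨φ, hφ, hx⟩ := E.covers (f y)
    exact ⟨_, ⟨φ, hφ, rfl⟩, hx⟩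
  compatible := by
    rintro _ ⟨φ, hφ, rfl⟩ _ ⟨φ', hφ', rfl⟩
    exact (E.compatible φ hφ φ' hφ').pullback f

lemma IsBundleMap.pullback {Y : Type v} [TopologicalSpace Y] (p : C(Y, X))
    {E F : ComplexVectorBundle X} {f : ∀ x, E.fiber x →ₗ[ℂ] F.fiber x} (hf : IsBundleMap E F f) :
    IsBundleMap (E.pullback p) (F.pullback p) (fun y => f (p y)) := by
  rintro _ ⟨φ, hφ, rfl⟩ _ ⟨φ', hφ', rfl⟩
  exact (hf φ hφ φ' hφ').pullback p

variable {E E' F F' H : ComplexVectorBundle X}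

lemma Iso.pullback {Y : Type v} [TopologicalSpace Y] (p : C(Y, X)) (h : Iso E F) :
    Iso (E.pullback p) (F.pullback p) := by
  obtain ⟨f, h1, h2⟩ := h
  exact ⟨fun y => f (p y), h1.pullback p, h2.pullback p⟩

lemma Iso.directSum (h : Iso E E') (h' : Iso F F') : Iso (E.directSum F) (E'.directSum F') := by
  obtain ⟨f, h1, h2⟩ := h
  obtain ⟨g, h3, h4⟩ := h'
  refine ⟨fun x => (f x).prodCongr (g x), ?_, ?_⟩
  · rintro _ ⟨φ, hφ, ψ, hψ, rfl⟩ _ ⟨φ', hφ', ψ', hψ', rfl⟩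
    exact (h1 φ hφ φ' hφ').prodMap (h3 ψ hψ ψ' hψ')
  · rintro _ ⟨φ, hφ, ψ, hψ, rfl⟩ _ ⟨φ', hφ', ψ', hψ', rfl⟩
    exact (h2 φ hφ φ' hφ').prodMap (h4 ψ hψ ψ' hψ')

lemma Iso.tensor (h : Iso E E') (h' : Iso F F') : Iso (E.tensor F) (E'.tensor F') := by
  obtain ⟨f, h1, h2⟩ := h
  obtain ⟨g, h3, h4⟩ := h'
  refine ⟨fun x => TensorProduct.congr (f x) (g x), ?_, ?_⟩
  · rintro _ ⟨φ, hφ, ψ, hψ, rfl⟩ _ ⟨φ', hφ', ψ', hψ', rfl⟩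
    exact (h1 φ hφ φ' hφ').tensorMap (h3 ψ hψ ψ' hψ')
  · rintro _ ⟨φ, hφ, ψ, hψ, rfl⟩ _ ⟨φ', hφ', ψ', hψ', rfl⟩
    exact (h2 φ hφ φ' hφ').tensorMap (h4 ψ hψ ψ' hψ')

variable (E F H)

lemma pullback_directSum {Y : Type v} [TopologicalSpace Y] (p : C(Y, X)) :
    Iso ((E.directSum F).pullback p) ((E.pullback p).directSum (F.pullback p)) := by
  refine iso_of_basis (fun y => LinearEquiv.refl ℂ _) fun y => ?_
  obtain ⟨φ, hφ, hx⟩ := E.covers (p y)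
  obtain ⟨ψ, hψ, hx'⟩ := F.covers (p y)
  exact ⟨_, ⟨_, ⟨φ, hφ, ψ, hψ, rfl⟩, rfl⟩, _, ⟨_, ⟨φ, hφ, rfl⟩, _, ⟨ψ, hψ, rfl⟩, rfl⟩,
    ⟨hx, hx'⟩, ⟨hx, hx'⟩, Equiv.refl _, fun _ _ _ _ => rfl⟩

lemma pullback_zero {Y : Type v} [TopologicalSpace Y] (p : C(Y, X)) :
    Iso ((zero X).pullback p) (zero Y) := by
  refine iso_of_basis (fun y => LinearEquiv.refl ℂ _) fun y => ?_
  exact ⟨_, ⟨_, rfl, rfl⟩, _, rfl, trivial, trivial, Equiv.refl _, fun _ _ _ j => j.elim⟩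

section bases

variable {A B C : Type*} [AddCommGroup A] [Module ℂ A] [AddCommGroup B] [Module ℂ B]
  [AddCommGroup C] [Module ℂ C] {ι κ μ : Type*}
  (a : Module.Basis ι ℂ A) (b : Module.Basis κ ℂ B) (c : Module.Basis μ ℂ C)

lemma basis_prodComm (j : ι ⊕ κ) :
    LinearEquiv.prodComm ℂ A B (a.prod b j) = b.prod a (Equiv.sumComm ι κ j) := by
  rcases j with j | j <;> ext <;> simp

lemma basis_prodAssoc (j : (ι ⊕ κ) ⊕ μ) :
    LinearEquiv.prodAssoc ℂ A B C ((a.prod b).prod c j) =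
      a.prod (b.prod c) (Equiv.sumAssoc ι κ μ j) := by
  rcases j with (j | j) | j <;> ext <;> simp

lemma basis_tensorComm (j : ι × κ) :
    TensorProduct.comm ℂ A B (a.tensorProduct b j) =
      b.tensorProduct a (Equiv.prodComm ι κ j) := by
  obtain ⟨i, j⟩ := j
  simp [Module.Basis.tensorProduct_apply]

lemma basis_tensorAssoc (j : (ι × κ) × μ) :
    TensorProduct.assoc ℂ A B C ((a.tensorProduct b).tensorProduct c j) =
      a.tensorProduct (b.tensorProduct c) (Equiv.prodAssoc ι κ μ j) := by
  obtain ⟨⟨i, j⟩, k⟩ := j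
  simp [Module.Basis.tensorProduct_apply]

lemma basis_prodRight (j : ι × (κ ⊕ μ)) :
    TensorProduct.prodRight ℂ ℂ A B C (a.tensorProduct (b.prod c) j) =
      (a.tensorProduct b).prod (a.tensorProduct c) (Equiv.prodSumDistrib ι κ μ j) := by
  obtain ⟨i, j | j⟩ := j <;> ext <;> simp [Module.Basis.tensorProduct_apply]

lemma basis_lid (j : Unit × ι) :
    TensorProduct.lid ℂ A ((Module.Basis.singleton Unit ℂ).tensorProduct a j) =
      a (Equiv.punitProd ι j) := by
  obtain ⟨i, j⟩ := j
  simp [Module.Basis.tensorProduct_apply]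

lemma basis_uniqueProd (j : Empty ⊕ ι) :
    (LinearEquiv.uniqueProd : (PUnit.{1} × A) ≃ₗ[ℂ] A)
      ((Module.Basis.empty PUnit.{1}).prod a j) = a (Equiv.emptySum Empty ι j) := by
  rcases j with j | j
  · exact j.elim
  · simp

end bases

lemma directSum_comm : Iso (E.directSum F) (F.directSum E) := by
  refine iso_of_basis (fun y => LinearEquiv.prodComm ℂ _ _) fun y => ?_
  obtain ⟨φ, hφ, hx⟩ := E.covers y
  obtain ⟨ψ, hψ, hx'⟩ := F.covers y
  refine ⟨_, ⟨φ, hφ, ψ, hψ, rfl⟩, _, ⟨ψ, hψ, φ, hφ, rfl⟩, ⟨hx, hx'⟩, ⟨hx', hx⟩,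
    Equiv.sumComm _ _, ?_⟩
  exact fun z hz hz' j => basis_prodComm _ _ j

lemma directSum_assoc :
    Iso ((E.directSum F).directSum H) (E.directSum (F.directSum H)) := by
  refine iso_of_basis (fun y => LinearEquiv.prodAssoc ℂ _ _ _) fun y => ?_
  obtain ⟨φ, hφ, hx⟩ := E.covers y
  obtain ⟨ψ, hψ, hx'⟩ := F.covers y
  obtain ⟨χ, hχ, hx''⟩ := H.covers y
  refine ⟨_, ⟨_, ⟨φ, hφ, ψ, hψ, rfl⟩, χ, hχ, rfl⟩, _, ⟨φ, hφ, _, ⟨ψ, hψ, χ, hχ, rfl⟩, rfl⟩,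
    ⟨⟨hx, hx'⟩, hx''⟩, ⟨hx, hx', hx''⟩, Equiv.sumAssoc _ _ _, ?_⟩
  exact fun z hz hz' j => basis_prodAssoc _ _ _ j

lemma zero_directSum : Iso ((zero X).directSum E) E := by
  refine iso_of_basis (fun y => (LinearEquiv.uniqueProd : (PUnit.{1} × E.fiber y) ≃ₗ[ℂ] E.fiber y)) fun y => ?_
  obtain ⟨φ, hφ, hx⟩ := E.covers y
  refine ⟨_, ⟨_, rfl, φ, hφ, rfl⟩, φ, hφ, ⟨Set.mem_univ _, hx⟩, hx, Equiv.emptySum _ _, ?_⟩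
  exact fun z hz hz' j => basis_uniqueProd _ j

lemma tensor_comm : Iso (E.tensor F) (F.tensor E) := by
  refine iso_of_basis (fun y => TensorProduct.comm ℂ _ _) fun y => ?_
  obtain ⟨φ, hφ, hx⟩ := E.covers y
  obtain ⟨ψ, hψ, hx'⟩ := F.covers y
  refine ⟨_, ⟨φ, hφ, ψ, hψ, rfl⟩, _, ⟨ψ, hψ, φ, hφ, rfl⟩, ⟨hx, hx'⟩, ⟨hx', hx⟩,
    Equiv.prodComm _ _, ?_⟩
  exact fun z hz hz' j => basis_tensorComm _ _ j

lemma tensor_assoc : Iso ((E.tensor F).tensor H) (E.tensor (F.tensor H)) := by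
  refine iso_of_basis (fun y => TensorProduct.assoc ℂ _ _ _) fun y => ?_
  obtain ⟨φ, hφ, hx⟩ := E.covers y
  obtain ⟨ψ, hψ, hx'⟩ := F.covers y
  obtain ⟨χ, hχ, hx''⟩ := H.covers y
  refine ⟨_, ⟨_, ⟨φ, hφ, ψ, hψ, rfl⟩, χ, hχ, rfl⟩, _, ⟨φ, hφ, _, ⟨ψ, hψ, χ, hχ, rfl⟩, rfl⟩,
    ⟨⟨hx, hx'⟩, hx''⟩, ⟨hx, hx', hx''⟩, Equiv.prodAssoc _ _ _, ?_⟩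
  exact fun z hz hz' j => basis_tensorAssoc _ _ _ j

lemma one_tensor : Iso ((one X).tensor E) E := by
  refine iso_of_basis (fun y => TensorProduct.lid ℂ _) fun y => ?_
  obtain ⟨φ, hφ, hx⟩ := E.covers y
  refine ⟨_, ⟨_, rfl, φ, hφ, rfl⟩, φ, hφ, ⟨Set.mem_univ _, hx⟩, hx, Equiv.punitProd _, ?_⟩
  exact fun z hz hz' j => basis_lid _ j

lemma zero_tensor : Iso ((zero X).tensor E) (zero X) := by
  refine iso_of_basis (fun y =>
    (LinearEquiv.ofSubsingleton _ _ : (PUnit.{1} ⊗[ℂ] E.fiber y) ≃ₗ[ℂ] PUnit.{1})) fun y => ?_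
  obtain ⟨φ, hφ, hx⟩ := E.covers y
  refine ⟨_, ⟨_, rfl, φ, hφ, rfl⟩, _, rfl, ⟨Set.mem_univ _, hx⟩, Set.mem_univ _,
    Equiv.equivOfIsEmpty _ _, ?_⟩
  rintro z hz hz' ⟨i, j⟩
  exact i.elim

lemma tensor_directSum :
    Iso (E.tensor (F.directSum H)) ((E.tensor F).directSum (E.tensor H)) := by
  refine iso_of_basis (fun y => TensorProduct.prodRight ℂ ℂ _ _ _) fun y => ?_
  obtain ⟨φ, hφ, hx⟩ := E.covers y
  obtain ⟨ψ, hψ, hx'⟩ := F.covers y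
  obtain ⟨χ, hχ, hx''⟩ := H.covers y
  refine ⟨_, ⟨φ, hφ, _, ⟨ψ, hψ, χ, hχ, rfl⟩, rfl⟩,
    _, ⟨_, ⟨φ, hφ, ψ, hψ, rfl⟩, _, ⟨φ, hφ, χ, hχ, rfl⟩, rfl⟩,
    ⟨hx, hx', hx''⟩, ⟨⟨hx, hx'⟩, ⟨hx, hx''⟩⟩, Equiv.prodSumDistrib _ _ _, ?_⟩
  exact fun z hz hz' j => basis_prodRight _ _ _ j

end constructions

end ComplexVectorBundle

/-! ### The Grothendieck ring of vector bundles -/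

section KTheory

/-- Isomorphism classes of complex vector bundles on `X`. -/
def BundleClass (X : Type u) [TopologicalSpace X] : Type (max u 1) :=
  Quotient (ComplexVectorBundle.setoid X)

namespace BundleClass

variable {X : Type u} [TopologicalSpace X]

/-- The isomorphism class of a bundle. -/
def mk (E : ComplexVectorBundle X) : BundleClass X := Quotient.mk _ E

lemma mk_eq {E F : ComplexVectorBundle X} (h : E.Iso F) : mk E = mk F := Quotient.sound h

/-- `[E] + [F] = [E ⊕ F]`. -/
noncomputable instance : Add (BundleClass X) where
  add := Quotient.map₂ ComplexVectorBundle.directSum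
    fun _ _ h _ _ h' => ComplexVectorBundle.Iso.directSum h h'

/-- `[E] * [F] = [E ⊗ F]`. -/
noncomputable instance : Mul (BundleClass X) where
  mul := Quotient.map₂ ComplexVectorBundle.tensor
    fun _ _ h _ _ h' => ComplexVectorBundle.Iso.tensor h h'

noncomputable instance : Zero (BundleClass X) := ⟨mk (ComplexVectorBundle.zero X)⟩

noncomputable instance : One (BundleClass X) := ⟨mk (ComplexVectorBundle.one X)⟩

open ComplexVectorBundle in
/-- Isomorphism classes form a commutative semiring under `⊕` and `⊗`. -/
noncomputable instance : CommSemiring (BundleClass X) where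
  add_assoc := by
    rintro ⟨E⟩ ⟨F⟩ ⟨H⟩
    exact mk_eq (directSum_assoc E F H)
  zero_add := by
    rintro ⟨E⟩
    exact mk_eq (zero_directSum E)
  add_zero := by
    rintro ⟨E⟩
    exact mk_eq ((directSum_comm E _).trans (zero_directSum E))
  add_comm := by
    rintro ⟨E⟩ ⟨F⟩
    exact mk_eq (directSum_comm E F)
  mul_assoc := by
    rintro ⟨E⟩ ⟨F⟩ ⟨H⟩
    exact mk_eq (tensor_assoc E F H)
  one_mul := by
    rintro ⟨E⟩
    exact mk_eq (one_tensor E)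
  mul_one := by
    rintro ⟨E⟩
    exact mk_eq ((tensor_comm E _).trans (one_tensor E))
  mul_comm := by
    rintro ⟨E⟩ ⟨F⟩
    exact mk_eq (tensor_comm E F)
  zero_mul := by
    rintro ⟨E⟩
    exact mk_eq (zero_tensor E)
  mul_zero := by
    rintro ⟨E⟩
    exact mk_eq ((tensor_comm E _).trans (zero_tensor E))
  left_distrib := by
    rintro ⟨E⟩ ⟨F⟩ ⟨H⟩
    exact mk_eq (tensor_directSum E F H)
  right_distrib := by
    rintro ⟨E⟩ ⟨F⟩ ⟨H⟩
    exact mk_eq ((tensor_comm _ H).trans ((tensor_directSum H E F).trans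
      ((tensor_comm H E).directSum (tensor_comm H F))))
  nsmul := nsmulRec

/-- Pullback of isomorphism classes. -/
noncomputable def pullback {Y : Type v} [TopologicalSpace Y] (f : C(Y, X)) :
    BundleClass X →+ BundleClass Y where
  toFun := Quotient.map (ComplexVectorBundle.pullback f) fun _ _ h =>
    ComplexVectorBundle.Iso.pullback f h
  map_zero' := mk_eq (ComplexVectorBundle.pullback_zero f)
  map_add' := by
    rintro ⟨E⟩ ⟨F⟩
    exact mk_eq (ComplexVectorBundle.pullback_directSum E F f)

end BundleClass

open Algebra in
/-- The `K`-group `K(X)`: the Grothendieck group of complex vector bundles on `X`. -/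
def KGroup (X : Type u) [TopologicalSpace X] : Type (max u 1) :=
  GrothendieckAddGroup (BundleClass X)

namespace KGroup

open Algebra

variable {X : Type u} [TopologicalSpace X]

noncomputable instance : AddCommGroup (KGroup X) :=
  inferInstanceAs (AddCommGroup (GrothendieckAddGroup (BundleClass X)))

/-- The canonical map from isomorphism classes to `K(X)`. -/
noncomputable def ofClass : BundleClass X →+ KGroup X :=
  GrothendieckAddGroup.of (M := BundleClass X)

/-- The universal property of `K(X)`. -/
noncomputable def lift {A : Type w} [AddCommGroup A] : (BundleClass X →+ A) ≃ (KGroup X →+ A) :=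
  GrothendieckAddGroup.lift (M := BundleClass X) (G := A)

lemma lift_ofClass {A : Type w} [AddCommGroup A] (f : BundleClass X →+ A) (a : BundleClass X) :
    lift f (ofClass a) = f a :=
  DFunLike.congr_fun (lift.symm_apply_apply f) a

lemma hom_ext {A : Type w} [AddCommGroup A] {f g : KGroup X →+ A}
    (h : ∀ a, f (ofClass a) = g (ofClass a)) : f = g :=
  lift.symm.injective (AddMonoidHom.ext h)

/-- The biadditive multiplication of `K(X)` determined by `[E] * [F] = [E ⊗ F]`. -/
noncomputable def mulHom : KGroup X →+ KGroup X →+ KGroup X :=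
  lift
    { toFun := fun a => lift (ofClass.comp (AddMonoidHom.mulLeft a))
      map_zero' := hom_ext fun b => by simp [lift_ofClass]
      map_add' := fun a a' => hom_ext fun b => by simp [lift_ofClass, add_mul] }

lemma mulHom_ofClass (a b : BundleClass X) :
    mulHom (ofClass a) (ofClass b) = ofClass (a * b) := by
  simp [mulHom, lift_ofClass]

noncomputable instance : Mul (KGroup X) := ⟨fun a b => mulHom a b⟩

noncomputable instance : One (KGroup X) := ⟨ofClass 1⟩

lemma mul_def (a b : KGroup X) : a * b = mulHom a b := rfl

lemma ofClass_mul (a b : BundleClass X) : ofClass (a * b) = ofClass a * ofClass b :=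
  (mulHom_ofClass a b).symm

lemma induction {p : KGroup X → Prop} (h1 : ∀ a, p (ofClass a))
    (hadd : ∀ x y, p x → p y → p (x + y)) (hneg : ∀ x, p x → p (-x)) (x : KGroup X) : p x := by
  have key : ∀ (S : AddSubgroup (KGroup X)), (∀ a, ofClass a ∈ S) → S = ⊤ := by
    intro S hS
    have h : QuotientAddGroup.mk' S = 0 := hom_ext fun a => by
      simpa using hS a
    rw [← QuotientAddGroup.ker_mk' S, h]
    exact AddMonoidHom.ker_zero
  let S : AddSubgroup (KGroup X) :=
    { carrier := {x | p x}
      zero_mem' := by simpa using h1 0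
      add_mem' := fun {x y} hx hy => hadd x y hx hy
      neg_mem' := fun {x} hx => hneg x hx }
  have : x ∈ S := by
    rw [key S h1]
    trivial
  exact this

lemma left_distrib' (a b c : KGroup X) : a * (b + c) = a * b + a * c := by
  simp [mul_def]

lemma right_distrib' (a b c : KGroup X) : (a + b) * c = a * c + b * c := by
  simp [mul_def]

lemma neg_mul' (a b : KGroup X) : (-a) * b = -(a * b) := by
  simp [mul_def]

lemma mul_comm' (a b : KGroup X) : a * b = b * a := by
  induction a using induction with
  | h1 a =>
    induction b using induction with
    | h1 b => rw [← ofClass_mul, ← ofClass_mul, mul_comm]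
    | hadd x y hx hy => rw [left_distrib', right_distrib', hx, hy]
    | hneg x hx => rw [neg_mul', ← hx, mul_def, map_neg, mul_def]
  | hadd x y hx hy => rw [left_distrib', right_distrib', hx, hy]
  | hneg x hx => rw [neg_mul', hx, mul_def, mul_def, map_neg]

lemma mul_neg' (a b : KGroup X) : a * (-b) = -(a * b) := by
  simp [mul_def]

lemma mul_assoc' (a b c : KGroup X) : a * b * c = a * (b * c) := by
  induction a using induction with
  | h1 a =>
    induction b using induction with
    | h1 b =>
      induction c using induction with
      | h1 c => rw [← ofClass_mul, ← ofClass_mul, ← ofClass_mul, ← ofClass_mul, mul_assoc]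
      | hadd x y hx hy => simp only [left_distrib', hx, hy]
      | hneg x hx => simp only [mul_neg', hx]
    | hadd x y hx hy => simp only [left_distrib', right_distrib', hx, hy]
    | hneg x hx => simp only [mul_neg', neg_mul', hx]
  | hadd x y hx hy => simp only [right_distrib', hx, hy]
  | hneg x hx => simp only [neg_mul', hx]

lemma one_mul' (a : KGroup X) : 1 * a = a := by
  induction a using induction with
  | h1 a => exact (ofClass_mul 1 a).symm.trans (by rw [one_mul])
  | hadd x y hx hy => rw [left_distrib', hx, hy]
  | hneg x hx => rw [mul_neg', hx]

/-- `K(X)` is a commutative ring under the tensor product. -/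
noncomputable instance : CommRing (KGroup X) where
  __ := (inferInstance : AddCommGroup (KGroup X))
  left_distrib := left_distrib'
  right_distrib := right_distrib'
  zero_mul a := by simp [mul_def]
  mul_zero a := by simp [mul_def]
  mul_assoc := mul_assoc'
  mul_comm := mul_comm'
  one_mul := one_mul'
  mul_one a := (mul_comm' a 1).trans (one_mul' a)

/-- The class `[E]` in `K(X)` of a vector bundle. -/
noncomputable def of (E : ComplexVectorBundle X) : KGroup X := ofClass (BundleClass.mk E)

/-- The pullback `f^* : K(X) → K(Y)`. -/
noncomputable def pullback {Y : Type v} [TopologicalSpace Y] (f : C(Y, X)) : KGroup X →+ KGroup Y :=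
  lift (ofClass.comp (BundleClass.pullback f))

end KGroup

/-- `K(X) ⊗ ℂ`. -/
abbrev KComplex (X : Type u) [TopologicalSpace X] : Type (max u 1) := KGroup X ⊗[ℤ] ℂ

/-- The pullback `f^* : K(X) ⊗ ℂ → K(Y) ⊗ ℂ`. -/
noncomputable def KComplex.pullback {X : Type u} [TopologicalSpace X]
    {Y : Type v} [TopologicalSpace Y] (f : C(Y, X)) : KComplex X →+ KComplex Y :=
  (TensorProduct.map (KGroup.pullback f).toIntLinearMap
    (LinearMap.id : ℂ →ₗ[ℤ] ℂ)).toAddMonoidHom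

/-! ### Adams operations -/

/-- The value in `K(X)` of the Adams operation `ψ^n` on (the class of) a vector bundle `E`, for
`n ≥ 1`: the `n`-th Newton polynomial in `[Λ^1 E], [Λ^2 E], …`, determined by Newton's identities
`ψ^n(E) = ∑_{0 < k < n} (-1)^(k-1) [Λ^k E] ψ^(n-k)(E) + (-1)^(n-1) n [Λ^n E]`,
i.e. the polynomial which expresses the power sum `∑ tᵢ^n` through the elementary symmetric
functions of the `tᵢ`.  (The value at `n = 0` is not meaningful.) -/
noncomputable def adams {X : Type u} [TopologicalSpace X] (E : ComplexVectorBundle X) (n : ℕ) :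
    KGroup X :=
  (∑ k : Fin n, if 0 < (k : ℕ) then
      (-1) ^ ((k : ℕ) - 1) * KGroup.of (E.exteriorPower k) * adams E (n - k) else 0) +
    (-1) ^ (n - 1) * n * KGroup.of (E.exteriorPower n)
termination_by n
decreasing_by omega

end KTheory

/-! ### Subbundles which are images of continuous projections -/

section subbundle

variable {Y : Type u} [TopologicalSpace Y]

/-- The inverse of a square matrix with continuous entries has continuous entries. -/
lemma continuous_nonsing_inv {S : Type*} [TopologicalSpace S] {m : Type*} [Fintype m]
    [DecidableEq m] (A : S → Matrix m m ℂ) (hA : Continuous A) (hd : ∀ s, (A s).det ≠ 0) :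
    Continuous fun s => (A s)⁻¹ := by
  simp only [Matrix.inv_def, Ring.inverse_eq_inv']
  exact (hA.matrix_det.inv₀ hd).smul hA.matrix_adjugate

open scoped ComplexOrder in
/-- If `A c = B` with `A`, `B` continuous and `A` injective, then `c` is continuous. -/
lemma continuous_of_mul_eq {S : Type*} [TopologicalSpace S] {m k l : Type*} [Fintype m]
    [Fintype k] [DecidableEq k] (A : S → Matrix m k ℂ) (B : S → Matrix m l ℂ)
    (c : S → Matrix k l ℂ) (hA : Continuous A) (hB : Continuous B)
    (hinj : ∀ s, Function.Injective (A s).mulVec) (h : ∀ s, A s * c s = B s) : Continuous c := by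
  have hd : ∀ s, ((A s).conjTranspose * A s).det ≠ 0 := fun s =>
    (Matrix.PosDef.conjTranspose_mul_self (A s) (hinj s)).det_pos.ne'
  have hc : c = fun s => ((A s).conjTranspose * A s)⁻¹ * ((A s).conjTranspose * B s) := by
    funext s
    rw [← h s, ← Matrix.mul_assoc, ← Matrix.mul_assoc, Matrix.mul_assoc _ _ (A s),
      Matrix.nonsing_inv_mul _ (isUnit_iff_ne_zero.2 (hd s)), Matrix.one_mul]
  rw [hc]
  exact (continuous_nonsing_inv _ (hA.matrix_conjTranspose.matrix_mul hA) hd).matrix_mul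
    (hA.matrix_conjTranspose.matrix_mul hB)

variable (B : ComplexVectorBundle Y) (W : ∀ y, Submodule ℂ (B.fiber y))

/-- The local frames of a family `W` of subspaces of the fibres of `B` whose members are
continuous sections of `B`. -/
def subAtlas : Set (LocalFrame fun y => W y) :=
  {χ | ∀ φ ∈ B.atlas, χ.MatrixContinuous φ (fun y => (W y).subtype)}

lemma subAtlas_compatible (χ : LocalFrame fun y => W y) (hχ : χ ∈ subAtlas B W)
    (χ' : LocalFrame fun y => W y) (hχ' : χ' ∈ subAtlas B W) :
    χ.MatrixContinuous χ' (fun _ => LinearMap.id) := by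
  classical
  refine LocalFrame.matrixContinuous_of_local fun x _ => ?_
  obtain ⟨φ, hφ, hx⟩ := B.covers x
  refine ⟨φ.dom, φ.isOpen_dom, hx, ?_⟩
  have := Fintype.ofFinite χ.ι
  have := Fintype.ofFinite χ'.ι
  have := Fintype.ofFinite φ.ι
  let S := ↥((χ.restrict φ.dom φ.isOpen_dom).dom ∩ χ'.dom)
  have s1 : (χ.restrict φ.dom φ.isOpen_dom).dom ∩ χ'.dom ⊆ χ'.dom ∩ φ.dom :=
    fun y hy => ⟨hy.2, hy.1.2⟩
  have s2 : (χ.restrict φ.dom φ.isOpen_dom).dom ∩ χ'.dom ⊆ χ.dom ∩ φ.dom :=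
    fun y hy => hy.1
  let A : S → Matrix φ.ι χ'.ι ℂ := fun y => Matrix.of fun i j =>
    (φ.basis y.1 (s1 y.2).2).repr (χ'.basis y.1 (s1 y.2).1 j : B.fiber y.1) i
  let A' : S → Matrix φ.ι χ.ι ℂ := fun y => Matrix.of fun i j =>
    (φ.basis y.1 (s1 y.2).2).repr (χ.basis y.1 (s2 y.2).1 j : B.fiber y.1) i
  let c : S → Matrix χ'.ι χ.ι ℂ := fun y => Matrix.of fun i j =>
    (χ'.basis y.1 (s1 y.2).1).repr (χ.basis y.1 (s2 y.2).1 j) i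
  have hA : Continuous A := continuous_matrix fun i j =>
    (hχ' φ hφ i j).comp (continuous_inclusion s1)
  have hA' : Continuous A' := continuous_matrix fun i j =>
    (hχ φ hφ i j).comp (continuous_inclusion s2)
  have hmul : ∀ (y : S) (v : χ'.ι → ℂ), (A y).mulVec v = fun i =>
      (φ.basis y.1 (s1 y.2).2).repr
        ((∑ j, v j • χ'.basis y.1 (s1 y.2).1 j : W y.1) : B.fiber y.1) i := by
    intro y v
    funext i
    simp [A, Matrix.mulVec, dotProduct, map_sum, Finsupp.finsetSum_apply, mul_comm]
  have hc : Continuous c := by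
    refine continuous_of_mul_eq A A' c hA hA' ?_ ?_
    · intro y v v' h
      rw [hmul, hmul] at h
      have h1 := (φ.basis y.1 (s1 y.2).2).repr.injective (Finsupp.ext fun i => congrFun h i)
      have h2 := Subtype.ext h1
      have h3 : (χ'.basis y.1 (s1 y.2).1).equivFun.symm v =
          (χ'.basis y.1 (s1 y.2).1).equivFun.symm v' := by
        simpa [Module.Basis.equivFun_symm_apply] using h2
      exact (χ'.basis y.1 (s1 y.2).1).equivFun.symm.injective h3
    · intro y
      ext i j
      have := congrFun (hmul y fun k => c y k j) i
      refine this.trans ?_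
      exact congrArg (fun v : W y.1 => (φ.basis y.1 (s1 y.2).2).repr (v : B.fiber y.1) i)
        ((χ'.basis y.1 (s1 y.2).1).sum_repr (χ.basis y.1 (s2 y.2).1 j))
  intro i j
  exact (continuous_apply_apply i j).comp hc

lemma subAtlas_covers (P : ∀ y, B.fiber y →ₗ[ℂ] B.fiber y) (hP : B.IsBundleMap B P)
    (hmem : ∀ y v, P y v ∈ W y) (hfix : ∀ y, ∀ v ∈ W y, P y v = v) (y₀ : Y) :
    ∃ χ ∈ subAtlas B W, y₀ ∈ χ.dom := by
  classical
  obtain ⟨φ, hφ, hy₀⟩ := B.covers y₀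
  have := Fintype.ofFinite φ.ι
  -- the linear map between the fibres over `y₀` and `y` which identifies the two frames
  let τ : ∀ y, y ∈ φ.dom → (B.fiber y₀ ≃ₗ[ℂ] B.fiber y) := fun y hy =>
    (φ.basis y₀ hy₀).equiv (φ.basis y hy) (Equiv.refl _)
  let Z : ∀ y, y ∈ φ.dom → (B.fiber y₀ →ₗ[ℂ] B.fiber y) := fun y hy =>
    P y ∘ₗ (τ y hy).toLinearMap ∘ₗ P y₀ +
      (LinearMap.id - P y) ∘ₗ (τ y hy).toLinearMap ∘ₗ (LinearMap.id - P y₀)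
  have hPP : ∀ y v, P y (P y v) = P y v := fun y v => hfix y _ (hmem y v)
  have hZP : ∀ y hy v, Z y hy (P y₀ v) = P y (Z y hy v) := by
    intro y hy v
    simp [Z, hPP]
  have hPφ : ∀ i j, Continuous fun y : φ.dom =>
      (φ.basis y y.2).repr (P y (φ.basis y y.2 j)) i := fun i j =>
    (hP φ hφ φ hφ i j).comp (f := fun y : φ.dom => (⟨y.1, y.2, y.2⟩ : ↥(φ.dom ∩ φ.dom)))
      (continuous_subtype_val.subtype_mk _)
  have hτ : ∀ y hy v i, (φ.basis y hy).repr (τ y hy v) i = (φ.basis y₀ hy₀).repr v i := by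
    intro y hy v i
    simp [τ, Module.Basis.equiv]
  have hPτ : ∀ v i, Continuous fun y : φ.dom =>
      (φ.basis y y.2).repr (P y (τ y y.2 v)) i := by
    intro v i
    have : (fun y : φ.dom => (φ.basis y y.2).repr (P y (τ y y.2 v)) i) = fun y : φ.dom =>
        ∑ j, (φ.basis y₀ hy₀).repr v j * (φ.basis y y.2).repr (P y (φ.basis y y.2 j)) i := by
      funext y
      conv_lhs => rw [← (φ.basis y y.2).sum_repr (τ y y.2 v)]
      simp only [hτ]
      rw [map_sum, map_sum, Finsupp.finsetSum_apply]
      simp only [map_smul, Finsupp.smul_apply, smul_eq_mul]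
    rw [this]
    exact continuous_finsetSum _ fun j _ => (hPφ i j).const_mul _
  let M : φ.dom → Matrix φ.ι φ.ι ℂ := fun y =>
    LinearMap.toMatrix (φ.basis y₀ hy₀) (φ.basis y y.2) (Z y y.2)
  have hM : Continuous M := by
    refine continuous_matrix fun i j => ?_
    have : (fun y : φ.dom => M y i j) = fun y : φ.dom =>
        (φ.basis y y.2).repr (P y (τ y y.2 (P y₀ (φ.basis y₀ hy₀ j)))) i +
        ((φ.basis y₀ hy₀).repr (φ.basis y₀ hy₀ j - P y₀ (φ.basis y₀ hy₀ j)) i -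
          (φ.basis y y.2).repr
            (P y (τ y y.2 (φ.basis y₀ hy₀ j - P y₀ (φ.basis y₀ hy₀ j)))) i) := by
      funext y
      simp only [M, LinearMap.toMatrix_apply, Z, LinearMap.add_apply, LinearMap.comp_apply,
        LinearMap.sub_apply, LinearMap.id_apply, LinearEquiv.coe_coe]
      rw [map_add, Finsupp.add_apply, map_sub (φ.basis y y.2).repr, Finsupp.sub_apply, hτ]
    rw [this]
    exact (hPτ _ i).add (continuous_const.sub (hPτ _ i))
  let D : Set Y := Subtype.val '' {y : φ.dom | (M y).det ≠ 0}
  have hD : IsOpen D := φ.isOpen_dom.isOpenMap_subtype_val _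
    (isOpen_ne.preimage hM.matrix_det)
  have hDφ : ∀ y ∈ D, y ∈ φ.dom := by
    rintro _ ⟨y, _, rfl⟩
    exact y.2
  have hbij : ∀ y (hy : y ∈ D), Function.Bijective (Z y (hDφ y hy)) := by
    rintro _ ⟨y, hy, rfl⟩
    exact (LinearEquiv.ofIsUnitDet (f := Z y y.2) (v := φ.basis y₀ hy₀) (v' := φ.basis y y.2)
      (isUnit_iff_ne_zero.2 hy)).bijective
  have hZW : ∀ y (hy : y ∈ D), ∀ v ∈ W y₀, Z y (hDφ y hy) v ∈ W y := by
    intro y hy v hv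
    rw [← hfix y₀ v hv, hZP]
    exact hmem _ _
  let R : ∀ y (hy : y ∈ D), W y₀ ≃ₗ[ℂ] W y := fun y hy =>
    LinearEquiv.ofBijective ((Z y (hDφ y hy)).restrict (hZW y hy)) (by
      constructor
      · intro v v' h
        have := congrArg Subtype.val h
        exact Subtype.ext ((hbij y hy).1 this)
      · rintro ⟨v, hv⟩
        obtain ⟨u, hu⟩ := (hbij y hy).2 v
        have h1 : P y₀ u = u := by
          refine (hbij y hy).1 ?_
          rw [hZP, hu, hfix y v hv]
        exact ⟨⟨u, h1 ▸ hmem y₀ u⟩, Subtype.ext hu⟩)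
  have : Module.Finite ℂ (B.fiber y₀) := Module.Finite.of_basis (φ.basis y₀ hy₀)
  let w := Module.finBasis ℂ (W y₀)
  let χ : LocalFrame fun y => W y :=
    { dom := D
      isOpen_dom := hD
      ι := Fin (Module.finrank ℂ (W y₀))
      basis := fun y hy => w.map (R y hy) }
  refine ⟨χ, ?_, ⟨⟨y₀, hy₀⟩, ?_, rfl⟩⟩
  · intro φ' hφ'
    have h1 : χ.MatrixContinuous φ (fun y => (W y).subtype) := by
      intro i j
      have : (fun y : ↥(χ.dom ∩ φ.dom) => (φ.basis y y.2.2).repr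
          ((W y).subtype (χ.basis y y.2.1 j)) i) = (fun y : φ.dom =>
            (φ.basis y y.2).repr (P y (τ y y.2 (w j))) i) ∘
              Set.inclusion (Set.inter_subset_right) := by
        funext y
        have hw : P y₀ (w j) = w j := hfix y₀ _ (w j).2
        have hZw : Z y y.2.2 (w j) = P y (τ y y.2.2 (w j)) := by simp [Z, hw]
        exact congrArg (fun v => (φ.basis y y.2.2).repr v i) hZw
      rw [this]
      exact (hPτ _ i).comp (continuous_inclusion _)
    exact h1.comp (B.compatible φ hφ φ' hφ') fun y hy => hDφ y hy.1
  · have : M ⟨y₀, hy₀⟩ = 1 := by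
      have hZ : Z y₀ hy₀ = LinearMap.id := by
        ext v
        have : ∀ v, τ y₀ hy₀ v = v := fun v => by simp [τ]
        simp [Z, this, hPP]
      simp only [M, hZ]
      exact LinearMap.toMatrix_id _
    simp [this]

/-- The subbundle of `B` with fibres `W y`, where `W y` is the image of a projection of the fibre
`B y` depending continuously on `y`.  Its atlas consists of all the local frames of `W` whose
members are continuous sections of `B`. -/
def ComplexVectorBundle.subbundle
    (hW : ∃ P : ∀ y, B.fiber y →ₗ[ℂ] B.fiber y, B.IsBundleMap B P ∧
      (∀ y v, P y v ∈ W y) ∧ ∀ y, ∀ v ∈ W y, P y v = v) : ComplexVectorBundle Y where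
  fiber y := W y
  atlas := subAtlas B W
  covers y := by
    obtain ⟨P, h1, h2, h3⟩ := hW
    exact subAtlas_covers B W P h1 h2 h3 y
  compatible := fun χ hχ χ' hχ' => subAtlas_compatible B W χ hχ χ' hχ'

end subbundle

/-! ### Equivariant bundles and the map `φ_g` -/

section equivariant

variable (G : Type v) [Group G] (M : Type u) [TopologicalSpace M] [MulAction G M]
  [ContinuousConstSMul G M]

/-- The homeomorphism `x ↦ g • x`, as a continuous map. -/
def smulMap {G : Type v} [Group G] {M : Type u} [TopologicalSpace M] [MulAction G M]
    [ContinuousConstSMul G M] (g : G) : C(M, M) := ⟨fun x => g • x, continuous_const_smul g⟩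

/-- A complex `G`-vector bundle over the `G`-space `M`, for a discrete group `G`: a complex vector
bundle with an action of `G` on its total space which lifts the action on `M` and is linear on the
fibres.  The action of `g` is the family of maps `act g h : E_x → E_y`, one for each `x` and
`y = g • x`. -/
structure EquivariantBundle extends ComplexVectorBundle M where
  act : ∀ (g : G) {x y : M}, g • x = y → fiber x →ₗ[ℂ] fiber y
  act_one : ∀ {x : M} (h : (1 : G) • x = x) (v : fiber x), act 1 h v = v
  act_mul : ∀ (g k : G) {x y z : M} (h : k • x = y) (h' : g • y = z) (h'' : (g * k) • x = z)
    (v : fiber x), act (g * k) h'' v = act g h' (act k h v)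
  act_continuous : ∀ g : G, toComplexVectorBundle.IsBundleMap
    (toComplexVectorBundle.pullback (smulMap g)) (fun x => act g (rfl : g • x = g • x))

namespace EquivariantBundle

variable {G M} (E : EquivariantBundle G M) (g : G)

/-- The inclusion `M^g → M` of the fixed point set. -/
def fixedIncl (M : Type u) [TopologicalSpace M] [MulAction G M] (g : G) :
    C(MulAction.fixedBy M g, M) := ⟨Subtype.val, continuous_subtype_val⟩

/-- The restriction of `E` to the fixed point set `M^g`. -/
def restrictFixed : ComplexVectorBundle (MulAction.fixedBy M g) :=
  E.toComplexVectorBundle.pullback (fixedIncl M g)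

/-- The action of `g` on the fibres of `E` over `M^g`. -/
def fixedAct (y : MulAction.fixedBy M g) : Module.End ℂ ((E.restrictFixed g).fiber y) :=
  E.act g y.2

lemma fixedAct_continuous :
    (E.restrictFixed g).IsBundleMap (E.restrictFixed g) (E.fixedAct g) := by
  rintro _ ⟨φ, hφ, rfl⟩ _ ⟨ψ, hψ, rfl⟩ i j
  have hc := E.act_continuous g φ hφ _ ⟨ψ, hψ, rfl⟩ i j
  have key : ∀ (x z : M) (h : g • x = z) (h1 : z ∈ ψ.dom) (h2 : g • x ∈ ψ.dom)
      (v : E.fiber x), (ψ.basis z h1).repr (E.act g h v) i =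
        (ψ.basis (g • x) h2).repr (E.act g rfl v) i := by
    intro x z h h1 h2 v
    subst h
    rfl
  have hmem : ∀ y : ↥((φ.pullback (fixedIncl M g)).dom ∩ (ψ.pullback (fixedIncl M g)).dom),
      (y : MulAction.fixedBy M g).1 ∈ φ.dom ∩ (ψ.pullback (smulMap g)).dom := fun y =>
    ⟨y.2.1, by
      change g • (y : MulAction.fixedBy M g).1 ∈ ψ.dom
      rw [(y : MulAction.fixedBy M g).2]
      exact y.2.2⟩
  refine (hc.comp (f := fun y => ⟨(y : MulAction.fixedBy M g).1, hmem y⟩)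
    ((continuous_subtype_val.comp continuous_subtype_val).subtype_mk _)).congr fun y => ?_
  exact (key _ _ (y : MulAction.fixedBy M g).2 y.2.2 (hmem y).2 _).symm

lemma fixedAct_pow (y : MulAction.fixedBy M g) (k : ℕ) (h : g ^ k • y.1 = y.1)
    (v : E.fiber y.1) : (E.fixedAct g y ^ k) v = E.act (g ^ k) h v := by
  induction k with
  | zero =>
    have key : ∀ (a : G) (ha : a = 1) (h : a • y.1 = y.1), E.act a h v = v := by
      rintro a rfl h
      exact E.act_one h v
    exact (key _ (pow_zero g) h).symm
  | succ k ih =>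
    have hk : g ^ k • y.1 = y.1 := by
      have h2 : g • g ^ k • y.1 = g • y.1 := by
        rw [← mul_smul, ← pow_succ', h]
        exact y.2.symm
      exact (MulAction.injective g) h2
    have key : ∀ (a : G) (ha : a = g * g ^ k) (h : a • y.1 = y.1),
        E.act a h v = E.act g y.2 (E.act (g ^ k) hk v) := by
      rintro a rfl h
      exact E.act_mul g (g ^ k) hk y.2 h v
    rw [key _ (pow_succ' g k) h, ← ih hk, pow_succ']
    rfl

lemma fixedAct_pow_orderOf (y : MulAction.fixedBy M g) : E.fixedAct g y ^ orderOf g = 1 := by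
  ext v
  have h : g ^ orderOf g • y.1 = y.1 := by rw [pow_orderOf_eq_one, one_smul]
  rw [E.fixedAct_pow g y _ h v]
  have key : ∀ (a : G) (ha : a = 1) (h : a • y.1 = y.1), E.act a h v = v := by
    rintro a rfl h
    exact E.act_one h v
  exact key _ (pow_orderOf_eq_one g) h

lemma fixedAct_pow_continuous (k : ℕ) :
    (E.restrictFixed g).IsBundleMap (E.restrictFixed g) (fun y => E.fixedAct g y ^ k) := by
  induction k with
  | zero => exact ComplexVectorBundle.isBundleMap_id _
  | succ k ih =>
    simp only [pow_succ']
    exact ComplexVectorBundle.IsBundleMap.comp ih (E.fixedAct_continuous g)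

lemma isBundleMap_sum {Y : Type u} [TopologicalSpace Y] {B : ComplexVectorBundle Y} {α : Type*}
    (s : Finset α) (f : α → ∀ y, B.fiber y →ₗ[ℂ] B.fiber y)
    (hf : ∀ a ∈ s, B.IsBundleMap B (f a)) : B.IsBundleMap B (fun y => ∑ a ∈ s, f a y) := by
  classical
  induction s using Finset.induction_on with
  | empty =>
    intro φ hφ ψ hψ
    simpa using LocalFrame.MatrixContinuous.zero φ ψ
  | insert a s ha ih =>
    intro φ hφ ψ hψ
    simp only [Finset.sum_insert ha]
    exact (hf a (Finset.mem_insert_self a s) φ hφ ψ hψ).add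
      (ih (fun b hb => hf b (Finset.mem_insert_of_mem hb)) φ hφ ψ hψ)

/-- The projection to the eigenspaces of `g`, obtained by averaging. -/
lemma exists_eigenprojection [Finite G] (ξ : ℂ) :
    ∃ P : ∀ y, (E.restrictFixed g).fiber y →ₗ[ℂ] (E.restrictFixed g).fiber y,
      (E.restrictFixed g).IsBundleMap (E.restrictFixed g) P ∧
      (∀ y v, P y v ∈ Module.End.eigenspace (E.fixedAct g y) ξ) ∧
      ∀ y, ∀ v ∈ Module.End.eigenspace (E.fixedAct g y) ξ, P y v = v := by
  have hpow : ∀ y, ∀ v ∈ Module.End.eigenspace (E.fixedAct g y) ξ, ∀ k : ℕ,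
      (E.fixedAct g y ^ k) v = ξ ^ k • v := by
    intro y v hv k
    rw [Module.End.mem_eigenspace_iff] at hv
    induction k with
    | zero => simp
    | succ k ih => rw [pow_succ, Module.End.mul_apply, hv, map_smul, ih, smul_smul, pow_succ']
  have hN : 0 < orderOf g := orderOf_pos g
  by_cases hξ : ξ ^ orderOf g = 1
  · have hξ0 : ξ ≠ 0 := by
      rintro rfl
      rw [zero_pow hN.ne'] at hξ
      exact zero_ne_one hξ
    refine ⟨fun y => ∑ k ∈ Finset.range (orderOf g),
      ((orderOf g : ℂ)⁻¹ * (ξ⁻¹) ^ k) • (E.fixedAct g y ^ k), ?_, ?_, ?_⟩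
    · refine isBundleMap_sum _ _ fun k _ => ?_
      intro φ hφ ψ hψ
      exact (E.fixedAct_pow_continuous g k φ hφ ψ hψ).smul _
    · intro y v
      rw [Module.End.mem_eigenspace_iff]
      let F : ℕ → (E.restrictFixed g).fiber y := fun k =>
        ((orderOf g : ℂ)⁻¹ * (ξ⁻¹) ^ k) • ((E.fixedAct g y ^ k) v)
      have h1 : ∑ k ∈ Finset.range (orderOf g), F (k + 1) =
          ∑ k ∈ Finset.range (orderOf g), F k := by
        have h2 := (Finset.sum_range_succ F (orderOf g)).symm.trans
          (Finset.sum_range_succ' F (orderOf g))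
        have h3 : F (orderOf g) = F 0 := by
          simp [F, inv_pow, hξ, E.fixedAct_pow_orderOf g y]
        rw [h3] at h2
        exact (add_right_cancel h2).symm
      have h4 : (∑ k ∈ Finset.range (orderOf g),
          ((orderOf g : ℂ)⁻¹ * (ξ⁻¹) ^ k) • (E.fixedAct g y ^ k)) v =
          ∑ k ∈ Finset.range (orderOf g), F k := by
        simp [F]
      rw [h4]
      conv_rhs => rw [← h1]
      rw [map_sum, Finset.smul_sum]
      refine Finset.sum_congr rfl fun k _ => ?_
      simp only [F]
      rw [map_smul, smul_smul, pow_succ' (E.fixedAct g y), Module.End.mul_apply]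
      congr 1
      rw [pow_succ]
      field_simp
    · intro y v hv
      have hN' : (orderOf g : ℂ) ≠ 0 := by exact_mod_cast hN.ne'
      have : ∀ k ∈ Finset.range (orderOf g),
          ((orderOf g : ℂ)⁻¹ * (ξ⁻¹) ^ k) • ((E.fixedAct g y ^ k) v) =
            (orderOf g : ℂ)⁻¹ • v := by
        intro k _
        rw [hpow y v hv k, smul_smul, mul_assoc, ← mul_pow, inv_mul_cancel₀ hξ0, one_pow, mul_one]
      simp only [LinearMap.sum_apply, LinearMap.smul_apply]
      rw [Finset.sum_congr rfl this, Finset.sum_const, Finset.card_range,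
        ← Nat.cast_smul_eq_nsmul ℂ, smul_smul, mul_inv_cancel₀ hN', one_smul]
  · refine ⟨fun _ => 0, fun φ _ ψ _ => LocalFrame.MatrixContinuous.zero φ ψ,
      fun _ _ => Submodule.zero_mem _, ?_⟩
    intro y v hv
    have h := hpow y v hv (orderOf g)
    rw [E.fixedAct_pow_orderOf g y, Module.End.one_apply] at h
    have h2 : (ξ ^ orderOf g - 1) • v = 0 := by rw [sub_smul, one_smul, ← h, sub_self]
    rcases smul_eq_zero.1 h2 with h3 | h3
    · exact absurd (sub_eq_zero.1 h3) hξ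
    · simp [h3]

/-- The eigenbundle `E_ξ` over `M^g`: its fibres are the `ξ`-eigenspaces of `g` acting on the
fibres of `E` over `M^g`. -/
noncomputable def eigenbundle [Finite G] (ξ : ℂ) : ComplexVectorBundle (MulAction.fixedBy M g) :=
  (E.restrictFixed g).subbundle (fun y => Module.End.eigenspace (E.fixedAct g y) ξ)
    (E.exists_eigenprojection g ξ)

/-- `φ_g(E) = ∑_ξ ξ E_ξ` in `K(M^g) ⊗ ℂ`.  The eigenvalues `ξ` of `g` satisfy
`ξ ^ orderOf g = 1`. -/
noncomputable def phi [Finite G] : KComplex (MulAction.fixedBy M g) :=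
  ∑ ξ ∈ Polynomial.nthRootsFinset (orderOf g) (1 : ℂ), KGroup.of (E.eigenbundle g ξ) ⊗ₜ[ℤ] ξ

end EquivariantBundle

end equivariant

/-! ### Cartesian powers and external tensor powers -/

section externalPower

/-- The `n`-fold product `X^n = X × ⋯ × X`, as a space with an action of `S_n`. -/
def CartPow (n : ℕ) (X : Type u) : Type u := Fin n → X

variable {n : ℕ} {X : Type u} [TopologicalSpace X]

/-- The `i`-th coordinate. -/
def CartPow.coord {X : Type u} (x : CartPow n X) (i : Fin n) : X := x i


instance : TopologicalSpace (CartPow n X) := inferInstanceAs (TopologicalSpace (Fin n → X))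

lemma CartPow.continuous_coord (i : Fin n) : Continuous fun x : CartPow n X => x.coord i :=
  continuous_apply i

/-- `σ (x_1, …, x_n) = (x_{σ⁻¹(1)}, …, x_{σ⁻¹(n)})`. -/
instance {X : Type u} : MulAction (Equiv.Perm (Fin n)) (CartPow n X) where
  smul σ x := fun i => x (σ.symm i)
  one_smul _ := rfl
  mul_smul _ _ _ := rfl

instance : ContinuousConstSMul (Equiv.Perm (Fin n)) (CartPow n X) where
  continuous_const_smul σ := continuous_pi fun i => continuous_apply (σ.symm i)

/-- The frame of `E ⊠ ⋯ ⊠ E` formed by the tensors `e_{j₁} ⊗ ⋯ ⊗ e_{jₙ}` built from the members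
of `n` frames of `E`. -/
noncomputable abbrev LocalFrame.external {E : X → Type} [∀ x, AddCommGroup (E x)]
    [∀ x, Module ℂ (E x)] (φ : Fin n → LocalFrame E) :
    LocalFrame (fun x : CartPow n X => ⨂[ℂ] i, E (x.coord i)) where
  dom := {x | ∀ i, x.coord i ∈ (φ i).dom}
  isOpen_dom := by
    rw [Set.ofPred_forall]
    exact isOpen_iInter_of_finite fun i =>
      (φ i).isOpen_dom.preimage (CartPow.continuous_coord i)
  ι := ∀ i, (φ i).ι
  basis x hx := Basis.piTensorProduct fun i => (φ i).basis (x.coord i) (hx i)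

namespace ComplexVectorBundle

variable (E : ComplexVectorBundle X)

/-- The permutation of tensor factors
`σ (v_1 ⊗ ⋯ ⊗ v_n) = v_{σ⁻¹(1)} ⊗ ⋯ ⊗ v_{σ⁻¹(n)}`, from the fibre of `E ⊠ ⋯ ⊠ E` over `x` to the
fibre over `y = σ • x`. -/
noncomputable def permute (σ : Equiv.Perm (Fin n)) {x y : CartPow n X} (h : σ • x = y) :
    (⨂[ℂ] i, E.fiber (x.coord i)) →ₗ[ℂ] ⨂[ℂ] i, E.fiber (y.coord i) :=
  h.rec (motive := fun y _ => (⨂[ℂ] i, E.fiber (x.coord i)) →ₗ[ℂ] ⨂[ℂ] i, E.fiber (y.coord i))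
    (PiTensorProduct.reindex ℂ (fun i => E.fiber (x.coord i)) σ).toLinearMap

lemma permute_tprod (σ : Equiv.Perm (Fin n)) (x : CartPow n X) (v : ∀ i, E.fiber (x.coord i)) :
    E.permute σ (rfl : σ • x = σ • x) (PiTensorProduct.tprod ℂ v) =
      PiTensorProduct.tprod ℂ (s := fun i => E.fiber ((σ • x).coord i)) fun i => v (σ.symm i) :=
  PiTensorProduct.reindex_tprod σ v

lemma external_compatible (φ ψ : Fin n → LocalFrame E.fiber)
    (hφ : ∀ i, φ i ∈ E.atlas) (hψ : ∀ i, ψ i ∈ E.atlas) :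
    (LocalFrame.external φ).MatrixContinuous (LocalFrame.external ψ)
      (fun _ => LinearMap.id) := by
  intro q p
  have key : ∀ x : ↥((LocalFrame.external φ).dom ∩ (LocalFrame.external ψ).dom),
      ∏ i, ((ψ i).basis (x.1.coord i) (x.2.2 i)).repr
        ((φ i).basis (x.1.coord i) (x.2.1 i) (p i)) (q i) =
      ((LocalFrame.external ψ).basis x x.2.2).repr ((LocalFrame.external φ).basis x x.2.1 p) q := by
    intro x
    have h1 : (LocalFrame.external φ).basis x x.2.1 p = PiTensorProduct.tprod ℂ
        fun i => (φ i).basis (x.1.coord i) (x.2.1 i) (p i) := Basis.piTensorProduct_apply _ _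
    rw [h1]
    exact (Basis.piTensorProduct_repr_tprod_apply
      (fun i => (ψ i).basis (x.1.coord i) (x.2.2 i))
      (fun i => (φ i).basis (x.1.coord i) (x.2.1 i) (p i)) q).symm
  refine Continuous.congr ?_ key
  refine continuous_finsetProd _ fun i _ => ?_
  have hc := E.compatible (φ i) (hφ _) (ψ i) (hψ i) (q i) (p i)
  exact hc.comp (f := fun x : ↥((LocalFrame.external φ).dom ∩ (LocalFrame.external ψ).dom) =>
      (⟨x.1.coord i, x.2.1 i, x.2.2 i⟩ : ↥((φ i).dom ∩ (ψ i).dom)))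
    (((CartPow.continuous_coord i).comp continuous_subtype_val).subtype_mk _)

lemma external_matrixContinuous (σ : Equiv.Perm (Fin n)) (φ ψ : Fin n → LocalFrame E.fiber)
    (hφ : ∀ i, φ i ∈ E.atlas) (hψ : ∀ i, ψ i ∈ E.atlas) :
    (LocalFrame.external φ).MatrixContinuous
      ((LocalFrame.external ψ).pullback (smulMap (M := CartPow n X) σ))
      (fun _ => E.permute σ rfl) := by
  intro q p
  have key : ∀ x : ↥((LocalFrame.external φ).dom ∩
      ((LocalFrame.external ψ).pullback (smulMap (M := CartPow n X) σ)).dom),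
      ∏ i, ((ψ i).basis (x.1.coord (σ.symm i)) (x.2.2 i)).repr
        ((φ (σ.symm i)).basis (x.1.coord (σ.symm i)) (x.2.1 (σ.symm i)) (p (σ.symm i))) (q i) =
      (((LocalFrame.external ψ).pullback (smulMap (M := CartPow n X) σ)).basis x x.2.2).repr
        (E.permute σ rfl ((LocalFrame.external φ).basis x x.2.1 p)) q := by
    intro x
    have h1 : (LocalFrame.external φ).basis x x.2.1 p = PiTensorProduct.tprod ℂ
        fun i => (φ i).basis (x.1.coord i) (x.2.1 i) (p i) := Basis.piTensorProduct_apply _ _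
    rw [h1, permute_tprod]
    exact (Basis.piTensorProduct_repr_tprod_apply
      (fun i => (ψ i).basis (x.1.coord (σ.symm i)) (x.2.2 i))
      (fun i => (φ (σ.symm i)).basis (x.1.coord (σ.symm i)) (x.2.1 (σ.symm i)) (p (σ.symm i))) q).symm
  refine Continuous.congr ?_ key
  refine continuous_finsetProd _ fun i _ => ?_
  have hc := E.compatible (φ (σ.symm i)) (hφ _) (ψ i) (hψ i) (q i) (p (σ.symm i))
  exact hc.comp (f := fun x : ↥((LocalFrame.external φ).dom ∩
      ((LocalFrame.external ψ).pullback (smulMap (M := CartPow n X) σ)).dom) =>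
      (⟨x.1.coord (σ.symm i), x.2.1 (σ.symm i), x.2.2 i⟩ : ↥((φ (σ.symm i)).dom ∩ (ψ i).dom)))
    (((CartPow.continuous_coord (σ.symm i)).comp continuous_subtype_val).subtype_mk _)

lemma permute_one {x : CartPow n X} (h : (1 : Equiv.Perm (Fin n)) • x = x)
    (v : ⨂[ℂ] i, E.fiber (x.coord i)) : E.permute 1 h v = v := by
  have : E.permute 1 h = LinearMap.id := by
    apply PiTensorProduct.ext
    ext v
    exact E.permute_tprod 1 x v
  rw [this]
  rfl

lemma permute_mul (g k : Equiv.Perm (Fin n)) {x y z : CartPow n X} (h : k • x = y)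
    (h' : g • y = z) (h'' : (g * k) • x = z) (v : ⨂[ℂ] i, E.fiber (x.coord i)) :
    E.permute (g * k) h'' v = E.permute g h' (E.permute k h v) := by
  subst h
  subst h'
  have : E.permute (g * k) h'' = E.permute g rfl ∘ₗ E.permute k rfl := by
    apply PiTensorProduct.ext
    ext v
    refine (E.permute_tprod (g * k) x v).trans ?_
    refine Eq.trans ?_ (congrArg (E.permute g rfl) (E.permute_tprod k x v)).symm
    exact (E.permute_tprod g (k • x) (fun i => v (k.symm i))).symm
  rw [this]
  rfl

/-- The external tensor power `E^{⊠n} = p_1^* E ⊗ ⋯ ⊗ p_n^* E` over `X^n`, with the action of `S_n`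
by permutation of the factors. -/
noncomputable def externalPower (n : ℕ) :
    EquivariantBundle (Equiv.Perm (Fin n)) (CartPow n X) where
  fiber x := ⨂[ℂ] i, E.fiber (CartPow.coord x i)
  atlas := {χ | ∃ φ : Fin n → LocalFrame E.fiber, (∀ i, φ i ∈ E.atlas) ∧
    χ = LocalFrame.external φ}
  covers x := by
    choose φ hφ hx using fun i => E.covers (CartPow.coord x i)
    exact ⟨_, ⟨φ, hφ, rfl⟩, hx⟩
  compatible := by
    rintro _ ⟨φ, hφ, rfl⟩ _ ⟨ψ, hψ, rfl⟩
    exact E.external_compatible φ ψ hφ hψ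
  act σ _ _ h := E.permute σ h
  act_one h v := E.permute_one h v
  act_mul g k _ _ _ h h' h'' v := E.permute_mul g k h h' h'' v
  act_continuous := by
    rintro σ _ ⟨φ, hφ, rfl⟩ _ ⟨_, ⟨ψ, hψ, rfl⟩, rfl⟩
    exact E.external_matrixContinuous σ φ ψ hφ hψ

end ComplexVectorBundle

/-- The diagonal embedding `X → X^n`. -/
def diagonal (n : ℕ) (X : Type u) : X → CartPow n X := fun x _ => x

/-- The diagonal embedding, as a continuous map from `X` to the fixed point set of `σ`. -/
def diagonalFixed (X : Type u) [TopologicalSpace X] (σ : Equiv.Perm (Fin n)) :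
    C(X, MulAction.fixedBy (CartPow n X) σ) where
  toFun x := ⟨diagonal n X x, rfl⟩
  continuous_toFun := (continuous_pi fun _ => continuous_id).subtype_mk _

end externalPower

end BundleK

/-! Both sides are values of one trace. The group algebra ℂ[S_n] acts on the bundle E^{⊗n} by
permuting tensor factors. The map sending an idempotent e to the class of the bundle e·E^{⊗n} in
K(X) ⊗ ℂ is additive on orthogonal idempotents and takes the same value at ab and ba whenever both
are idempotent. Since ℂ[S_n] is semisimple, such a map extends to a ℂ-linear trace T_n on ℂ[S_n]
(`exists_trace`, `AlgebraAction.trace`).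

Left side: on the diagonal, E^{⊠n} becomes E^{⊗n}. In ℂ[S_n] one has σ = ∑ ξ e_ξ, where e_ξ is the
averaging idempotent that projects to the ξ-eigenspace. By linearity the pullback of φ_σ(E^{⊠n}) is
T_n(σ), for every σ (`pullback_phi_externalPower`).

Right side: Λ^k E is the image of the antisymmetrizer, and products of classes correspond to the
embedding S_k × S_m → S_{k+m} (`of_exteriorPower_mul_trace`). Let A_j be the signed sum over the
permutations of the first j letters and c_j the cycle (j … n-1). Splitting S_{j+2} into cosets of
S_{j+1} and using the trace property gives T(A_{j+2} c_{j+1}) = T(A_{j+1} c_{j+1}) - (j+1) T(A_{j+1}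
c_j). This telescopes (`newton_trace`) to Newton's identity n [Λ^n E] = ∑_{k<n} (-1)^(n-1+k) [Λ^k E]
T_{n-k}((n-k)-cycle). The same recursion defines `adams`, so strong induction gives ψ^n(E) =
T_n(n-cycle) (`adams_tmul_one`). The argument uses no splitting principle, so X may be any
topological space. -/

namespace BundleK

universe u v w

/-! ### Extending functions on idempotents to traces on semisimple algebras. -/

section trace

/-- Take the `a j` to be a basis of the range and the `b j` its coordinate functionals precomposed
with the projection. Biorthogonality holds because the projection fixes its range; it makes the rank
one summands orthogonal idempotents. -/
lemma exists_eq_sum_vecMulVec_of_isIdempotentElem {m : Type*} [Fintype m] [DecidableEq m]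
    {M : Matrix m m ℂ} (hM : IsIdempotentElem M) :
    ∃ (r : ℕ) (a b : Fin r → m → ℂ), (∀ i j, b i ⬝ᵥ a j = if i = j then 1 else 0) ∧
      M = ∑ j, Matrix.vecMulVec (a j) (b j) := by
  let f := Matrix.toLin' M
  have hf : ∀ x, f (f x) = f x := fun x => by
    simp only [f, Matrix.toLin'_apply, Matrix.mulVec_mulVec, hM.eq]
  let c := Module.finBasis ℂ (LinearMap.range f)
  let g : Fin _ → ((m → ℂ) →ₗ[ℂ] ℂ) := fun j => c.coord j ∘ₗ f.rangeRestrict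
  let b : Fin (Module.finrank ℂ (LinearMap.range f)) → m → ℂ := fun j k => g j (Pi.single k 1)
  have hb : ∀ j x, b j ⬝ᵥ x = g j x := by
    intro j x
    conv_rhs => rw [← Finset.univ_sum_single x]
    rw [map_sum]
    refine Finset.sum_congr rfl fun k _ => ?_
    have : Pi.single k (x k) = x k • (Pi.single k 1 : m → ℂ) := by
      rw [← Pi.single_smul, smul_eq_mul, mul_one]
    rw [this, map_smul, smul_eq_mul, mul_comm]
  have hfc : ∀ j, f.rangeRestrict (c j : m → ℂ) = c j := by
    intro j
    obtain ⟨x, hx⟩ := (c j).2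
    apply Subtype.ext
    change f (c j : m → ℂ) = c j
    rw [← hx, hf]
  refine ⟨_, fun j => (c j : m → ℂ), b, ?_, ?_⟩
  · intro i j
    rw [hb]
    simp only [g, LinearMap.comp_apply, hfc, Module.Basis.coord_apply, Module.Basis.repr_self]
    rw [Finsupp.single_apply]
    simp [eq_comm]
  · apply Matrix.toLin'.injective
    ext1 x
    ext1
    simp only [LinearMap.comp_apply, map_sum, LinearMap.sum_apply, Matrix.toLin'_apply]
    set y : m → ℂ := LinearMap.single ℂ (fun _ => ℂ) x 1
    have h1 : f y = ((∑ j, (c.repr (f.rangeRestrict y) j) • c j : LinearMap.range f) : m → ℂ) := by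
      rw [c.sum_repr]
      rfl
    have h2 : ∀ j, (Matrix.vecMulVec (c j : m → ℂ) (b j)).mulVec y = g j y • (c j : m → ℂ) := by
      intro j
      rw [Matrix.vecMulVec_mulVec, hb, op_smul_eq_smul]
    simp only [h2]
    refine h1.trans ?_
    rw [Submodule.coe_sum]
    rfl

/-- Additivity is assumed only on orthogonal pairs of idempotents, so the induction relies on each
partial sum being an idempotent orthogonal to the next term. -/
lemma map_sum_orthogonalIdempotents {A V I : Type*} [Semiring A] [AddCommGroup V] (κ : A → V)
    (hadd : ∀ e f, IsIdempotentElem e → IsIdempotentElem f → e * f = 0 → f * e = 0 →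
      κ (e + f) = κ e + κ f) {p : I → A} (hp : OrthogonalIdempotents p) (s : Finset I) :
    κ (∑ i ∈ s, p i) = ∑ i ∈ s, κ (p i) := by
  classical
  induction s using Finset.induction_on with
  | empty =>
    -- The relation κ 0 = κ 0 + κ 0 forces κ 0 = 0.
    have := hadd 0 0 IsIdempotentElem.zero IsIdempotentElem.zero (mul_zero 0) (mul_zero 0)
    simpa using this
  | insert i s hi ih =>
    rw [Finset.sum_insert hi, Finset.sum_insert hi, hadd _ _ (hp.idem i)
      hp.isIdempotentElem_sum, ih]
    · rw [Finset.mul_sum]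
      exact Finset.sum_eq_zero fun j hj => hp.ortho (by rintro rfl; exact hi hj)
    · rw [Finset.sum_mul]
      exact Finset.sum_eq_zero fun j hj => hp.ortho (by rintro rfl; exact hi hj)

/-- All rank one idempotents of a block have the same κ-value as the corner matrix unit `ε i`. Hence
κ of an idempotent is the sum of its block ranks times κ (ε i), and the rank of an idempotent matrix
is its trace; this dictates the formula for `T`. -/
lemma exists_trace_pi_matrix {I : Type*} [Fintype I] (d : I → ℕ) [∀ i, NeZero (d i)]
    {V : Type*} [AddCommGroup V] [Module ℂ V]
    (κ : (Π i, Matrix (Fin (d i)) (Fin (d i)) ℂ) → V)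
    (hswap : ∀ a b, IsIdempotentElem (a * b) → IsIdempotentElem (b * a) → κ (a * b) = κ (b * a))
    (hadd : ∀ e f, IsIdempotentElem e → IsIdempotentElem f → e * f = 0 → f * e = 0 →
      κ (e + f) = κ e + κ f) :
    ∃ T : (Π i, Matrix (Fin (d i)) (Fin (d i)) ℂ) →ₗ[ℂ] V,
      (∀ a b, T (a * b) = T (b * a)) ∧ ∀ e, IsIdempotentElem e → T e = κ e := by
  classical
  let z : ∀ i, Fin (d i) → ℂ := fun i => Pi.single 0 1
  let ε : ∀ i, (Π i, Matrix (Fin (d i)) (Fin (d i)) ℂ) := fun i =>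
    Pi.single i (Matrix.vecMulVec (z i) (z i))
  have hz : ∀ i, z i ⬝ᵥ z i = 1 := fun i => by simp [z]
  have hmul : ∀ i (a b a' b' : Fin (d i) → ℂ),
      (Pi.single i (Matrix.vecMulVec a b) * Pi.single i (Matrix.vecMulVec a' b') :
        Π i, Matrix (Fin (d i)) (Fin (d i)) ℂ) =
      Pi.single i ((b ⬝ᵥ a') • Matrix.vecMulVec a b') := by
    intro i a b a' b'
    rw [← Pi.single_mul, Matrix.vecMulVec_mul_vecMulVec]
    congr 1
    ext x y
    simp [Matrix.vecMulVec_apply]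
    ring
  let T : (Π i, Matrix (Fin (d i)) (Fin (d i)) ℂ) →ₗ[ℂ] V :=
    ∑ i, (LinearMap.toSpanSingleton ℂ V (κ (ε i))) ∘ₗ
      (Matrix.traceLinearMap (Fin (d i)) ℂ ℂ) ∘ₗ LinearMap.proj i
  have hT : ∀ a, T a = ∑ i, (a i).trace • κ (ε i) := fun a => by
    simp [T]
  refine ⟨T, fun a b => ?_, fun e he => ?_⟩
  · rw [hT, hT]
    refine Finset.sum_congr rfl fun i _ => ?_
    rw [Pi.mul_apply, Pi.mul_apply, Matrix.trace_mul_comm]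
  · have hei : ∀ i, IsIdempotentElem (e i) := fun i => congrFun he i
    choose r a b hab hsum using fun i => exists_eq_sum_vecMulVec_of_isIdempotentElem (hei i)
    let p : (Σ i, Fin (r i)) → (Π i, Matrix (Fin (d i)) (Fin (d i)) ℂ) := fun q =>
      Pi.single q.1 (Matrix.vecMulVec (a q.1 q.2) (b q.1 q.2))
    have hp : OrthogonalIdempotents p := by
      refine ⟨?_, ?_⟩
      · rintro ⟨i, j⟩
        change p _ * p _ = p _
        simp only [p]
        rw [hmul, hab, if_pos rfl, one_smul]
      · rintro ⟨i, j⟩ ⟨i', j'⟩ hne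
        change p _ * p _ = 0
        simp only [p]
        by_cases h : i = i'
        · subst h
          have : j ≠ j' := by
            rintro rfl
            exact hne rfl
          rw [hmul, hab, if_neg this, zero_smul, Pi.single_zero]
        · funext k
          by_cases hk : k = i
          · subst hk
            simp [Pi.single_eq_of_ne h]
          · simp [Pi.single_eq_of_ne hk]
    -- With z the first unit vector, (a zᵀ)(z bᵀ) = a bᵀ, while the swapped product is (b·a) z zᵀ =
    -- z zᵀ.
    have hκ : ∀ q, κ (p q) = κ (ε q.1) := by
      rintro ⟨i, j⟩
      have h1 : (Pi.single i (Matrix.vecMulVec (a i j) (z i)) *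
          Pi.single i (Matrix.vecMulVec (z i) (b i j)) :
          Π i, Matrix (Fin (d i)) (Fin (d i)) ℂ) = p ⟨i, j⟩ := by
        rw [hmul, hz, one_smul]
      have h2 : (Pi.single i (Matrix.vecMulVec (z i) (b i j)) *
          Pi.single i (Matrix.vecMulVec (a i j) (z i)) :
          Π i, Matrix (Fin (d i)) (Fin (d i)) ℂ) = ε i := by
        rw [hmul, hab, if_pos rfl, one_smul]
      rw [← h1, ← h2]
      refine hswap _ _ ?_ ?_
      · rw [h1]
        exact hp.idem _
      · rw [h2]
        change ε i * ε i = ε i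
        simp only [ε]
        rw [hmul, hz, one_smul]
    have he' : e = ∑ q, p q := by
      rw [Fintype.sum_sigma]
      conv_lhs => rw [← Finset.univ_sum_single e]
      refine Finset.sum_congr rfl fun i _ => ?_
      rw [hsum i]
      exact map_sum (AddMonoidHom.single (fun i => Matrix (Fin (d i)) (Fin (d i)) ℂ) i) _ _
    rw [hT]
    conv_rhs => rw [he']
    rw [map_sum_orthogonalIdempotents κ hadd hp, Fintype.sum_sigma]
    refine Finset.sum_congr rfl fun i _ => ?_
    rw [Finset.sum_congr rfl fun j _ => hκ ⟨i, j⟩, hsum i, Matrix.trace_sum, Finset.sum_smul]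
    refine Finset.sum_congr rfl fun j _ => ?_
    rw [Matrix.trace_vecMulVec, dotProduct_comm, hab, if_pos rfl, one_smul]

/-- An additive, conjugation invariant function on the idempotents of a semisimple algebra extends
to a linear trace on the algebra. -/
theorem exists_trace {A : Type*} [Ring A] [Algebra ℂ A] [IsSemisimpleRing A]
    [FiniteDimensional ℂ A] {V : Type*} [AddCommGroup V] [Module ℂ V] (κ : A → V)
    (hswap : ∀ a b, IsIdempotentElem (a * b) → IsIdempotentElem (b * a) → κ (a * b) = κ (b * a))
    (hadd : ∀ e f, IsIdempotentElem e → IsIdempotentElem f → e * f = 0 → f * e = 0 →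
      κ (e + f) = κ e + κ f) :
    ∃ T : A →ₗ[ℂ] V, (∀ a b, T (a * b) = T (b * a)) ∧ ∀ e, IsIdempotentElem e → T e = κ e := by
  -- Wedderburn–Artin over an algebraically closed field leaves only matrix blocks over ℂ itself.
  obtain ⟨n, d, hd, ⟨Φ⟩⟩ := IsSemisimpleRing.exists_algEquiv_pi_matrix_of_isAlgClosed ℂ A
  have hΦ : ∀ {e}, IsIdempotentElem e → IsIdempotentElem (Φ.symm e) := fun he => he.map Φ.symm
  obtain ⟨T, h1, h2⟩ := exists_trace_pi_matrix d (fun a => κ (Φ.symm a))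
    (fun a b ha hb => by
      have ha' := hΦ ha
      have hb' := hΦ hb
      simp only [map_mul] at ha' hb' ⊢
      exact hswap _ _ ha' hb')
    (fun e f he hf hef hfe => by
      simp only [map_add]
      exact hadd _ _ (hΦ he) (hΦ hf) (by rw [← map_mul, hef, map_zero])
        (by rw [← map_mul, hfe, map_zero]))
  refine ⟨T ∘ₗ Φ.toLinearMap, fun a b => ?_, fun e he => ?_⟩
  · simp [h1 (Φ a)]
  · simpa using h2 (Φ e) (he.map Φ)

end trace

end BundleK

/-! ### Images of idempotent bundle endomorphisms. -/

namespace BundleK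

namespace ComplexVectorBundle

variable {X : Type u} [TopologicalSpace X] {E F H E' F' : ComplexVectorBundle X}

section modules

variable {A B C : Type*} [AddCommGroup A] [Module ℂ A] [AddCommGroup B] [Module ℂ B]
  [AddCommGroup C] [Module ℂ C] {ι κ : Type*}

lemma coprod_basis_inl (a : Module.Basis ι ℂ A) (b : Module.Basis κ ℂ B) (f : A →ₗ[ℂ] C)
    (g : B →ₗ[ℂ] C) (j : ι) : f.coprod g (a.prod b (Sum.inl j)) = f (a j) := by
  simp

lemma coprod_basis_inr (a : Module.Basis ι ℂ A) (b : Module.Basis κ ℂ B) (f : A →ₗ[ℂ] C)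
    (g : B →ₗ[ℂ] C) (j : κ) : f.coprod g (a.prod b (Sum.inr j)) = g (b j) := by
  simp

lemma sum_repr_subspace_basis [Fintype κ] {W : Submodule ℂ A} (a : Module.Basis ι ℂ A)
    (c : Module.Basis κ ℂ W) (v : κ → ℂ) (i : ι) :
    ∑ j, a.repr (c j : A) i * v j = a.repr ((∑ j, v j • c j : W) : A) i := by
  simp [map_sum, Finsupp.finsetSum_apply, mul_comm]

lemma apply_of_mem_range {p : Module.End ℂ A}
    (hp : IsIdempotentElem p) {v : A} (hv : v ∈ LinearMap.range p) : p v = v := by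
  obtain ⟨u, rfl⟩ := hv
  exact LinearMap.congr_fun hp u

lemma map_rangeRestrict_map_subtype {p : Module.End ℂ A} (hp : IsIdempotentElem p)
    {q : Module.End ℂ B} (hq : IsIdempotentElem q)
    (v : LinearMap.range p ⊗[ℂ] LinearMap.range q) :
    TensorProduct.map p.rangeRestrict q.rangeRestrict (TensorProduct.map p q
      (TensorProduct.map (LinearMap.range p).subtype (LinearMap.range q).subtype v)) = v := by
  induction v with
  | zero => simp
  | add a b ha hb => simp only [map_add, ha, hb]
  | tmul a b =>
    simp only [TensorProduct.map_tmul, Submodule.subtype_apply]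
    congr 1
    · apply Subtype.ext
      simp [apply_of_mem_range hp a.2]
    · apply Subtype.ext
      simp [apply_of_mem_range hq b.2]

lemma map_subtype_map_rangeRestrict (p : Module.End ℂ A) (q : Module.End ℂ B) (v : A ⊗[ℂ] B) :
    TensorProduct.map (LinearMap.range p).subtype (LinearMap.range q).subtype
      (TensorProduct.map p.rangeRestrict q.rangeRestrict v) = TensorProduct.map p q v := by
  rw [← LinearMap.comp_apply, ← TensorProduct.map_comp]
  rfl

end modules

lemma IsBundleMap.prod {f : ∀ x, H.fiber x →ₗ[ℂ] E.fiber x} {g : ∀ x, H.fiber x →ₗ[ℂ] F.fiber x}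
    (hf : IsBundleMap H E f) (hg : IsBundleMap H F g) :
    IsBundleMap H (E.directSum F) (fun x => (f x).prod (g x)) := by
  rintro χ hχ _ ⟨φ, hφ, ψ, hψ, rfl⟩
  have s1 : χ.dom ∩ (φ.prod ψ).dom ⊆ χ.dom ∩ φ.dom := fun x hx => ⟨hx.1, hx.2.1⟩
  have s2 : χ.dom ∩ (φ.prod ψ).dom ⊆ χ.dom ∩ ψ.dom := fun x hx => ⟨hx.1, hx.2.2⟩
  rintro (i | i) j
  · exact ((hf χ hχ φ hφ i j).comp (continuous_inclusion s1)).congr fun x =>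
      (Module.Basis.prod_repr_inl (φ.basis x.1 x.2.2.1) (ψ.basis x.1 x.2.2.2)
        (f x.1 (χ.basis x.1 x.2.1 j), g x.1 (χ.basis x.1 x.2.1 j)) i).symm
  · exact ((hg χ hχ ψ hψ i j).comp (continuous_inclusion s2)).congr fun x =>
      (Module.Basis.prod_repr_inr (φ.basis x.1 x.2.2.1) (ψ.basis x.1 x.2.2.2)
        (f x.1 (χ.basis x.1 x.2.1 j), g x.1 (χ.basis x.1 x.2.1 j)) i).symm

lemma IsBundleMap.coprod {f : ∀ x, E.fiber x →ₗ[ℂ] H.fiber x}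
    {g : ∀ x, F.fiber x →ₗ[ℂ] H.fiber x} (hf : IsBundleMap E H f) (hg : IsBundleMap F H g) :
    IsBundleMap (E.directSum F) H (fun x => (f x).coprod (g x)) := by
  rintro _ ⟨φ, hφ, ψ, hψ, rfl⟩ χ hχ
  have s1 : (φ.prod ψ).dom ∩ χ.dom ⊆ φ.dom ∩ χ.dom := fun x hx => ⟨hx.1.1, hx.2⟩
  have s2 : (φ.prod ψ).dom ∩ χ.dom ⊆ ψ.dom ∩ χ.dom := fun x hx => ⟨hx.1.2, hx.2⟩
  rintro i (j | j)
  · exact ((hf φ hφ χ hχ i j).comp (continuous_inclusion s1)).congr fun x =>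
      congrArg (fun v => (χ.basis x x.2.2).repr v i) (coprod_basis_inl _ _ _ _ j).symm
  · exact ((hg ψ hψ χ hχ i j).comp (continuous_inclusion s2)).congr fun x =>
      congrArg (fun v => (χ.basis x x.2.2).repr v i) (coprod_basis_inr _ _ _ _ j).symm

lemma IsBundleMap.tensorMap {f : ∀ x, E.fiber x →ₗ[ℂ] E'.fiber x}
    {g : ∀ x, F.fiber x →ₗ[ℂ] F'.fiber x} (hf : IsBundleMap E E' f) (hg : IsBundleMap F F' g) :
    IsBundleMap (E.tensor F) (E'.tensor F') (fun x => TensorProduct.map (f x) (g x)) := by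
  rintro _ ⟨φ, hφ, ψ, hψ, rfl⟩ _ ⟨φ', hφ', ψ', hψ', rfl⟩
  exact (hf φ hφ φ' hφ').tensorMap (hg ψ hψ ψ' hψ')

section subbundle

variable (W : ∀ x, Submodule ℂ (E.fiber x))
  (hW : ∃ P : ∀ x, E.fiber x →ₗ[ℂ] E.fiber x, E.IsBundleMap E P ∧
      (∀ x v, P x v ∈ W x) ∧ ∀ x, ∀ v ∈ W x, P x v = v)

lemma isBundleMap_subtype : IsBundleMap (E.subbundle W hW) E (fun x => (W x).subtype) :=
  fun _ hχ φ hφ => hχ φ hφ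

/-- The matrix `c` of the corestricted map satisfies A c = A', where `A` is the matrix of the
inclusion of the subbundle and `A'` that of `f`. Both are continuous and `A` is injective, so
`continuous_of_mul_eq` gives the continuity of `c`. -/
lemma IsBundleMap.codRestrict {f : ∀ x, F.fiber x →ₗ[ℂ] E.fiber x} (hf : IsBundleMap F E f)
    (hmem : ∀ x v, f x v ∈ W x) :
    IsBundleMap F (E.subbundle W hW) (fun x => (f x).codRestrict (W x) (hmem x)) := by
  classical
  intro ψ hψ χ hχ
  refine LocalFrame.matrixContinuous_of_local fun x _ => ?_
  obtain ⟨φ, hφ, hx⟩ := E.covers x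
  refine ⟨φ.dom, φ.isOpen_dom, hx, ?_⟩
  have := Fintype.ofFinite χ.ι
  have := Fintype.ofFinite ψ.ι
  have := Fintype.ofFinite φ.ι
  let S := ↥((ψ.restrict φ.dom φ.isOpen_dom).dom ∩ χ.dom)
  have s1 : (ψ.restrict φ.dom φ.isOpen_dom).dom ∩ χ.dom ⊆ χ.dom ∩ φ.dom :=
    fun y hy => ⟨hy.2, hy.1.2⟩
  have s2 : (ψ.restrict φ.dom φ.isOpen_dom).dom ∩ χ.dom ⊆ ψ.dom ∩ φ.dom :=
    fun y hy => hy.1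
  let A : S → Matrix φ.ι χ.ι ℂ := fun y => Matrix.of fun i j =>
    (φ.basis y.1 (s1 y.2).2).repr (χ.basis y.1 (s1 y.2).1 j : W y.1).1 i
  let A' : S → Matrix φ.ι ψ.ι ℂ := fun y => Matrix.of fun i j =>
    (φ.basis y.1 (s1 y.2).2).repr (f y.1 (ψ.basis y.1 (s2 y.2).1 j)) i
  let c : S → Matrix χ.ι ψ.ι ℂ := fun y => Matrix.of fun i j =>
    (χ.basis y.1 (s1 y.2).1).repr
      ((f y.1).codRestrict (W y.1) (hmem y.1) (ψ.basis y.1 (s2 y.2).1 j)) i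
  have hA : Continuous A := continuous_matrix fun i j =>
    (hχ φ hφ i j).comp (continuous_inclusion s1)
  have hA' : Continuous A' := continuous_matrix fun i j =>
    (hf ψ hψ φ hφ i j).comp (continuous_inclusion s2)
  have hmul : ∀ (y : S) (v : χ.ι → ℂ), (A y).mulVec v = fun i =>
      (φ.basis y.1 (s1 y.2).2).repr
        (∑ j, v j • (χ.basis y.1 (s1 y.2).1 j : W y.1) : W y.1).1 i := by
    intro y v
    funext i
    exact sum_repr_subspace_basis (φ.basis y.1 (s1 y.2).2) (χ.basis y.1 (s1 y.2).1) v i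
  have hc : Continuous c := by
    refine continuous_of_mul_eq A A' c hA hA' ?_ ?_
    · intro y v v' h
      rw [hmul, hmul] at h
      have h1 := (φ.basis y.1 (s1 y.2).2).repr.injective (Finsupp.ext fun i => congrFun h i)
      have h3 : (χ.basis y.1 (s1 y.2).1).equivFun.symm v =
          (χ.basis y.1 (s1 y.2).1).equivFun.symm v' := by
        rw [Module.Basis.equivFun_symm_apply, Module.Basis.equivFun_symm_apply]
        exact Subtype.ext h1
      exact (χ.basis y.1 (s1 y.2).1).equivFun.symm.injective h3
    · intro y
      ext i j
      have := congrFun (hmul y fun k => c y k j) i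
      refine this.trans ?_
      exact congrArg (fun v : W y.1 => (φ.basis y.1 (s1 y.2).2).repr (v : E.fiber y.1) i)
        ((χ.basis y.1 (s1 y.2).1).sum_repr
          ((f y.1).codRestrict (W y.1) (hmem y.1) (ψ.basis y.1 (s2 y.2).1 j)))
  intro i j
  exact (continuous_apply_apply i j).comp hc

/-- Mutually inverse bundle maps give an isomorphism. -/
lemma iso_of_inverse {f : ∀ x, E.fiber x →ₗ[ℂ] F.fiber x} {g : ∀ x, F.fiber x →ₗ[ℂ] E.fiber x}
    (hf : IsBundleMap E F f) (hg : IsBundleMap F E g) (hgf : ∀ x v, g x (f x v) = v)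
    (hfg : ∀ x v, f x (g x v) = v) : Iso E F :=
  ⟨fun x => LinearEquiv.ofLinearMap (f x) (g x) (LinearMap.ext (hfg x)) (LinearMap.ext (hgf x)),
    hf, hg⟩

variable (V : ∀ x, Submodule ℂ (F.fiber x))
  (hV : ∃ P : ∀ x, F.fiber x →ₗ[ℂ] F.fiber x, F.IsBundleMap F P ∧
      (∀ x v, P x v ∈ V x) ∧ ∀ x, ∀ v ∈ V x, P x v = v)

/-- The maps need to be mutually inverse only between the two families of subspaces; on the ambient
bundles they may be far from isomorphisms. -/
lemma subbundle_iso {f : ∀ x, E.fiber x →ₗ[ℂ] F.fiber x} {g : ∀ x, F.fiber x →ₗ[ℂ] E.fiber x}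
    (hf : IsBundleMap E F f) (hg : IsBundleMap F E g) (hfW : ∀ x, ∀ v ∈ W x, f x v ∈ V x)
    (hgV : ∀ x, ∀ v ∈ V x, g x v ∈ W x) (hgf : ∀ x, ∀ v ∈ W x, g x (f x v) = v)
    (hfg : ∀ x, ∀ v ∈ V x, f x (g x v) = v) :
    Iso (E.subbundle W hW) (F.subbundle V hV) :=
  iso_of_inverse
    (((isBundleMap_subtype W hW).comp hf).codRestrict V hV (fun x v => hfW x v.1 v.2))
    (((isBundleMap_subtype V hV).comp hg).codRestrict W hW (fun x v => hgV x v.1 v.2))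
    (fun x v => Subtype.ext (hgf x v.1 v.2)) (fun x v => Subtype.ext (hfg x v.1 v.2))

end subbundle

section image

/-- The image of an idempotent bundle endomorphism. -/
noncomputable def image (E : ComplexVectorBundle X) (P : ∀ x, Module.End ℂ (E.fiber x))
    (hP : IsBundleMap E E P) (hid : ∀ x, IsIdempotentElem (P x)) : ComplexVectorBundle X :=
  E.subbundle (fun x => LinearMap.range (P x)) ⟨P, hP, fun x v => ⟨v, rfl⟩, by
    rintro x _ ⟨v, rfl⟩
    exact LinearMap.congr_fun (hid x) v⟩

variable {P : ∀ x, Module.End ℂ (E.fiber x)} {hP : IsBundleMap E E P}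
  {hPid : ∀ x, IsIdempotentElem (P x)}
  {Q : ∀ x, Module.End ℂ (F.fiber x)} {hQ : IsBundleMap F F Q}
  {hQid : ∀ x, IsIdempotentElem (Q x)}

lemma isBundleMap_image_incl :
    IsBundleMap (E.image P hP hPid) E (fun x => (LinearMap.range (P x)).subtype) :=
  isBundleMap_subtype _ _

lemma isBundleMap_image_proj :
    IsBundleMap E (E.image P hP hPid) (fun x => (P x).rangeRestrict) :=
  hP.codRestrict _ _ _

/-- This is Murray–von Neumann equivalence: `f` and `g` exchange the two images, and on these the
composites, being the idempotents, act as the identity. It yields the invariance of the image class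
under ab ↦ ba. -/
lemma image_iso_of_comp {f : ∀ x, E.fiber x →ₗ[ℂ] F.fiber x}
    {g : ∀ x, F.fiber x →ₗ[ℂ] E.fiber x}
    (hf : IsBundleMap E F f) (hg : IsBundleMap F E g) (hgf : ∀ x, g x ∘ₗ f x = P x)
    (hfg : ∀ x, f x ∘ₗ g x = Q x) : Iso (E.image P hP hPid) (F.image Q hQ hQid) := by
  have h1 : ∀ x v, g x (f x v) = P x v := fun x v => LinearMap.congr_fun (hgf x) v
  have h2 : ∀ x v, f x (g x v) = Q x v := fun x v => LinearMap.congr_fun (hfg x) v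
  refine subbundle_iso _ _ _ _ hf hg ?_ ?_ ?_ ?_
  · intro x v hv
    rw [← apply_of_mem_range (hPid x) hv, ← h1, h2]
    exact ⟨_, rfl⟩
  · intro x v hv
    rw [← apply_of_mem_range (hQid x) hv, ← h2, h1]
    exact ⟨_, rfl⟩
  · intro x v hv
    rw [h1, apply_of_mem_range (hPid x) hv]
  · intro x v hv
    rw [h2, apply_of_mem_range (hQid x) hv]

/-- The isomorphism is v ↦ (P v, Q v), with inverse the sum; orthogonality kills the cross terms. It
yields the additivity of the image class. -/
lemma image_add_iso {Q : ∀ x, Module.End ℂ (E.fiber x)} {hQ : IsBundleMap E E Q}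
    {hQid : ∀ x, IsIdempotentElem (Q x)} {R : ∀ x, Module.End ℂ (E.fiber x)}
    {hR : IsBundleMap E E R} {hRid : ∀ x, IsIdempotentElem (R x)} (hsum : ∀ x, R x = P x + Q x)
    (hPQ : ∀ x, P x * Q x = 0) (hQP : ∀ x, Q x * P x = 0) :
    Iso (E.image R hR hRid) ((E.image P hP hPid).directSum (E.image Q hQ hQid)) := by
  have hs : ∀ x v, R x v = P x v + Q x v := fun x v => by rw [hsum]; rfl
  have h1 : ∀ x v, P x (Q x v) = 0 := fun x v => LinearMap.congr_fun (hPQ x) v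
  have h2 : ∀ x v, Q x (P x v) = 0 := fun x v => LinearMap.congr_fun (hQP x) v
  have h3 : ∀ x v, P x (P x v) = P x v := fun x v => LinearMap.congr_fun (hPid x) v
  have h4 : ∀ x v, Q x (Q x v) = Q x v := fun x v => LinearMap.congr_fun (hQid x) v
  have hf : IsBundleMap (E.image R hR hRid) ((E.image P hP hPid).directSum (E.image Q hQ hQid))
      (fun x => ((P x).rangeRestrict ∘ₗ (LinearMap.range (R x)).subtype).prod
        ((Q x).rangeRestrict ∘ₗ (LinearMap.range (R x)).subtype)) :=
    (isBundleMap_image_incl.comp isBundleMap_image_proj).prod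
      (isBundleMap_image_incl.comp isBundleMap_image_proj)
  have hg : IsBundleMap ((E.image P hP hPid).directSum (E.image Q hQ hQid)) (E.image R hR hRid)
      (fun x => (R x).rangeRestrict ∘ₗ ((LinearMap.range (P x)).subtype.coprod
        (LinearMap.range (Q x)).subtype)) :=
    (isBundleMap_image_incl.coprod isBundleMap_image_incl).comp isBundleMap_image_proj
  refine iso_of_inverse hf hg ?_ ?_
  · rintro x ⟨v, hv⟩
    apply Subtype.ext
    change R x (P x v + Q x v) = v
    rw [← hs, apply_of_mem_range (hRid x) hv, apply_of_mem_range (hRid x) hv]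
  · rintro x ⟨⟨_, a, rfl⟩, ⟨_, b, rfl⟩⟩
    refine Prod.ext (Subtype.ext ?_) (Subtype.ext ?_)
    · change P x (R x (P x a + Q x b)) = P x a
      simp [hs, h1, h2, h3, h4]
    · change Q x (R x (P x a + Q x b)) = Q x b
      simp [hs, h1, h2, h3, h4]

/-- The image of P ⊗ Q is the tensor product of the images, and Φ carries P ⊗ Q to R. The target `H`
is kept separate from E ⊗ F so that Φ can be the concatenation E^{⊗k} ⊗ E^{⊗m} ≅ E^{⊗(k+m)}. -/
lemma image_tensor_iso {R : ∀ x, Module.End ℂ (H.fiber x)}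
    {hR : IsBundleMap H H R} {hRid : ∀ x, IsIdempotentElem (R x)}
    {Φ : ∀ x, E.fiber x ⊗[ℂ] F.fiber x →ₗ[ℂ] H.fiber x}
    {Ψ : ∀ x, H.fiber x →ₗ[ℂ] E.fiber x ⊗[ℂ] F.fiber x}
    (hΦ : IsBundleMap (E.tensor F) H Φ) (hΨ : IsBundleMap H (E.tensor F) Ψ)
    (hΨΦ : ∀ x, Ψ x ∘ₗ Φ x = LinearMap.id) (hΦΨ : ∀ x, Φ x ∘ₗ Ψ x = LinearMap.id)
    (h : ∀ x, R x ∘ₗ Φ x = Φ x ∘ₗ TensorProduct.map (P x) (Q x)) :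
    Iso ((E.image P hP hPid).tensor (F.image Q hQ hQid)) (H.image R hR hRid) := by
  have hf : IsBundleMap ((E.image P hP hPid).tensor (F.image Q hQ hQid)) (H.image R hR hRid)
      (fun x => (R x).rangeRestrict ∘ₗ (Φ x ∘ₗ TensorProduct.map (LinearMap.range (P x)).subtype
        (LinearMap.range (Q x)).subtype)) :=
    ((isBundleMap_image_incl.tensorMap isBundleMap_image_incl).comp hΦ).comp
      isBundleMap_image_proj
  have hg : IsBundleMap (H.image R hR hRid) ((E.image P hP hPid).tensor (F.image Q hQ hQid))
      (fun x => TensorProduct.map (P x).rangeRestrict (Q x).rangeRestrict ∘ₗ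
        (Ψ x ∘ₗ (LinearMap.range (R x)).subtype)) :=
    (isBundleMap_image_incl.comp hΨ).comp (isBundleMap_image_proj.tensorMap isBundleMap_image_proj)
  have hΨΦ' : ∀ x v, Ψ x (Φ x v) = v := fun x v => LinearMap.congr_fun (hΨΦ x) v
  have hΦΨ' : ∀ x v, Φ x (Ψ x v) = v := fun x v => LinearMap.congr_fun (hΦΨ x) v
  have h' : ∀ x v, R x (Φ x v) = Φ x (TensorProduct.map (P x) (Q x) v) := fun x v =>
    LinearMap.congr_fun (h x) v
  refine iso_of_inverse hf hg ?_ ?_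
  · intro x v
    change TensorProduct.map (P x).rangeRestrict (Q x).rangeRestrict (Ψ x (R x (Φ x
      (TensorProduct.map (LinearMap.range (P x)).subtype (LinearMap.range (Q x)).subtype v)))) = v
    rw [h', hΨΦ']
    exact map_rangeRestrict_map_subtype (hPid x) (hQid x) v
  · rintro x ⟨v, hv⟩
    apply Subtype.ext
    change R x (Φ x (TensorProduct.map (LinearMap.range (P x)).subtype
      (LinearMap.range (Q x)).subtype (TensorProduct.map (P x).rangeRestrict (Q x).rangeRestrict
        (Ψ x v)))) = v
    refine (congrArg (fun w => R x (Φ x w))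
      (map_subtype_map_rangeRestrict (P x) (Q x) (Ψ x v))).trans ?_
    rw [← h', hΦΨ', apply_of_mem_range (hRid x) hv, apply_of_mem_range (hRid x) hv]

end image

end ComplexVectorBundle

namespace KGroup

variable {X : Type u} [TopologicalSpace X] {E F : ComplexVectorBundle X}

lemma of_eq_of_iso (h : E.Iso F) : of E = of F := congrArg ofClass (BundleClass.mk_eq h)

lemma of_directSum (E F : ComplexVectorBundle X) : of (E.directSum F) = of E + of F :=
  ofClass.map_add (BundleClass.mk E) (BundleClass.mk F)

lemma of_tensor (E F : ComplexVectorBundle X) : of (E.tensor F) = of E * of F :=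
  ofClass_mul (BundleClass.mk E) (BundleClass.mk F)

lemma pullback_of {Y : Type v} [TopologicalSpace Y] (f : C(Y, X)) (E : ComplexVectorBundle X) :
    pullback f (of E) = of (E.pullback f) :=
  lift_ofClass _ _

end KGroup

end BundleK

/-! ### The trace of an algebra action, with values in K(X) ⊗ ℂ. -/

namespace BundleK

-- Scalars of K(X) ⊗ ℂ act through the right factor; this is the structure for which the traces
-- below are ℂ-linear.
attribute [local instance] Algebra.TensorProduct.rightAlgebra

namespace KComplex

variable {X : Type u} [TopologicalSpace X]

lemma smul_tmul (c : ℂ) (a : KGroup X) (d : ℂ) :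
    c • (a ⊗ₜ[ℤ] d : KComplex X) = a ⊗ₜ[ℤ] (c * d) := by
  rw [Algebra.smul_def, Algebra.TensorProduct.right_algebraMap_apply,
    Algebra.TensorProduct.tmul_mul_tmul, one_mul]

end KComplex

/-- An action of a complex algebra on a vector bundle by bundle endomorphisms. -/
structure AlgebraAction {X : Type u} [TopologicalSpace X] (A : Type v) [Ring A] [Algebra ℂ A]
    (B : ComplexVectorBundle X) where
  hom : ∀ x, A →ₐ[ℂ] Module.End ℂ (B.fiber x)
  isBundleMap : ∀ a, B.IsBundleMap B (fun x => hom x a)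

namespace AlgebraAction

variable {X : Type u} [TopologicalSpace X] {A : Type v} [Ring A] [Algebra ℂ A]
  {B : ComplexVectorBundle X} (ρ : AlgebraAction A B)

/-- The image of an idempotent of the algebra. -/
noncomputable def image (e : A) (he : IsIdempotentElem e) : ComplexVectorBundle X :=
  B.image (fun x => ρ.hom x e) (ρ.isBundleMap e) (fun x => he.map (ρ.hom x))

open Classical in
/-- The class of the image of an idempotent. -/
noncomputable def imageClass (e : A) : KComplex X :=
  -- The value 0 off the idempotents only makes the function total: the hypotheses and the
  -- conclusion of `exists_trace` evaluate it at idempotents alone.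
  if he : IsIdempotentElem e then KGroup.of (ρ.image e he) ⊗ₜ[ℤ] 1 else 0

lemma imageClass_of_isIdempotentElem {e : A} (he : IsIdempotentElem e) :
    ρ.imageClass e = KGroup.of (ρ.image e he) ⊗ₜ[ℤ] 1 := dif_pos he

/-- The actions of `b` and `a` carry the images of ab and ba to each other. -/
lemma imageClass_mul_comm (a b : A) (hab : IsIdempotentElem (a * b))
    (hba : IsIdempotentElem (b * a)) : ρ.imageClass (a * b) = ρ.imageClass (b * a) := by
  rw [imageClass_of_isIdempotentElem _ hab, imageClass_of_isIdempotentElem _ hba]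
  congr 1
  refine KGroup.of_eq_of_iso ?_
  exact ComplexVectorBundle.image_iso_of_comp (ρ.isBundleMap b) (ρ.isBundleMap a)
    (fun x => (map_mul (ρ.hom x) a b).symm) (fun x => (map_mul (ρ.hom x) b a).symm)

lemma imageClass_add (e f : A) (he : IsIdempotentElem e) (hf : IsIdempotentElem f)
    (hef : e * f = 0) (hfe : f * e = 0) :
    ρ.imageClass (e + f) = ρ.imageClass e + ρ.imageClass f := by
  have hs : IsIdempotentElem (e + f) := by
    change (e + f) * (e + f) = e + f
    rw [add_mul, mul_add, mul_add, he.eq, hf.eq, hef, hfe, add_zero, zero_add]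
  rw [imageClass_of_isIdempotentElem _ he, imageClass_of_isIdempotentElem _ hf,
    imageClass_of_isIdempotentElem _ hs, ← TensorProduct.add_tmul, ← KGroup.of_directSum]
  congr 1
  refine KGroup.of_eq_of_iso ?_
  exact ComplexVectorBundle.image_add_iso (fun x => map_add (ρ.hom x) e f)
    (fun x => by rw [← map_mul, hef, map_zero]) (fun x => by rw [← map_mul, hfe, map_zero])

lemma exists_trace [IsSemisimpleRing A] [FiniteDimensional ℂ A] :
    ∃ T : A →ₗ[ℂ] KComplex X, (∀ a b, T (a * b) = T (b * a)) ∧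
      ∀ e, IsIdempotentElem e → T e = ρ.imageClass e :=
  BundleK.exists_trace ρ.imageClass ρ.imageClass_mul_comm ρ.imageClass_add

/-- The trace of a semisimple algebra acting on a bundle, with values in `K(X) ⊗ ℂ`.  Its value at
an idempotent is the class of the image. -/
noncomputable def trace [IsSemisimpleRing A] [FiniteDimensional ℂ A] : A →ₗ[ℂ] KComplex X :=
  ρ.exists_trace.choose

lemma trace_mul_comm [IsSemisimpleRing A] [FiniteDimensional ℂ A] (a b : A) :
    ρ.trace (a * b) = ρ.trace (b * a) :=
  ρ.exists_trace.choose_spec.1 a b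

lemma trace_of_isIdempotentElem [IsSemisimpleRing A] [FiniteDimensional ℂ A] {e : A}
    (he : IsIdempotentElem e) : ρ.trace e = KGroup.of (ρ.image e he) ⊗ₜ[ℤ] 1 :=
  (ρ.exists_trace.choose_spec.2 e he).trans (ρ.imageClass_of_isIdempotentElem he)

/-- The action of a group algebra determined by an action of the group. -/
noncomputable def ofGroup {G : Type v} [Group G] (r : ∀ x, G →* Module.End ℂ (B.fiber x))
    (hr : ∀ g, B.IsBundleMap B (fun x => r x g)) : AlgebraAction (MonoidAlgebra ℂ G) B where
  hom x := MonoidAlgebra.lift ℂ _ G (r x)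
  isBundleMap a := by
    induction a using MonoidAlgebra.induction_on with
    | of g =>
      intro φ hφ ψ hψ
      simpa using hr g φ hφ ψ hψ
    | add a b ha hb =>
      intro φ hφ ψ hψ
      simp only [map_add]
      exact (ha φ hφ ψ hψ).add (hb φ hφ ψ hψ)
    | smul c a ha =>
      intro φ hφ ψ hψ
      simp only [map_smul]
      exact (ha φ hφ ψ hψ).smul c

lemma ofGroup_hom_of {G : Type v} [Group G] (r : ∀ x, G →* Module.End ℂ (B.fiber x))
    (hr : ∀ g, B.IsBundleMap B (fun x => r x g)) (x : X) (g : G) :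
    (ofGroup r hr).hom x (MonoidAlgebra.of ℂ G g) = r x g :=
  MonoidAlgebra.lift_of _ _

end AlgebraAction

/-! ### Spectral decomposition of an element of finite order. -/

section eigenidempotent

/-- The idempotent `(1/N) ∑ ξ⁻ᵏ gᵏ` which projects to the `ξ`-eigenspace of `g`. -/
noncomputable def eigenidempotent {A : Type*} [Ring A] [Algebra ℂ A] (g : A) (N : ℕ) (ξ : ℂ) : A :=
  ∑ k ∈ Finset.range N, ((N : ℂ)⁻¹ * (ξ⁻¹) ^ k) • g ^ k

variable {A : Type*} [Ring A] [Algebra ℂ A] {g : A} {N : ℕ} {ξ : ℂ}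

/-- Multiplication by `g` shifts the summation index, at the cost of a factor ξ. The shifted sum is
the original one because the summand has equal values at 0 and N. -/
lemma mul_eigenidempotent (hg : g ^ N = 1) (hN : 0 < N) (hξ : ξ ^ N = 1) :
    g * eigenidempotent g N ξ = ξ • eigenidempotent g N ξ := by
  have hξ0 : ξ ≠ 0 := by
    rintro rfl
    rw [zero_pow hN.ne'] at hξ
    exact zero_ne_one hξ
  let F : ℕ → A := fun k => ((N : ℂ)⁻¹ * (ξ⁻¹) ^ k) • g ^ k
  have h1 : ∑ k ∈ Finset.range N, F (k + 1) = ∑ k ∈ Finset.range N, F k := by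
    have h2 := (Finset.sum_range_succ F N).symm.trans (Finset.sum_range_succ' F N)
    have h3 : F N = F 0 := by simp [F, inv_pow, hξ, hg]
    rw [h3] at h2
    exact (add_right_cancel h2).symm
  change g * ∑ k ∈ Finset.range N, F k = ξ • ∑ k ∈ Finset.range N, F k
  conv_rhs => rw [← h1]
  rw [Finset.mul_sum, Finset.smul_sum]
  refine Finset.sum_congr rfl fun k _ => ?_
  simp only [F]
  rw [mul_smul_comm, smul_smul, ← pow_succ']
  congr 1
  rw [pow_succ]
  field_simp

lemma sum_smul_pow_eq (hN : 0 < N) (hξ : ξ ^ N = 1) {V : Type*} [AddCommGroup V] [Module ℂ V]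
    (v : V) : ∑ k ∈ Finset.range N, ((N : ℂ)⁻¹ * (ξ⁻¹) ^ k) • (ξ ^ k • v) = v := by
  have hξ0 : ξ ≠ 0 := by
    rintro rfl
    rw [zero_pow hN.ne'] at hξ
    exact zero_ne_one hξ
  have hN' : (N : ℂ) ≠ 0 := by exact_mod_cast hN.ne'
  have : ∀ k ∈ Finset.range N, ((N : ℂ)⁻¹ * (ξ⁻¹) ^ k) • (ξ ^ k • v) = (N : ℂ)⁻¹ • v := by
    intro k _
    rw [smul_smul, mul_assoc, ← mul_pow, inv_mul_cancel₀ hξ0, one_pow, mul_one]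
  rw [Finset.sum_congr rfl this, Finset.sum_const, Finset.card_range,
    ← Nat.cast_smul_eq_nsmul ℂ, smul_smul, mul_inv_cancel₀ hN', one_smul]

lemma isIdempotentElem_eigenidempotent (hg : g ^ N = 1) (hN : 0 < N) (hξ : ξ ^ N = 1) :
    IsIdempotentElem (eigenidempotent g N ξ) := by
  have hpow : ∀ k : ℕ, g ^ k * eigenidempotent g N ξ = ξ ^ k • eigenidempotent g N ξ := by
    intro k
    induction k with
    | zero => simp
    | succ k ih =>
      rw [pow_succ, mul_assoc, mul_eigenidempotent hg hN hξ, mul_smul_comm, ih, smul_smul,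
        pow_succ']
  change eigenidempotent g N ξ * eigenidempotent g N ξ = _
  conv_lhs => enter [1]; rw [eigenidempotent]
  rw [Finset.sum_mul]
  simp only [smul_mul_assoc, hpow]
  exact sum_smul_pow_eq hN hξ _

/-- Multiplication by a primitive root ζ permutes the roots of unity and scales the sum by ζ⁻ᵏ ≠ 1,
so the sum vanishes. -/
lemma sum_nthRoots_inv_pow {k : ℕ} (hk : k ≠ 0) (hkN : k < N) :
    ∑ ξ ∈ Polynomial.nthRootsFinset N (1 : ℂ), (ξ⁻¹) ^ k = 0 := by
  have hN : 0 < N := by omega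
  have hζ := Complex.isPrimitiveRoot_exp N hN.ne'
  set ζ := Complex.exp (2 * Real.pi * Complex.I / N)
  have hζ0 : ζ ≠ 0 := hζ.ne_zero hN.ne'
  have h1 : ∑ ξ ∈ Polynomial.nthRootsFinset N (1 : ℂ), (ξ⁻¹) ^ k =
      ∑ ξ ∈ Polynomial.nthRootsFinset N (1 : ℂ), ((ζ * ξ)⁻¹) ^ k := by
    symm
    refine Finset.sum_bij (fun ξ _ => ζ * ξ) ?_ ?_ ?_ ?_
    · intro ξ hξ
      rw [Polynomial.mem_nthRootsFinset hN] at hξ ⊢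
      rw [mul_pow, hζ.pow_eq_one, hξ, one_mul]
    · intro a _ b _ h
      exact mul_left_cancel₀ hζ0 h
    · intro ξ hξ
      refine ⟨ζ⁻¹ * ξ, ?_, ?_⟩
      · rw [Polynomial.mem_nthRootsFinset hN] at hξ ⊢
        rw [mul_pow, inv_pow, hζ.pow_eq_one, hξ, inv_one, one_mul]
      · field_simp
    · intro ξ _
      rfl
  simp only [mul_inv, mul_pow] at h1
  rw [← Finset.mul_sum] at h1
  have h2 : (ζ⁻¹) ^ k ≠ 1 := by
    rw [inv_pow, ne_eq, inv_eq_one]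
    exact hζ.pow_ne_one_of_pos_of_lt hk hkN
  have h3 : (1 - (ζ⁻¹) ^ k) * ∑ ξ ∈ Polynomial.nthRootsFinset N (1 : ℂ), (ξ⁻¹) ^ k = 0 := by
    rw [sub_mul, one_mul, ← h1, sub_self]
  exact (mul_eq_zero.1 h3).resolve_left (sub_ne_zero.2 h2.symm)

/-- After exchanging the sums, orthogonality of characters leaves only k = 0, where the N roots
cancel the factor 1/N. -/
lemma sum_eigenidempotent (hN : 0 < N) :
    ∑ ξ ∈ Polynomial.nthRootsFinset N (1 : ℂ), eigenidempotent g N ξ = 1 := by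
  have hN' : (N : ℂ) ≠ 0 := by exact_mod_cast hN.ne'
  simp only [eigenidempotent]
  rw [Finset.sum_comm]
  simp only [← Finset.sum_smul, ← Finset.mul_sum]
  rw [Finset.sum_eq_single_of_mem 0 (Finset.mem_range.2 hN)]
  · have := (Complex.isPrimitiveRoot_exp N hN.ne').card_nthRootsFinset
    simp [this, hN']
  · intro k hk hk0
    rw [sum_nthRoots_inv_pow hk0 (Finset.mem_range.1 hk), mul_zero, zero_smul]

/-- Multiply the decomposition of 1 by `g`. This identity turns the weighted sum of eigenbundles
defining `phi` into the trace of the group element. -/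
lemma sum_smul_eigenidempotent (hg : g ^ N = 1) (hN : 0 < N) :
    ∑ ξ ∈ Polynomial.nthRootsFinset N (1 : ℂ), ξ • eigenidempotent g N ξ = g := by
  conv_rhs => rw [← mul_one g, ← sum_eigenidempotent (g := g) hN, Finset.mul_sum]
  refine Finset.sum_congr rfl fun ξ hξ => ?_
  rw [mul_eigenidempotent hg hN ((Polynomial.mem_nthRootsFinset hN _).1 hξ)]

lemma range_eigenidempotent {V : Type*} [AddCommGroup V] [Module ℂ V] {f : Module.End ℂ V}
    (hf : f ^ N = 1) (hN : 0 < N) (hξ : ξ ^ N = 1) :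
    LinearMap.range (eigenidempotent f N ξ) = Module.End.eigenspace f ξ := by
  ext v
  rw [Module.End.mem_eigenspace_iff]
  constructor
  · rintro ⟨w, rfl⟩
    exact LinearMap.congr_fun (mul_eigenidempotent hf hN hξ) w
  · intro hv
    have hpow : ∀ k : ℕ, (f ^ k) v = ξ ^ k • v := by
      intro k
      induction k with
      | zero => simp
      | succ k ih => rw [pow_succ, Module.End.mul_apply, hv, map_smul, ih, smul_smul, pow_succ']
    refine ⟨v, ?_⟩
    simp only [eigenidempotent, LinearMap.sum_apply, LinearMap.smul_apply, hpow]
    exact sum_smul_pow_eq hN hξ v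

lemma map_eigenidempotent {A' : Type*} [Ring A'] [Algebra ℂ A'] (F : A →ₐ[ℂ] A') :
    F (eigenidempotent g N ξ) = eigenidempotent (F g) N ξ := by
  simp [eigenidempotent]

end eigenidempotent

end BundleK

/-! ### Tensor powers, and the external power restricted to the diagonal. -/

namespace BundleK

/-- The frame `e_{j₁} ⊗ ⋯ ⊗ e_{jₙ}` of a fibrewise tensor power. -/
noncomputable abbrev LocalFrame.tensorPower {X : Type u} [TopologicalSpace X] {E : X → Type}
    [∀ x, AddCommGroup (E x)] [∀ x, Module ℂ (E x)] (n : ℕ) (φ : LocalFrame E) :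
    LocalFrame (fun x => ⨂[ℂ] _ : Fin n, E x) where
  dom := φ.dom
  isOpen_dom := φ.isOpen_dom
  ι := Fin n → φ.ι
  basis x hx := Basis.piTensorProduct fun _ => φ.basis x hx

lemma piTensorProduct_repr {V : Type*} [AddCommGroup V] [Module ℂ V] {ι κ : Type*} [Finite ι]
    [Finite κ] (b : Module.Basis κ ℂ V) (v : ι → V) (q : ι → κ) [Fintype ι] :
    (Basis.piTensorProduct fun _ : ι => b).repr (PiTensorProduct.tprod ℂ v) q =
      ∏ i, b.repr (v i) (q i) :=
  (Basis.piTensorProduct_repr_tprod_apply (fun _ => b) v q).trans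
    (by congr!)

namespace ComplexVectorBundle

variable {X : Type u} [TopologicalSpace X] {E F H : ComplexVectorBundle X}

/-- Meant for maps natural in the fibre, such as permuting or antisymmetrizing factors: in frames
induced from one frame of the base bundle their matrices do not depend on the point. -/
lemma isBundleMap_of_const {f : ∀ x, E.fiber x →ₗ[ℂ] F.fiber x}
    (h : ∀ x, ∃ φ ∈ E.atlas, ∃ ψ ∈ F.atlas, x ∈ φ.dom ∧ x ∈ ψ.dom ∧ ∃ M : ψ.ι → φ.ι → ℂ,
      ∀ y (hy : y ∈ φ.dom) (hy' : y ∈ ψ.dom) i j,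
        (ψ.basis y hy').repr (f y (φ.basis y hy j)) i = M i j) : IsBundleMap E F f := by
  refine isBundleMap_of_local fun x => ?_
  obtain ⟨φ, hφ, ψ, hψ, hx, hx', M, hM⟩ := h x
  refine ⟨φ, hφ, ψ, hψ, hx, hx', fun i j => ?_⟩
  exact (continuous_const (y := M i j)).congr fun y => (hM y _ _ i j).symm

variable (E)

/-- The tensor power `E^{⊗n}`. -/
noncomputable def tensorPower (n : ℕ) : ComplexVectorBundle X where
  fiber x := ⨂[ℂ] _ : Fin n, E.fiber x
  atlas := LocalFrame.tensorPower n '' E.atlas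
  covers x := by
    obtain ⟨φ, hφ, hx⟩ := E.covers x
    exact ⟨_, ⟨φ, hφ, rfl⟩, hx⟩
  compatible := by
    rintro _ ⟨φ, hφ, rfl⟩ _ ⟨ψ, hψ, rfl⟩ q p
    refine Continuous.congr (f := fun x : ↥(φ.dom ∩ ψ.dom) => ∏ i : Fin n,
      (ψ.basis x x.2.2).repr (φ.basis x x.2.1 (p i)) (q i)) ?_ ?_
    · exact continuous_finsetProd _ fun i _ => E.compatible φ hφ ψ hψ (q i) (p i)
    · intro x
      have h1 := piTensorProduct_repr (ψ.basis x x.2.2) (fun i => φ.basis x x.2.1 (p i)) q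
      rw [← h1]
      exact congrArg (fun v => (Basis.piTensorProduct fun _ : Fin n => ψ.basis x x.2.2).repr v q)
        (Basis.piTensorProduct_apply (fun _ : Fin n => φ.basis x x.2.1) p).symm

/-- The permutation of the factors of a tensor power. -/
noncomputable def tensorPerm (V : Type*) [AddCommGroup V] [Module ℂ V] (n : ℕ) :
    Equiv.Perm (Fin n) →* Module.End ℂ (⨂[ℂ] _ : Fin n, V) where
  toFun σ := (PiTensorProduct.reindex ℂ (fun _ => V) σ).toLinearMap
  map_one' := by
    apply PiTensorProduct.ext
    ext v
    exact PiTensorProduct.reindex_tprod _ _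
  map_mul' σ τ := by
    apply PiTensorProduct.ext
    ext v
    simp only [LinearMap.compMultilinearMap_apply, LinearEquiv.coe_coe, Module.End.mul_apply]
    rw [PiTensorProduct.reindex_tprod, PiTensorProduct.reindex_tprod]
    exact (PiTensorProduct.reindex_tprod (R := ℂ) (s := fun _ => V) σ fun i => v (τ.symm i)).symm

lemma tensorPerm_tprod {V : Type*} [AddCommGroup V] [Module ℂ V] {n : ℕ}
    (σ : Equiv.Perm (Fin n)) (v : Fin n → V) :
    tensorPerm V n σ (PiTensorProduct.tprod ℂ v) =
      PiTensorProduct.tprod ℂ fun i => v (σ.symm i) :=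
  PiTensorProduct.reindex_tprod σ v

lemma tensorPerm_pow_orderOf {V : Type*} [AddCommGroup V] [Module ℂ V] {n : ℕ}
    (σ : Equiv.Perm (Fin n)) : tensorPerm V n σ ^ orderOf σ = 1 := by
  rw [← map_pow, pow_orderOf_eq_one, map_one]

lemma isBundleMap_tensorPerm (n : ℕ) (σ : Equiv.Perm (Fin n)) :
    IsBundleMap (E.tensorPower n) (E.tensorPower n) (fun x => tensorPerm (E.fiber x) n σ) := by
  classical
  refine isBundleMap_of_const fun x => ?_
  obtain ⟨φ, hφ, hx⟩ := E.covers x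
  refine ⟨_, ⟨φ, hφ, rfl⟩, _, ⟨φ, hφ, rfl⟩, hx, hx,
    fun q p => ∏ i, Finsupp.single (p (σ.symm i)) (1 : ℂ) (q i), fun y hy _ q p => ?_⟩
  have h1 := congrArg (tensorPerm (E.fiber y) n σ)
    (Basis.piTensorProduct_apply (fun _ : Fin n => φ.basis y hy) p)
  rw [tensorPerm_tprod] at h1
  refine (congrArg (fun v => (Basis.piTensorProduct fun _ : Fin n => φ.basis y hy).repr v q)
    h1).trans ?_
  rw [piTensorProduct_repr]
  exact Finset.prod_congr rfl fun i _ => by rw [Module.Basis.repr_self]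

/-- The action of `ℂ[S_n]` on `E^{⊗n}`. -/
noncomputable def tensorAction (n : ℕ) :
    AlgebraAction (MonoidAlgebra ℂ (Equiv.Perm (Fin n))) (E.tensorPower n) :=
  AlgebraAction.ofGroup (fun x => tensorPerm (E.fiber x) n) (E.isBundleMap_tensorPerm n)

lemma tensorAction_of {n : ℕ} (x : X) (σ : Equiv.Perm (Fin n)) :
    (E.tensorAction n).hom x (MonoidAlgebra.of ℂ _ σ) = tensorPerm (E.fiber x) n σ :=
  AlgebraAction.ofGroup_hom_of _ _ x σ

section external

variable (n : ℕ) (σ : Equiv.Perm (Fin n))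

/-- The fibres agree definitionally but the atlases differ: an external frame may use a different
frame of `E` in each factor. Over the diagonal, constant families of frames suffice for comparison.
-/
lemma isBundleMap_pullback_externalPower : IsBundleMap
    (((E.externalPower n).restrictFixed σ).pullback (diagonalFixed X σ)) (E.tensorPower n)
    (fun x => (LinearMap.id : (⨂[ℂ] _ : Fin n, E.fiber x) →ₗ[ℂ] ⨂[ℂ] _ : Fin n, E.fiber x)) := by
  refine isBundleMap_of_local fun x => ?_
  obtain ⟨φ, hφ, hx⟩ := E.covers x
  refine ⟨_, ⟨_, ⟨_, ⟨fun _ => φ, fun _ => hφ, rfl⟩, rfl⟩, rfl⟩, _, ⟨φ, hφ, rfl⟩, fun _ => hx, hx, ?_⟩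
  exact LocalFrame.matrixContinuous_of_basis id fun y hy hy' j => rfl

lemma isBundleMap_tensorPower_externalPower : IsBundleMap (E.tensorPower n)
    (((E.externalPower n).restrictFixed σ).pullback (diagonalFixed X σ))
    (fun x => (LinearMap.id : (⨂[ℂ] _ : Fin n, E.fiber x) →ₗ[ℂ] ⨂[ℂ] _ : Fin n, E.fiber x)) := by
  refine isBundleMap_of_local fun x => ?_
  obtain ⟨φ, hφ, hx⟩ := E.covers x
  refine ⟨_, ⟨φ, hφ, rfl⟩, _, ⟨_, ⟨_, ⟨fun _ => φ, fun _ => hφ, rfl⟩, rfl⟩, rfl⟩, hx, fun _ => hx, ?_⟩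
  exact LocalFrame.matrixContinuous_of_basis id fun y hy hy' j => rfl

lemma fixedAct_externalPower (x : X) :
    (E.externalPower n).fixedAct σ (diagonalFixed X σ x) = tensorPerm (E.fiber x) n σ := by
  refine PiTensorProduct.ext (MultilinearMap.ext fun v : Fin n → E.fiber x => ?_)
  exact (E.permute_tprod σ (diagonal n X x) v).trans
    (tensorPerm_tprod (V := E.fiber x) σ v).symm

variable {n σ}

lemma isIdempotentElem_eigenidempotent_of {ξ : ℂ} (hξ : ξ ^ orderOf σ = 1) :
    IsIdempotentElem (eigenidempotent (MonoidAlgebra.of ℂ (Equiv.Perm (Fin n)) σ)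
      (orderOf σ) ξ) :=
  isIdempotentElem_eigenidempotent (by rw [← map_pow, pow_orderOf_eq_one, map_one])
    (orderOf_pos σ) hξ

lemma range_tensorAction_eigenidempotent {ξ : ℂ} (hξ : ξ ^ orderOf σ = 1) (x : X) :
    LinearMap.range ((E.tensorAction n).hom x (eigenidempotent (MonoidAlgebra.of ℂ _ σ)
      (orderOf σ) ξ)) = Module.End.eigenspace (tensorPerm (E.fiber x) n σ) ξ := by
  rw [map_eigenidempotent, tensorAction_of]
  exact range_eigenidempotent (tensorPerm_pow_orderOf σ) (orderOf_pos σ) hξ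

/-- Both bundles have as fibre the ξ-eigenspace of σ on E_x^{⊗n}, but with frames from different
subbundle constructions. Each map includes into the ambient bundle and projects back; both
projections fix the eigenspace, so the maps are mutually inverse. -/
lemma pullback_eigenbundle_iso {ξ : ℂ} (hξ : ξ ^ orderOf σ = 1) :
    Iso (((E.externalPower n).eigenbundle σ ξ).pullback (diagonalFixed X σ))
      ((E.tensorAction n).image _ (isIdempotentElem_eigenidempotent_of hξ)) := by
  obtain ⟨P, hP, hPmem, hPfix⟩ := (E.externalPower n).exists_eigenprojection σ ξ
  set e := eigenidempotent (MonoidAlgebra.of ℂ (Equiv.Perm (Fin n)) σ) (orderOf σ) ξ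
  have hr : ∀ x, LinearMap.range ((E.tensorAction n).hom x e) =
      Module.End.eigenspace ((E.externalPower n).fixedAct σ (diagonalFixed X σ x)) ξ := fun x =>
    (E.range_tensorAction_eigenidempotent hξ x).trans (by rw [fixedAct_externalPower]; rfl)
  have h1 : IsBundleMap (((E.externalPower n).eigenbundle σ ξ).pullback (diagonalFixed X σ))
      (((E.externalPower n).restrictFixed σ).pullback (diagonalFixed X σ)) _ :=
    (isBundleMap_subtype (E := (E.externalPower n).restrictFixed σ)
      (fun y => Module.End.eigenspace ((E.externalPower n).fixedAct σ y) ξ)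
      ((E.externalPower n).exists_eigenprojection σ ξ)).pullback (diagonalFixed X σ)
  have h2 : IsBundleMap (((E.externalPower n).restrictFixed σ).pullback (diagonalFixed X σ))
      (((E.externalPower n).eigenbundle σ ξ).pullback (diagonalFixed X σ)) _ :=
    (hP.codRestrict (fun y => Module.End.eigenspace ((E.externalPower n).fixedAct σ y) ξ)
      ((E.externalPower n).exists_eigenprojection σ ξ) hPmem).pullback (diagonalFixed X σ)
  refine iso_of_inverse ((h1.comp (E.isBundleMap_pullback_externalPower n σ)).comp
    isBundleMap_image_proj) ((isBundleMap_image_incl.comp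
      (E.isBundleMap_tensorPower_externalPower n σ)).comp h2) ?_ ?_
  · rintro x ⟨v, hv⟩
    apply Subtype.ext
    change P (diagonalFixed X σ x) ((E.tensorAction n).hom x e v) = v
    have h3 : (E.tensorAction n).hom x e v = v :=
      apply_of_mem_range ((isIdempotentElem_eigenidempotent_of hξ).map _) (by rw [hr]; exact hv)
    exact (congrArg (P (diagonalFixed X σ x)) h3).trans (hPfix (diagonalFixed X σ x) v hv)
  · rintro x ⟨v, hv⟩
    apply Subtype.ext
    change (E.tensorAction n).hom x e (P (diagonalFixed X σ x) v) = v
    have h3 : P (diagonalFixed X σ x) v = v := hPfix (diagonalFixed X σ x) v (by rw [← hr]; exact hv)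
    exact (congrArg ((E.tensorAction n).hom x e) h3).trans
      (apply_of_mem_range ((isIdempotentElem_eigenidempotent_of hξ).map _) hv)

end external

end ComplexVectorBundle

end BundleK

/-! ### Exterior powers as images of the antisymmetrizer. -/

namespace BundleK

section antisymmetrizer

/-- The idempotent `(1/n!) ∑ sgn(w) w` of the group algebra of `S_n`. -/
noncomputable def antisymmetrizer (n : ℕ) : MonoidAlgebra ℂ (Equiv.Perm (Fin n)) :=
  (n.factorial : ℂ)⁻¹ • ∑ w : Equiv.Perm (Fin n),
    ((Equiv.Perm.sign w : ℤ) : ℂ) • MonoidAlgebra.of ℂ _ w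

lemma of_mul_antisymmetrizer {n : ℕ} (σ : Equiv.Perm (Fin n)) :
    MonoidAlgebra.of ℂ _ σ * antisymmetrizer n =
      ((Equiv.Perm.sign σ : ℤ) : ℂ) • antisymmetrizer n := by
  rw [antisymmetrizer, mul_smul_comm, smul_comm]
  congr 1
  rw [Finset.mul_sum, Finset.smul_sum]
  conv_rhs => rw [← Equiv.sum_comp (Equiv.mulLeft σ)]
  refine Finset.sum_congr rfl fun w _ => ?_
  rw [Equiv.coe_mulLeft, mul_smul_comm, ← map_mul, smul_smul, map_mul Equiv.Perm.sign]
  congr 1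
  rcases Int.units_eq_one_or (Equiv.Perm.sign σ) with h | h <;> simp [h]

lemma isIdempotentElem_antisymmetrizer (n : ℕ) : IsIdempotentElem (antisymmetrizer n) := by
  change antisymmetrizer n * antisymmetrizer n = _
  conv_lhs => enter [1]; rw [antisymmetrizer]
  rw [smul_mul_assoc, Finset.sum_mul]
  have h : ∀ w ∈ (Finset.univ : Finset (Equiv.Perm (Fin n))),
      (((Equiv.Perm.sign w : ℤ) : ℂ) • MonoidAlgebra.of ℂ _ w) * antisymmetrizer n =
        antisymmetrizer n := by
    intro w _
    rw [smul_mul_assoc, of_mul_antisymmetrizer, smul_smul]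
    rcases Int.units_eq_one_or (Equiv.Perm.sign w) with h | h <;> simp [h]
  have hn : (n.factorial : ℂ) ≠ 0 := by exact_mod_cast n.factorial_ne_zero
  rw [Finset.sum_congr rfl h, Finset.sum_const, Finset.card_univ, Fintype.card_perm,
    Fintype.card_fin, ← Nat.cast_smul_eq_nsmul ℂ, smul_smul, inv_mul_cancel₀ hn, one_smul]

/-- The normalised projection from a tensor power to an exterior power. -/
noncomputable def tensorToExterior (V : Type*) [AddCommGroup V] [Module ℂ V] (n : ℕ) :
    (⨂[ℂ] _ : Fin n, V) →ₗ[ℂ] ⋀[ℂ]^n V :=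
  (n.factorial : ℂ)⁻¹ • PiTensorProduct.lift (exteriorPower.ιMulti ℂ n).toMultilinearMap

variable {V : Type*} [AddCommGroup V] [Module ℂ V] {n : ℕ}

lemma tensorToExterior_tprod (v : Fin n → V) : tensorToExterior V n (PiTensorProduct.tprod ℂ v) =
    (n.factorial : ℂ)⁻¹ • exteriorPower.ιMulti ℂ n v := by
  simp [tensorToExterior]

/-- The map to the tensor power is the signed sum over S_n without normalisation. Each of its n!
terms returns v / n!, since the sign cancels the sign of reordering the wedge. -/
lemma tensorToExterior_toTensorPower (v : ⋀[ℂ]^n V) :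
    tensorToExterior V n (exteriorPower.toTensorPower ℂ V n v) = v := by
  have : tensorToExterior V n ∘ₗ exteriorPower.toTensorPower ℂ V n = LinearMap.id := by
    apply exteriorPower.linearMap_ext
    ext1 v
    have hn : (n.factorial : ℂ) ≠ 0 := by exact_mod_cast n.factorial_ne_zero
    have h : ∀ σ ∈ (Finset.univ : Finset (Equiv.Perm (Fin n))),
        tensorToExterior V n (Equiv.Perm.sign σ • PiTensorProduct.tprod ℂ fun i => v (σ i)) =
        (n.factorial : ℂ)⁻¹ • exteriorPower.ιMulti ℂ n v := by
      intro σ _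
      have h1 := (exteriorPower.ιMulti ℂ n (M := V)).map_perm v σ
      have h2 : tensorToExterior V n (PiTensorProduct.tprod ℂ fun i => v (σ i)) =
          (n.factorial : ℂ)⁻¹ • Equiv.Perm.sign σ • exteriorPower.ιMulti ℂ n v := by
        rw [tensorToExterior_tprod, ← h1]
        rfl
      rcases Int.units_eq_one_or (Equiv.Perm.sign σ) with h | h <;>
        simp [h, h2, Units.smul_def]
    simp only [LinearMap.compAlternatingMap_apply, LinearMap.comp_apply,
      exteriorPower.toTensorPower_apply_ιMulti, map_sum, LinearMap.id_apply]
    rw [Finset.sum_congr rfl h, Finset.sum_const, Finset.card_univ, Fintype.card_perm,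
      Fintype.card_fin, ← Nat.cast_smul_eq_nsmul ℂ, smul_smul, mul_inv_cancel₀ hn, one_smul]
  exact LinearMap.congr_fun this v

end antisymmetrizer

namespace ComplexVectorBundle

variable {X : Type u} [TopologicalSpace X] (E : ComplexVectorBundle X)

lemma toTensorPower_tensorToExterior (n : ℕ) (x : X) (v : ⨂[ℂ] _ : Fin n, E.fiber x) :
    exteriorPower.toTensorPower ℂ _ n (tensorToExterior _ n v) =
      (E.tensorAction n).hom x (antisymmetrizer n) v := by
  have : exteriorPower.toTensorPower ℂ _ n ∘ₗ tensorToExterior _ n =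
      (n.factorial : ℂ)⁻¹ • ∑ w : Equiv.Perm (Fin n),
        ((Equiv.Perm.sign w : ℤ) : ℂ) • tensorPerm (E.fiber x) n w := by
    refine PiTensorProduct.ext (MultilinearMap.ext fun v => ?_)
    simp only [LinearMap.compMultilinearMap_apply, LinearMap.comp_apply, tensorToExterior_tprod,
      map_smul, exteriorPower.toTensorPower_apply_ιMulti, LinearMap.smul_apply,
      LinearMap.sum_apply]
    congr 1
    -- `toTensorPower` permutes by v ∘ w and `tensorPerm` by v ∘ w⁻¹; inverting w reconciles them
    -- and preserves the sign.
    rw [← Equiv.sum_comp (Equiv.inv _)]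
    refine Finset.sum_congr rfl fun w _ => ?_
    rw [tensorPerm_tprod, Equiv.inv_apply, Equiv.Perm.sign_inv]
    rcases Int.units_eq_one_or (Equiv.Perm.sign w) with h | h
    · rw [h]
      simp
    · rw [h]
      simp [Units.smul_def]
  refine (LinearMap.congr_fun this v).trans ?_
  rw [antisymmetrizer, map_smul, map_sum]
  simp only [map_smul, tensorAction_of]
  rfl

lemma isBundleMap_toTensorPower (n : ℕ) : IsBundleMap (E.exteriorPower n) (E.tensorPower n)
    (fun x => exteriorPower.toTensorPower ℂ (E.fiber x) n) := by
  classical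
  refine isBundleMap_of_const fun x => ?_
  obtain ⟨φ, hφ, hx⟩ := E.covers x
  refine ⟨_, ⟨φ, hφ, rfl⟩, _, ⟨φ, hφ, rfl⟩, hx, hx,
    fun q s => ∑ w : Equiv.Perm (Fin n), (Equiv.Perm.sign w) • ∏ i, Finsupp.single
      ((Finite.equivFin φ.ι).symm (Set.powersetCard.ofFinEmbEquiv.symm s (w i))) (1 : ℂ) (q i),
    fun y hy _ q s => ?_⟩
  have h1 : exteriorPower.toTensorPower ℂ (E.fiber y) n ((φ.exteriorPower n).basis y hy s) =
      ∑ w : Equiv.Perm (Fin n), Equiv.Perm.sign w • PiTensorProduct.tprod ℂ fun i =>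
        φ.basis y hy ((Finite.equivFin φ.ι).symm
          (Set.powersetCard.ofFinEmbEquiv.symm s (w i))) := by
    simp only [LocalFrame.exteriorPower]
    rw [_root_.exteriorPower.basis_apply, _root_.exteriorPower.ιMulti_family,
      exteriorPower.toTensorPower_apply_ιMulti]
    simp
  refine (congrArg (fun v => (Basis.piTensorProduct fun _ : Fin n => φ.basis y hy).repr v q)
    h1).trans ?_
  simp only [map_sum, Finsupp.finsetSum_apply]
  refine Finset.sum_congr rfl fun w _ => ?_
  have h2 : (Basis.piTensorProduct fun _ : Fin n => φ.basis y hy).repr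
      (PiTensorProduct.tprod ℂ fun i => φ.basis y hy ((Finite.equivFin φ.ι).symm
          (Set.powersetCard.ofFinEmbEquiv.symm s (w i)))) q = ∏ i, Finsupp.single
      ((Finite.equivFin φ.ι).symm (Set.powersetCard.ofFinEmbEquiv.symm s (w i))) (1 : ℂ) (q i) := by
    rw [piTensorProduct_repr]
    exact Finset.prod_congr rfl fun i _ => by rw [Module.Basis.repr_self]
  rw [← h2]
  rcases Int.units_eq_one_or (Equiv.Perm.sign w) with h | h <;> rw [h] <;> simp [Units.smul_def]

lemma isBundleMap_tensorToExterior (n : ℕ) : IsBundleMap (E.tensorPower n) (E.exteriorPower n)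
    (fun x => tensorToExterior (E.fiber x) n) := by
  classical
  refine isBundleMap_of_const fun x => ?_
  obtain ⟨φ, hφ, hx⟩ := E.covers x
  refine ⟨_, ⟨φ, hφ, rfl⟩, _, ⟨φ, hφ, rfl⟩, hx, hx,
    fun s q => (n.factorial : ℂ)⁻¹ * (Matrix.of fun a b : Fin n => Finsupp.single (q a) (1 : ℂ)
      ((Finite.equivFin φ.ι).symm (Set.powersetCard.ofFinEmbEquiv.symm s b))).det,
    fun y hy _ s q => ?_⟩
  have h1 := congrArg (tensorToExterior (E.fiber y) n)
    (Basis.piTensorProduct_apply (fun _ : Fin n => φ.basis y hy) q)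
  rw [tensorToExterior_tprod] at h1
  refine (congrArg (fun v => ((φ.exteriorPower n).basis y hy).repr v s) h1).trans ?_
  simp only [LocalFrame.exteriorPower]
  rw [map_smul, Finsupp.smul_apply, smul_eq_mul, _root_.exteriorPower.basis_repr_apply,
    _root_.exteriorPower.ιMultiDual_apply_ιMulti]
  congr 2
  ext a b
  simp [Finsupp.single_apply, Equiv.eq_symm_apply]

/-- Λ^n E is a retract of E^{⊗n}: one composite of the two natural maps is the identity, the other
is the antisymmetrizer. -/
lemma exteriorPower_iso (n : ℕ) : Iso (E.exteriorPower n)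
    ((E.tensorAction n).image _ (isIdempotentElem_antisymmetrizer n)) := by
  refine iso_of_inverse ((E.isBundleMap_toTensorPower n).comp isBundleMap_image_proj)
    (isBundleMap_image_incl.comp (E.isBundleMap_tensorToExterior n)) ?_ ?_
  · intro x v
    change tensorToExterior _ n ((E.tensorAction n).hom x (antisymmetrizer n)
      (exteriorPower.toTensorPower ℂ (E.fiber x) n v)) = v
    rw [← toTensorPower_tensorToExterior]
    exact (tensorToExterior_toTensorPower _).trans (tensorToExterior_toTensorPower v)
  · rintro x ⟨v, hv⟩
    apply Subtype.ext
    change (E.tensorAction n).hom x (antisymmetrizer n)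
      (exteriorPower.toTensorPower ℂ (E.fiber x) n (tensorToExterior _ n v)) = v
    have h := apply_of_mem_range ((isIdempotentElem_antisymmetrizer n).map
      ((E.tensorAction n).hom x)) hv
    refine (congrArg ((E.tensorAction n).hom x (antisymmetrizer n))
      ((E.toTensorPower_tensorToExterior n x v).trans h)).trans h

end ComplexVectorBundle

end BundleK

/-! ### The embedding of S_k × S_m and multiplicativity of image classes. -/

namespace BundleK

/-- The embedding `S_k × S_m → S_{k+m}`. -/
def permSum (k m : ℕ) :
    Equiv.Perm (Fin k) × Equiv.Perm (Fin m) →* Equiv.Perm (Fin (k + m)) :=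
  (finSumFinEquiv.permCongrHom.toMonoidHom).comp (Equiv.Perm.sumCongrHom (Fin k) (Fin m))

lemma permSum_symm_apply {k m : ℕ} (σ : Equiv.Perm (Fin k)) (τ : Equiv.Perm (Fin m))
    (i : Fin (k + m)) : finSumFinEquiv.symm ((permSum k m (σ, τ)).symm i) =
      Sum.map σ.symm τ.symm (finSumFinEquiv.symm i) := by
  change finSumFinEquiv.symm (finSumFinEquiv _) = _
  rw [Equiv.symm_apply_apply]
  rfl

/-- The embedding `ℂ[S_k] → ℂ[S_{k+m}]` induced by the permutations of the first `k` letters. -/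
noncomputable def permLeft (k m : ℕ) : MonoidAlgebra ℂ (Equiv.Perm (Fin k)) →ₐ[ℂ]
    MonoidAlgebra ℂ (Equiv.Perm (Fin (k + m))) :=
  MonoidAlgebra.lift ℂ _ _ ((MonoidAlgebra.of ℂ _).comp ((permSum k m).comp (MonoidHom.inl _ _)))

/-- The embedding `ℂ[S_m] → ℂ[S_{k+m}]` induced by the permutations of the last `m` letters. -/
noncomputable def permRight (k m : ℕ) : MonoidAlgebra ℂ (Equiv.Perm (Fin m)) →ₐ[ℂ]
    MonoidAlgebra ℂ (Equiv.Perm (Fin (k + m))) :=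
  MonoidAlgebra.lift ℂ _ _ ((MonoidAlgebra.of ℂ _).comp ((permSum k m).comp (MonoidHom.inr _ _)))

lemma permLeft_of {k m : ℕ} (σ : Equiv.Perm (Fin k)) :
    permLeft k m (MonoidAlgebra.of ℂ _ σ) = MonoidAlgebra.of ℂ _ (permSum k m (σ, 1)) :=
  MonoidAlgebra.lift_of _ _

lemma permRight_of {k m : ℕ} (τ : Equiv.Perm (Fin m)) :
    permRight k m (MonoidAlgebra.of ℂ _ τ) = MonoidAlgebra.of ℂ _ (permSum k m (1, τ)) :=
  MonoidAlgebra.lift_of _ _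

lemma permLeft_of_mul_permRight_of {k m : ℕ} (σ : Equiv.Perm (Fin k)) (τ : Equiv.Perm (Fin m)) :
    permLeft k m (MonoidAlgebra.of ℂ _ σ) * permRight k m (MonoidAlgebra.of ℂ _ τ) =
      MonoidAlgebra.of ℂ _ (permSum k m (σ, τ)) := by
  rw [permLeft_of, permRight_of, ← map_mul, ← map_mul, Prod.mk_mul_mk, mul_one, one_mul]

/-- Permutations of disjoint sets of letters commute, and the claim is bilinear. It ensures that the
product of two embedded idempotents is idempotent. -/
lemma commute_permLeft_permRight {k m : ℕ} (a : MonoidAlgebra ℂ (Equiv.Perm (Fin k)))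
    (b : MonoidAlgebra ℂ (Equiv.Perm (Fin m))) : Commute (permLeft k m a) (permRight k m b) := by
  induction a using MonoidAlgebra.induction_on with
  | of σ =>
    induction b using MonoidAlgebra.induction_on with
    | of τ =>
      change _ * _ = _ * _
      rw [permLeft_of_mul_permRight_of, permLeft_of, permRight_of, ← map_mul, ← map_mul,
        Prod.mk_mul_mk, mul_one, one_mul]
    | add a b ha hb => rw [map_add]; exact ha.add_right hb
    | smul c a ha => rw [map_smul]; exact ha.smul_right c
  | add a b ha hb => rw [map_add]; exact ha.add_left hb
  | smul c a ha => rw [map_smul]; exact ha.smul_left c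

lemma isIdempotentElem_permLeft_mul_permRight {k m : ℕ}
    {a : MonoidAlgebra ℂ (Equiv.Perm (Fin k))} {b : MonoidAlgebra ℂ (Equiv.Perm (Fin m))}
    (ha : IsIdempotentElem a) (hb : IsIdempotentElem b) :
    IsIdempotentElem (permLeft k m a * permRight k m b) :=
  IsIdempotentElem.mul_of_commute (commute_permLeft_permRight a b) (ha.map _) (hb.map _)

/-- The isomorphism `V^{⊗k} ⊗ V^{⊗m} = V^{⊗(k+m)}`. -/
noncomputable def tensorPowerMul (V : Type*) [AddCommGroup V] [Module ℂ V] (k m : ℕ) :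
    ((⨂[ℂ] _ : Fin k, V) ⊗[ℂ] (⨂[ℂ] _ : Fin m, V)) ≃ₗ[ℂ] ⨂[ℂ] _ : Fin (k + m), V :=
  (PiTensorProduct.tmulEquiv ℂ V).trans (PiTensorProduct.reindex ℂ (fun _ => V) finSumFinEquiv)

lemma tensorPowerMul_tprod {V : Type*} [AddCommGroup V] [Module ℂ V] {k m : ℕ} (a : Fin k → V)
    (b : Fin m → V) :
    tensorPowerMul V k m (PiTensorProduct.tprod ℂ a ⊗ₜ[ℂ] PiTensorProduct.tprod ℂ b) =
      PiTensorProduct.tprod ℂ fun i => Sum.elim a b (finSumFinEquiv.symm i) := by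
  rw [tensorPowerMul, LinearEquiv.trans_apply, PiTensorProduct.tmulEquiv_apply]
  exact PiTensorProduct.reindex_tprod (R := ℂ) (s := fun _ => V) finSumFinEquiv _

namespace ComplexVectorBundle

lemma tensorPerm_permSum {V : Type*} [AddCommGroup V] [Module ℂ V] {k m : ℕ}
    (σ : Equiv.Perm (Fin k)) (τ : Equiv.Perm (Fin m)) :
    tensorPerm V (k + m) (permSum k m (σ, τ)) ∘ₗ (tensorPowerMul V k m).toLinearMap =
      (tensorPowerMul V k m).toLinearMap ∘ₗ
        TensorProduct.map (tensorPerm V k σ) (tensorPerm V m τ) := by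
  apply TensorProduct.ext
  refine PiTensorProduct.ext (MultilinearMap.ext fun a => ?_)
  refine PiTensorProduct.ext (MultilinearMap.ext fun b => ?_)
  change tensorPerm V (k + m) (permSum k m (σ, τ)) (tensorPowerMul V k m
      (PiTensorProduct.tprod ℂ a ⊗ₜ[ℂ] PiTensorProduct.tprod ℂ b)) = tensorPowerMul V k m
      (tensorPerm V k σ (PiTensorProduct.tprod ℂ a) ⊗ₜ[ℂ]
        tensorPerm V m τ (PiTensorProduct.tprod ℂ b))
  simp only [tensorPerm_tprod, tensorPowerMul_tprod, permSum_symm_apply]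
  congr 1
  funext i
  rcases finSumFinEquiv.symm i with j | j <;> rfl

/-- The action of `ℂ[S_n]` on a tensor power. -/
noncomputable def tensorRep (V : Type*) [AddCommGroup V] [Module ℂ V] (n : ℕ) :
    MonoidAlgebra ℂ (Equiv.Perm (Fin n)) →ₐ[ℂ] Module.End ℂ (⨂[ℂ] _ : Fin n, V) :=
  MonoidAlgebra.lift ℂ _ _ (tensorPerm V n)

lemma tensorRep_of {V : Type*} [AddCommGroup V] [Module ℂ V] {n : ℕ} (σ : Equiv.Perm (Fin n)) :
    tensorRep V n (MonoidAlgebra.of ℂ _ σ) = tensorPerm V n σ :=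
  MonoidAlgebra.lift_of _ _

/-- Both sides are bilinear in (a, b), which reduces the claim to group elements, i.e. to
`tensorPerm_permSum`. -/
lemma tensorRep_permLeft_mul_permRight {V : Type*} [AddCommGroup V] [Module ℂ V] {k m : ℕ}
    (a : MonoidAlgebra ℂ (Equiv.Perm (Fin k))) (b : MonoidAlgebra ℂ (Equiv.Perm (Fin m))) :
    tensorRep V (k + m) (permLeft k m a * permRight k m b) ∘ₗ
        (tensorPowerMul V k m).toLinearMap =
      (tensorPowerMul V k m).toLinearMap ∘ₗ
        TensorProduct.map (tensorRep V k a) (tensorRep V m b) := by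
  induction a using MonoidAlgebra.induction_on with
  | of σ =>
    induction b using MonoidAlgebra.induction_on with
    | of τ =>
      rw [permLeft_of_mul_permRight_of, tensorRep_of, tensorRep_of, tensorRep_of]
      exact tensorPerm_permSum σ τ
    | add a b ha hb =>
      rw [map_add, mul_add, map_add, map_add, TensorProduct.map_add_right, LinearMap.comp_add,
        ← ha, ← hb, LinearMap.add_comp]
    | smul c a ha =>
      rw [map_smul, mul_smul_comm, map_smul, map_smul, TensorProduct.map_smul_right,
        LinearMap.comp_smul, ← ha, LinearMap.smul_comp]
  | add a b ha hb =>
    rw [map_add, add_mul, map_add, map_add, TensorProduct.map_add_left, LinearMap.comp_add,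
      ← ha, ← hb, LinearMap.add_comp]
  | smul c a ha =>
    rw [map_smul, smul_mul_assoc, map_smul, map_smul, TensorProduct.map_smul_left,
      LinearMap.comp_smul, ← ha, LinearMap.smul_comp]

/-- The frame bijection underlying `tensorPowerMul`. -/
def appendIndex (ι : Type) (k m : ℕ) : (Fin k → ι) × (Fin m → ι) ≃ (Fin (k + m) → ι) :=
  (Equiv.sumArrowEquivProdArrow (Fin k) (Fin m) ι).symm.trans
    (Equiv.arrowCongr finSumFinEquiv (Equiv.refl ι))

lemma tensorPowerMul_basis {V : Type*} [AddCommGroup V] [Module ℂ V] {ι : Type} [Finite ι]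
    {k m : ℕ} (b : Module.Basis ι ℂ V) (q : (Fin k → ι) × (Fin m → ι)) :
    tensorPowerMul V k m (((Basis.piTensorProduct fun _ : Fin k => b).tensorProduct
      (Basis.piTensorProduct fun _ : Fin m => b)) q) =
      (Basis.piTensorProduct fun _ : Fin (k + m) => b) (appendIndex ι k m q) := by
  obtain ⟨q, q'⟩ := q
  rw [Module.Basis.tensorProduct_apply, Basis.piTensorProduct_apply, Basis.piTensorProduct_apply,
    Basis.piTensorProduct_apply, tensorPowerMul_tprod]
  congr 1
  funext i
  change _ = b (Sum.elim q q' (finSumFinEquiv.symm i))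
  rcases finSumFinEquiv.symm i with j | j <;> rfl

variable {X : Type u} [TopologicalSpace X] (E : ComplexVectorBundle X) (k m : ℕ)

lemma isBundleMap_tensorPowerMul :
    IsBundleMap ((E.tensorPower k).tensor (E.tensorPower m)) (E.tensorPower (k + m))
      (fun x => (tensorPowerMul (E.fiber x) k m).toLinearMap) := by
  refine isBundleMap_of_local fun x => ?_
  obtain ⟨φ, hφ, hx⟩ := E.covers x
  refine ⟨_, ⟨_, ⟨φ, hφ, rfl⟩, _, ⟨φ, hφ, rfl⟩, rfl⟩, _, ⟨φ, hφ, rfl⟩, ⟨hx, hx⟩, hx, ?_⟩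
  exact LocalFrame.matrixContinuous_of_basis (appendIndex φ.ι k m)
    fun y hy hy' j => tensorPowerMul_basis (φ.basis y hy') j

lemma isBundleMap_tensorPowerMul_symm :
    IsBundleMap (E.tensorPower (k + m)) ((E.tensorPower k).tensor (E.tensorPower m))
      (fun x => (tensorPowerMul (E.fiber x) k m).symm.toLinearMap) := by
  refine isBundleMap_of_local fun x => ?_
  obtain ⟨φ, hφ, hx⟩ := E.covers x
  refine ⟨_, ⟨φ, hφ, rfl⟩, _, ⟨_, ⟨φ, hφ, rfl⟩, _, ⟨φ, hφ, rfl⟩, rfl⟩, hx, ⟨hx, hx⟩, ?_⟩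
  refine LocalFrame.matrixContinuous_of_basis (appendIndex φ.ι k m).symm fun y hy hy' j => ?_
  refine (LinearEquiv.symm_apply_eq (tensorPowerMul (E.fiber y) k m)).2 ?_
  have := tensorPowerMul_basis (φ.basis y hy) ((appendIndex φ.ι k m).symm j)
  rw [Equiv.apply_symm_apply] at this
  exact this.symm

variable {k m}

/-- Concatenation of tensors intertwines a ⊗ b with the product of their embeddings, so
`image_tensor_iso` applies. -/
lemma of_image_mul_of_image {a : MonoidAlgebra ℂ (Equiv.Perm (Fin k))}
    {b : MonoidAlgebra ℂ (Equiv.Perm (Fin m))} (ha : IsIdempotentElem a)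
    (hb : IsIdempotentElem b) :
    KGroup.of ((E.tensorAction k).image a ha) * KGroup.of ((E.tensorAction m).image b hb) =
      KGroup.of ((E.tensorAction (k + m)).image _
        (isIdempotentElem_permLeft_mul_permRight ha hb)) := by
  rw [← KGroup.of_tensor]
  refine KGroup.of_eq_of_iso ?_
  exact image_tensor_iso (E.isBundleMap_tensorPowerMul k m)
    (E.isBundleMap_tensorPowerMul_symm k m)
    (fun x => LinearEquiv.symm_comp (tensorPowerMul (E.fiber x) k m))
    (fun x => LinearEquiv.comp_symm (tensorPowerMul (E.fiber x) k m))
    (fun x => tensorRep_permLeft_mul_permRight (V := E.fiber x) a b)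

end ComplexVectorBundle

end BundleK

/-! ### Newton's identity in the group algebra of the symmetric group. -/

namespace BundleK

section newton

open Equiv Equiv.Perm

/-- The permutations of `Fin n` which fix all letters from `j` on. -/
def headPerms (n j : ℕ) : Finset (Perm (Fin n)) :=
  Finset.univ.filter fun w => ∀ i : Fin n, j ≤ i → w i = i

lemma mem_headPerms {n j : ℕ} {w : Perm (Fin n)} :
    w ∈ headPerms n j ↔ ∀ i : Fin n, j ≤ i → w i = i := by
  simp [headPerms]

/-- The signed group element `sgn(w) w`. -/
noncomputable def signedPerm {n : ℕ} : Perm (Fin n) →* MonoidAlgebra ℂ (Perm (Fin n)) where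
  toFun w := ((sign w : ℤ) : ℂ) • MonoidAlgebra.of ℂ _ w
  map_one' := by rw [map_one, map_one, Units.val_one, Int.cast_one, one_smul]
  map_mul' v w := by
    rw [smul_mul_smul_comm, ← map_mul, Perm.sign_mul, Units.val_mul, Int.cast_mul]

lemma signedPerm_apply {n : ℕ} (w : Perm (Fin n)) :
    signedPerm w = ((sign w : ℤ) : ℂ) • MonoidAlgebra.of ℂ _ w := rfl

lemma signedPerm_swap {n : ℕ} {i j : Fin n} (h : i ≠ j) :
    signedPerm (swap i j) = -MonoidAlgebra.of ℂ _ (swap i j) := by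
  rw [signedPerm_apply, sign_swap h]
  simp

/-- The signed sum of the permutations of the first `j` letters. -/
noncomputable def headSum (n j : ℕ) : MonoidAlgebra ℂ (Perm (Fin n)) :=
  ∑ w ∈ headPerms n j, signedPerm w

lemma headSum_zero (n : ℕ) : headSum n 0 = 1 := by
  have : headPerms n 0 = {1} := by
    ext w
    simp [mem_headPerms, Equiv.ext_iff]
  rw [headSum, this, Finset.sum_singleton, map_one]

lemma headSum_self (n : ℕ) : headSum n n = (n.factorial : ℂ) • antisymmetrizer n := by
  have h : headPerms n n = Finset.univ := by
    ext w
    simp only [mem_headPerms, Finset.mem_univ, iff_true]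
    intro i hi
    exact absurd i.2 (not_lt.2 hi)
  have hn : (n.factorial : ℂ) ≠ 0 := by exact_mod_cast n.factorial_ne_zero
  rw [headSum, h, antisymmetrizer, smul_smul, mul_inv_cancel₀ hn, one_smul]
  rfl

/-- Coset decomposition: a permutation w of the first j + 1 letters is uniquely w' (i J), where J is
the new letter, i = w⁻¹ J ≤ J and w' fixes J. Each genuine transposition contributes the sign -1. -/
lemma headSum_succ {n j : ℕ} (hj : j < n) : headSum n (j + 1) = headSum n j -
    ∑ i ∈ Finset.Iio (⟨j, hj⟩ : Fin n),
      headSum n j * MonoidAlgebra.of ℂ _ (swap i ⟨j, hj⟩) := by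
  set J : Fin n := ⟨j, hj⟩
  -- The index i = J is included; its `swap` is the identity and later splits off as the leading
  -- term.
  have h1 : headSum n (j + 1) = ∑ i ∈ Finset.Iic J, headSum n j * signedPerm (swap i J) := by
    simp only [headSum, Finset.sum_mul]
    rw [← Finset.sum_product']
    symm
    refine Finset.sum_bij' (fun p _ => p.2 * swap p.1 J)
      (fun w _ => (w.symm J, w * swap (w.symm J) J)) ?_ ?_ ?_ ?_ ?_
    · rintro ⟨i, w⟩ hp
      rw [Finset.mem_product, Finset.mem_Iic, mem_headPerms] at hp
      rw [mem_headPerms]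
      intro l hl
      have hlJ : J < l := by
        change j < l.1
        omega
      rw [Perm.mul_apply, swap_apply_of_ne_of_ne (hp.1.trans_lt hlJ).ne' hlJ.ne']
      exact hp.2 l (by omega)
    · intro w hw
      rw [mem_headPerms] at hw
      rw [Finset.mem_product, Finset.mem_Iic, mem_headPerms]
      have h2 : w.symm J ≤ J := by
        by_contra hlt
        have h3 := hw (w.symm J) (not_le.1 hlt)
        rw [Equiv.apply_symm_apply] at h3
        exact hlt h3.symm.le
      refine ⟨h2, fun l hl => ?_⟩
      change (w * swap (w.symm J) J) l = l
      rcases eq_or_ne l J with rfl | hne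
      · simp
      · have hlJ : J < l := lt_of_le_of_ne hl hne.symm
        rw [Perm.mul_apply, swap_apply_of_ne_of_ne (h2.trans_lt hlJ).ne' hlJ.ne']
        exact hw l hlJ
    · rintro ⟨i, w⟩ hp
      rw [Finset.mem_product, mem_headPerms] at hp
      have hJ : w.symm J = J := by
        rw [Equiv.symm_apply_eq]
        exact (hp.2 J le_rfl).symm
      have hi : (w * swap i J).symm J = i := by
        rw [Equiv.symm_apply_eq, Perm.mul_apply, swap_apply_left]
        exact (hp.2 J le_rfl).symm
      simp only [hi, mul_assoc, swap_mul_self, mul_one]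
    · intro w _
      simp [mul_assoc]
    · rintro ⟨i, w⟩ _
      rw [map_mul]
  rw [h1, ← Finset.Iio_insert, Finset.sum_insert (by simp), swap_self, sub_eq_add_neg,
    ← Finset.sum_neg_distrib]
  congr 1
  · change _ * signedPerm 1 = _
    rw [map_one, mul_one]
  · refine Finset.sum_congr rfl fun i hi => ?_
    rw [signedPerm_swap (Finset.mem_Iio.1 hi).ne, mul_neg]

/-- Conjugation by τ permutes the summands and preserves signs. -/
lemma headSum_conj {n j : ℕ} {τ : Perm (Fin n)} (hτ : τ ∈ headPerms n j) :
    MonoidAlgebra.of ℂ _ τ * headSum n j = headSum n j * MonoidAlgebra.of ℂ _ τ := by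
  rw [mem_headPerms] at hτ
  have hτ' : ∀ i : Fin n, j ≤ i → τ.symm i = i := fun i hi => by
    rw [Equiv.symm_apply_eq]
    exact (hτ i hi).symm
  rw [headSum, Finset.mul_sum, Finset.sum_mul]
  refine Finset.sum_bij' (fun w _ => τ * w * τ⁻¹) (fun w _ => τ⁻¹ * w * τ) ?_ ?_ ?_ ?_ ?_
  · intro w hw
    rw [mem_headPerms] at hw ⊢
    intro i hi
    simp [hτ' i hi, hw i hi, hτ i hi]
  · intro w hw
    rw [mem_headPerms] at hw ⊢
    intro i hi
    simp [hτ' i hi, hw i hi, hτ i hi]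
  · intro w _
    group
  · intro w _
    group
  · intro w _
    rw [signedPerm_apply, signedPerm_apply, mul_smul_comm, smul_mul_assoc, ← map_mul, ← map_mul,
      inv_mul_cancel_right, Perm.sign_mul, Perm.sign_mul, sign_inv, mul_right_comm, Int.units_mul_self,
      one_mul]

/-- The cycle `(j j+1 ⋯ n-1)` of `Fin n`. -/
def tailCycle (n j : ℕ) : Perm (Fin n) where
  toFun i := ⟨if i.1 < j then i.1 else if i.1 + 1 < n then i.1 + 1 else j, by split_ifs <;> omega⟩
  invFun i := ⟨if i.1 < j then i.1 else if i.1 = j then n - 1 else i.1 - 1, by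
    split_ifs <;> omega⟩
  left_inv i := by
    ext
    dsimp only
    split_ifs <;> omega
  right_inv i := by
    ext
    dsimp only
    split_ifs <;> omega

lemma tailCycle_val {n j : ℕ} (i : Fin n) : (tailCycle n j i : ℕ) =
    if i.1 < j then i.1 else if i.1 + 1 < n then i.1 + 1 else j := rfl

lemma tailCycle_eq_one {n j : ℕ} (hj : n ≤ j + 1) : tailCycle n j = 1 := by
  ext i
  rw [tailCycle_val, Perm.one_apply]
  split_ifs <;> omega

lemma swap_mul_tailCycle {n j : ℕ} (hj : j + 1 < n) :
    swap ⟨j, by omega⟩ ⟨j + 1, hj⟩ * tailCycle n (j + 1) = tailCycle n j := by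
  ext i
  rw [Perm.mul_apply, swap_apply_def]
  simp only [Fin.ext_iff, tailCycle_val, apply_ite Fin.val]
  split_ifs <;> omega

variable {n : ℕ} {V : Type*} [AddCommGroup V] [Module ℂ V]
  (T : MonoidAlgebra ℂ (Perm (Fin n)) →ₗ[ℂ] V)

/-- Expand by `headSum_succ`. The transpositions (i j+1) with i ≤ j are conjugate to (j j+1) by (i
j), which commutes with both `headSum n (j + 1)` and the tail cycle. So all j + 1 correction terms
have the same trace, and (j j+1) lengthens the tail cycle by one letter. -/
lemma trace_headSum_succ_mul_tailCycle (hT : ∀ a b, T (a * b) = T (b * a)) {j : ℕ}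
    (hj : j + 1 < n) :
    T (headSum n (j + 2) * MonoidAlgebra.of ℂ _ (tailCycle n (j + 1))) =
      T (headSum n (j + 1) * MonoidAlgebra.of ℂ _ (tailCycle n (j + 1))) -
        ((j + 1 : ℕ) : ℂ) • T (headSum n (j + 1) * MonoidAlgebra.of ℂ _ (tailCycle n j)) := by
  set J : Fin n := ⟨j + 1, hj⟩
  set K : Fin n := ⟨j, by omega⟩
  have key : ∀ i ∈ Finset.Iio J, T (headSum n (j + 1) * MonoidAlgebra.of ℂ _ (swap i J) *
      MonoidAlgebra.of ℂ _ (tailCycle n (j + 1))) =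
      T (headSum n (j + 1) * MonoidAlgebra.of ℂ _ (tailCycle n j)) := by
    intro i hi
    have hiJ : i < J := Finset.mem_Iio.1 hi
    have hij : i.1 < j + 1 := hiJ
    have hJK : J ≠ K := by simp [J, K]
    have hτ : swap i K ∈ headPerms n (j + 1) := by
      rw [mem_headPerms]
      intro l hl
      refine swap_apply_of_ne_of_ne ?_ ?_
      · rintro rfl
        omega
      · rintro rfl
        simp [K] at hl
    have hcomm : swap i K * tailCycle n (j + 1) = tailCycle n (j + 1) * swap i K := by
      have h1 : tailCycle n (j + 1) i = i := Fin.ext (by rw [tailCycle_val, if_pos hij])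
      have h2 : tailCycle n (j + 1) K = K :=
        Fin.ext (by rw [tailCycle_val, if_pos (Nat.lt_succ_self j)])
      rw [Equiv.mul_swap_eq_swap_mul, h1, h2]
    have hconj : swap i K * swap i J * swap i K = swap K J := by
      have h3 := Equiv.swap_mul_swap_mul_swap (x := J) (y := i) (z := K) hiJ.ne' hJK
      rw [swap_comm i J]
      exact h3
    have hinv : swap i K * swap i K = 1 := swap_mul_self i K
    have e1 : swap i J = swap i K * swap K J * swap i K := by
      rw [← hconj]
      simp only [mul_assoc, hinv, mul_one]
      rw [← mul_assoc, hinv, one_mul]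
    set s := MonoidAlgebra.of ℂ _ (swap i K)
    set c := MonoidAlgebra.of ℂ _ (tailCycle n (j + 1))
    have hs : s * s = 1 := by rw [← map_mul, hinv, map_one]
    have hsc : s * c = c * s := by rw [← map_mul, hcomm, map_mul]
    have hsH : s * headSum n (j + 1) = headSum n (j + 1) * s := headSum_conj hτ
    rw [e1, ← swap_mul_tailCycle hj]
    simp only [map_mul (MonoidAlgebra.of ℂ (Perm (Fin n)))]
    change T (headSum n (j + 1) * (s * MonoidAlgebra.of ℂ _ (swap K J) * s) * c) =
      T (headSum n (j + 1) * (MonoidAlgebra.of ℂ _ (swap K J) * c))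
    -- The right-hand `s` moves past `c`, the left-hand one past the head sum; cyclicity of `T`
    -- brings them together, where s² = 1.
    rw [mul_assoc _ _ c, mul_assoc _ s c, hsc, mul_assoc s, ← mul_assoc, ← hsH, mul_assoc s, hT]
    simp only [mul_assoc, hs, mul_one]
  rw [headSum_succ hj, sub_mul, map_sub, Finset.sum_mul, map_sum, Finset.sum_congr rfl key,
    Finset.sum_const, Fin.card_Iio, Nat.cast_smul_eq_nsmul]

/-- Newton's identity for traces on the group algebra of the symmetric group. -/
lemma newton_trace (hT : ∀ a b, T (a * b) = T (b * a)) {j : ℕ} (hj : j < n) :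
    (j.factorial : ℂ)⁻¹ • T (headSum n (j + 1) * MonoidAlgebra.of ℂ _ (tailCycle n j)) =
      ∑ k ∈ Finset.range (j + 1), ((-1) ^ (j + k) * (k.factorial : ℂ)⁻¹) •
        T (headSum n k * MonoidAlgebra.of ℂ _ (tailCycle n k)) := by
  induction j with
  | zero =>
    have h := headSum_succ hj
    have h0 : Finset.Iio (⟨0, hj⟩ : Fin n) = ∅ := by
      ext i
      simp [Fin.lt_def]
    rw [h0, Finset.sum_empty, sub_zero] at h
    simp [h]
  | succ j ih =>
    have hf : ((j + 1).factorial : ℂ) = (j + 1 : ℕ) * j.factorial := by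
      rw [Nat.factorial_succ]
      push_cast
      ring
    have hj0 : ((j + 1 : ℕ) : ℂ) ≠ 0 := by exact_mod_cast j.succ_ne_zero
    -- Division by (j+1)! turns the coefficient j + 1 into 1/j!, so the subtracted term is the
    -- induction hypothesis; the other term is the new summand k = j + 1.
    rw [trace_headSum_succ_mul_tailCycle T hT hj, smul_sub, smul_smul, hf, mul_inv,
      mul_right_comm, inv_mul_cancel₀ hj0, one_mul, ih (by omega), Finset.sum_range_succ _ (j + 1),
      ← mul_inv, ← hf, sub_eq_neg_add, ← Finset.sum_neg_distrib]
    congr 1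
    · refine Finset.sum_congr rfl fun k _ => ?_
      rw [← neg_smul]
      congr 1
      ring
    · rw [← two_mul (j + 1), pow_mul]
      simp

end newton

end BundleK

/-! ### Identification of the cycle's trace with the Adams operation. -/

namespace BundleK

attribute [local instance] Algebra.TensorProduct.rightAlgebra

lemma permSum_castAdd {k m : ℕ} (σ : Equiv.Perm (Fin k)) (τ : Equiv.Perm (Fin m)) (i : Fin k) :
    permSum k m (σ, τ) (Fin.castAdd m i) = Fin.castAdd m (σ i) := by
  change finSumFinEquiv (Sum.map σ τ (finSumFinEquiv.symm (Fin.castAdd m i))) = _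
  rw [finSumFinEquiv_symm_apply_castAdd]
  rfl

lemma permSum_natAdd {k m : ℕ} (σ : Equiv.Perm (Fin k)) (τ : Equiv.Perm (Fin m)) (i : Fin m) :
    permSum k m (σ, τ) (Fin.natAdd k i) = Fin.natAdd k (τ i) := by
  change finSumFinEquiv (Sum.map σ τ (finSumFinEquiv.symm (Fin.natAdd k i))) = _
  rw [finSumFinEquiv_symm_apply_natAdd]
  rfl

lemma sign_permSum {k m : ℕ} (σ : Equiv.Perm (Fin k)) (τ : Equiv.Perm (Fin m)) :
    Equiv.Perm.sign (permSum k m (σ, τ)) = Equiv.Perm.sign σ * Equiv.Perm.sign τ :=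
  (Equiv.Perm.sign_permCongr finSumFinEquiv _).trans (Equiv.Perm.sign_sumCongr σ τ)

/-- Viewed on `Fin k ⊕ Fin m`, such a permutation preserves the right summand, hence also the left
one, and so splits; its right component is trivial. -/
lemma exists_permSum_eq {k m : ℕ} {w : Equiv.Perm (Fin (k + m))} (hw : w ∈ headPerms (k + m) k) :
    ∃ σ, permSum k m (σ, 1) = w := by
  rw [mem_headPerms] at hw
  have hw' : ∀ j, w (Fin.natAdd k j) = Fin.natAdd k j := fun j => hw _ (by simp)
  let w' : Equiv.Perm (Fin k ⊕ Fin m) := finSumFinEquiv.symm.permCongr w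
  have hinr : ∀ j, w' (Sum.inr j) = Sum.inr j := by
    intro j
    change finSumFinEquiv.symm (w (finSumFinEquiv (Sum.inr j))) = Sum.inr j
    rw [finSumFinEquiv_apply_right, hw', finSumFinEquiv_symm_apply_natAdd]
  have hmaps : Set.MapsTo w' (Set.range Sum.inr) (Set.range Sum.inr) := by
    rintro _ ⟨j, rfl⟩
    exact ⟨j, (hinr j).symm⟩
  obtain ⟨⟨σ, τ⟩, hστ⟩ := Equiv.Perm.mem_sumCongrHom_range_of_perm_mapsTo_inl
    ((Equiv.Perm.perm_mapsTo_inl_iff_mapsTo_inr w').2 hmaps)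
  have hτ : τ = 1 := by
    ext1 j
    have h := hinr j
    rw [← hστ] at h
    exact Sum.inr_injective h
  subst hτ
  refine ⟨σ, ?_⟩
  change finSumFinEquiv.permCongr (Equiv.Perm.sumCongrHom _ _ (σ, 1)) = w
  rw [hστ]
  ext i
  simp [w']

lemma permLeft_antisymmetrizer (k m : ℕ) :
    permLeft k m (antisymmetrizer k) = (k.factorial : ℂ)⁻¹ • headSum (k + m) k := by
  rw [antisymmetrizer, map_smul, map_sum, headSum]
  congr 1
  refine Finset.sum_bij (fun σ _ => permSum k m (σ, 1)) ?_ ?_ ?_ ?_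
  · intro σ _
    rw [mem_headPerms]
    intro i hi
    induction i using Fin.addCases with
    | left i => exact absurd hi (not_le.2 i.2)
    | right i => rw [permSum_natAdd]; rfl
  · intro σ _ τ _ h
    ext1 i
    have h1 := congrArg (fun w => w (Fin.castAdd m i)) h
    simp only [permSum_castAdd] at h1
    exact Fin.castAdd_injective k m h1
  · intro w hw
    obtain ⟨σ, hσ⟩ := exists_permSum_eq hw
    exact ⟨σ, Finset.mem_univ _, hσ⟩
  · intro σ _
    rw [map_smul, permLeft_of, signedPerm_apply, sign_permSum, map_one, mul_one]

lemma permSum_one_finRotate (k m : ℕ) :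
    permSum k m (1, finRotate m) = tailCycle (k + m) k := by
  ext i
  rw [tailCycle_val]
  induction i using Fin.addCases with
  | left i =>
    rw [permSum_castAdd, if_pos (by simp)]
    rfl
  | right i =>
    obtain _ | m := m
    · exact i.elim0
    · rw [permSum_natAdd, Fin.val_natAdd, Fin.val_natAdd, coe_finRotate]
      have := i.2
      split_ifs with h1 h2 h3 h3
      · omega
      · subst h1
        rw [Fin.val_last] at h3
        omega
      · rfl
      · omega
      · rw [add_assoc]
      · have : i = Fin.last m := Fin.ext (by rw [Fin.val_last]; omega)
        exact absurd this h1

lemma tailCycle_zero (n : ℕ) : tailCycle n 0 = finRotate n := by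
  obtain _ | n := n
  · exact Subsingleton.elim _ _
  · ext i
    rw [tailCycle_val, coe_finRotate, if_neg (Nat.not_lt_zero _)]
    have h := Fin.ext_iff (a := i) (b := Fin.last n)
    rw [Fin.val_last] at h
    split_ifs with h1 h2 h2
    · rw [h.1 h2] at h1; omega
    · rfl
    · rfl
    · have : i = Fin.last n := h.2 (by omega)
      exact absurd this h2

/-- This is `newton_trace` at its last index n - 1: the tail cycle there is trivial and the head sum
is n! times the antisymmetrizer, so n!/(n-1)! leaves the factor n. -/
lemma natCast_mul_trace_antisymmetrizer {R : Type*} [CommRing R] [Algebra ℂ R] {n : ℕ}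
    (T : MonoidAlgebra ℂ (Equiv.Perm (Fin n)) →ₗ[ℂ] R) (hT : ∀ a b, T (a * b) = T (b * a))
    (hn : 1 ≤ n) : (n : R) * T (antisymmetrizer n) =
      ∑ k ∈ Finset.range n, (-1) ^ (n - 1 + k) * ((k.factorial : ℂ)⁻¹ •
        T (headSum n k * MonoidAlgebra.of ℂ _ (tailCycle n k))) := by
  obtain ⟨n, rfl⟩ : ∃ m, n = m + 1 := ⟨n - 1, by omega⟩
  have h := newton_trace T hT (Nat.lt_succ_self n)
  have hf : (n.factorial : ℂ) ≠ 0 := by exact_mod_cast n.factorial_ne_zero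
  have hf' : (n.factorial : ℂ)⁻¹ * ((n + 1).factorial : ℂ) = (n + 1 : ℕ) := by
    rw [Nat.factorial_succ]
    push_cast
    field_simp
  rw [tailCycle_eq_one le_rfl, map_one, mul_one, headSum_self, map_smul, smul_smul, hf',
    Nat.cast_smul_eq_nsmul ℂ, nsmul_eq_mul] at h
  rw [h]
  refine Finset.sum_congr rfl fun k _ => ?_
  rw [mul_smul, Nat.add_sub_cancel, Algebra.smul_def ((-1) ^ (n + k)), map_pow, map_neg, map_one]

namespace ComplexVectorBundle

variable {X : Type u} [TopologicalSpace X] (E : ComplexVectorBundle X)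

lemma trace_tensorAction_of {n : ℕ} (σ : Equiv.Perm (Fin n)) :
    (E.tensorAction n).trace (MonoidAlgebra.of ℂ _ σ) =
      ∑ ξ ∈ Polynomial.nthRootsFinset (orderOf σ) (1 : ℂ),
        ξ • (E.tensorAction n).trace (eigenidempotent (MonoidAlgebra.of ℂ _ σ) (orderOf σ) ξ) := by
  conv_lhs => rw [← sum_smul_eigenidempotent (g := MonoidAlgebra.of ℂ _ σ) (N := orderOf σ)
    (by rw [← map_pow, pow_orderOf_eq_one, map_one]) (orderOf_pos σ)]
  rw [map_sum]
  simp only [map_smul]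

/-- The pulled back eigenbundles are the images of the eigenidempotents of σ, and the sum of these
weighted by the eigenvalues is σ itself. -/
lemma pullback_phi_externalPower {n : ℕ} (σ : Equiv.Perm (Fin n)) :
    KComplex.pullback (diagonalFixed X σ) ((E.externalPower n).phi σ) =
      (E.tensorAction n).trace (MonoidAlgebra.of ℂ _ σ) := by
  rw [trace_tensorAction_of, EquivariantBundle.phi, map_sum]
  refine Finset.sum_congr rfl fun ξ hξ => ?_
  have hξ' := (Polynomial.mem_nthRootsFinset (orderOf_pos σ) _).1 hξ
  rw [AlgebraAction.trace_of_isIdempotentElem _ (isIdempotentElem_eigenidempotent_of hξ'),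
    KComplex.smul_tmul, mul_one, ← KGroup.of_eq_of_iso (E.pullback_eigenbundle_iso hξ'),
    ← KGroup.pullback_of]
  rfl

lemma of_exteriorPower_tmul_one (n : ℕ) :
    (KGroup.of (E.exteriorPower n) ⊗ₜ[ℤ] 1 : KComplex X) =
      (E.tensorAction n).trace (antisymmetrizer n) := by
  rw [AlgebraAction.trace_of_isIdempotentElem _ (isIdempotentElem_antisymmetrizer n),
    KGroup.of_eq_of_iso (E.exteriorPower_iso n)]

lemma trace_mul_trace_of_isIdempotentElem {k m : ℕ} {a : MonoidAlgebra ℂ (Equiv.Perm (Fin k))}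
    {b : MonoidAlgebra ℂ (Equiv.Perm (Fin m))} (ha : IsIdempotentElem a)
    (hb : IsIdempotentElem b) :
    (E.tensorAction k).trace a * (E.tensorAction m).trace b =
      (E.tensorAction (k + m)).trace (permLeft k m a * permRight k m b) := by
  rw [AlgebraAction.trace_of_isIdempotentElem _ ha, AlgebraAction.trace_of_isIdempotentElem _ hb,
    AlgebraAction.trace_of_isIdempotentElem _ (isIdempotentElem_permLeft_mul_permRight ha hb),
    Algebra.TensorProduct.tmul_mul_tmul, mul_one, of_image_mul_of_image]

/-- Multiplicativity is available only for idempotents, so the cycle is expanded into its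
eigenidempotents, multiplied term by term with the antisymmetrizer, and reassembled by linearity. -/
lemma of_exteriorPower_mul_trace {k m n : ℕ} (h : k + m = n) :
    (KGroup.of (E.exteriorPower k) ⊗ₜ[ℤ] 1 : KComplex X) *
        (E.tensorAction m).trace (MonoidAlgebra.of ℂ _ (finRotate m)) =
      (k.factorial : ℂ)⁻¹ • (E.tensorAction n).trace
        (headSum n k * MonoidAlgebra.of ℂ _ (tailCycle n k)) := by
  subst h
  set σ := finRotate m
  have h1 : (MonoidAlgebra.of ℂ _ σ : MonoidAlgebra ℂ (Equiv.Perm (Fin m))) ^ orderOf σ = 1 := by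
    rw [← map_pow, pow_orderOf_eq_one, map_one]
  rw [← map_smul, ← smul_mul_assoc, ← permLeft_antisymmetrizer, ← permSum_one_finRotate,
    ← permRight_of, of_exteriorPower_tmul_one, trace_tensorAction_of, Finset.mul_sum]
  conv_rhs => rw [← sum_smul_eigenidempotent (g := MonoidAlgebra.of ℂ _ (finRotate m)) h1
    (orderOf_pos σ), map_sum, Finset.mul_sum, map_sum]
  refine Finset.sum_congr rfl fun ξ hξ => ?_
  have hξ' := (Polynomial.mem_nthRootsFinset (orderOf_pos σ) _).1 hξ
  rw [map_smul, mul_smul_comm, mul_smul_comm, map_smul, trace_mul_trace_of_isIdempotentElem _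
    (isIdempotentElem_antisymmetrizer k) (isIdempotentElem_eigenidempotent_of hξ')]

lemma natCast_mul_of_exteriorPower {n : ℕ} (hn : 1 ≤ n) :
    (n : KComplex X) * (KGroup.of (E.exteriorPower n) ⊗ₜ[ℤ] 1) =
      ∑ k ∈ Finset.range n, (-1) ^ (n - 1 + k) * ((k.factorial : ℂ)⁻¹ •
        (E.tensorAction n).trace (headSum n k * MonoidAlgebra.of ℂ _ (tailCycle n k))) := by
  rw [of_exteriorPower_tmul_one]
  exact natCast_mul_trace_antisymmetrizer (E.tensorAction n).trace
    (E.tensorAction n).trace_mul_comm hn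

/-- Substituting the expression for n [Λ^n E] into the definition of `adams` cancels every W k with
0 < k < n: the signs are (-1)^(k-1) and (-1)^(2(n-1)+k). -/
lemma map_adams_eq_of_newton {R : Type*} [CommRing R] (ι : KGroup X →+* R) (W : ℕ → R) {n : ℕ}
    (hn : 1 ≤ n) (hW : ∀ k, 0 < k → k < n →
      ι (KGroup.of (E.exteriorPower k)) * ι (adams E (n - k)) = W k)
    (hn' : (n : R) * ι (KGroup.of (E.exteriorPower n)) =
      ∑ k ∈ Finset.range n, (-1) ^ (n - 1 + k) * W k) : ι (adams E n) = W 0 := by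
  rw [adams, map_add, map_sum, map_mul, map_mul, map_pow, map_neg, map_one, map_natCast,
    mul_assoc, hn', Finset.mul_sum, ← Finset.sum_range (fun k => ι (if 0 < k then
      (-1) ^ (k - 1) * KGroup.of (E.exteriorPower k) * adams E (n - k) else 0)),
    ← Finset.sum_add_distrib, Finset.sum_eq_single_of_mem 0 (Finset.mem_range.2 hn)]
  -- At k = 0 the recursion of `adams` contributes nothing, and Newton's sum contributes W 0 with
  -- sign (-1)^(2(n-1)) = 1.
  · rw [if_neg (lt_irrefl 0), map_zero, zero_add, add_zero, ← mul_assoc, ← pow_add, ← two_mul,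
      pow_mul, neg_one_sq, one_pow, one_mul]
  · intro k hk hk0
    have hk1 := Nat.pos_of_ne_zero hk0
    rw [if_pos hk1, map_mul, map_mul, mul_assoc, hW k hk1 (Finset.mem_range.1 hk), map_pow,
      map_neg, map_one, ← mul_assoc, ← pow_add, ← add_assoc, ← two_mul, pow_add, pow_mul,
      neg_one_sq, one_pow, one_mul]
    obtain ⟨j, rfl⟩ : ∃ j, k = j + 1 := ⟨k - 1, by omega⟩
    rw [Nat.add_sub_cancel, pow_succ]
    ring

/-- The traces of the full cycles satisfy the recursion that defines `adams`, in which the top term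
occurs with coefficient 1; strong induction therefore involves no division in K(X). -/
lemma adams_tmul_one {n : ℕ} (hn : 1 ≤ n) : (adams E n ⊗ₜ[ℤ] 1 : KComplex X) =
    (E.tensorAction n).trace (MonoidAlgebra.of ℂ _ (finRotate n)) := by
  induction n using Nat.strong_induction_on with
  | _ n ih =>
    let ι : KGroup X →+* KComplex X := Algebra.TensorProduct.includeLeftRingHom
    let W : ℕ → KComplex X := fun k => (k.factorial : ℂ)⁻¹ • (E.tensorAction n).trace
      (headSum n k * MonoidAlgebra.of ℂ _ (tailCycle n k))
    -- The term k = 0 has trivial head sum and the full n-cycle as tail.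
    have hW0 : (E.tensorAction n).trace (MonoidAlgebra.of ℂ _ (finRotate n)) = W 0 := by
      simp only [W, headSum_zero, tailCycle_zero, one_mul, Nat.factorial_zero, Nat.cast_one,
        inv_one, one_smul]
    have hW : ∀ k, 0 < k → k < n →
        ι (KGroup.of (E.exteriorPower k)) * ι (adams E (n - k)) = W k := by
      intro k hk hkn
      refine Eq.trans ?_ (E.of_exteriorPower_mul_trace (show k + (n - k) = n by omega))
      rw [← ih (n - k) (by omega) (by omega)]
      rfl
    have hn' : (n : KComplex X) * ι (KGroup.of (E.exteriorPower n)) =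
        ∑ k ∈ Finset.range n, (-1) ^ (n - 1 + k) * W k := E.natCast_mul_of_exteriorPower hn
    rw [hW0]
    exact E.map_adams_eq_of_newton ι W hn hW hn'

end ComplexVectorBundle

/-- Invariance under the cycle equates consecutive coordinates, so all of them equal the zeroth; n ≥
1 provides that coordinate. -/
lemma fixedBy_finRotate {X : Type u} {n : ℕ} (hn : 1 ≤ n) :
    MulAction.fixedBy (CartPow n X) (finRotate n) = Set.range (diagonal n X) := by
  obtain ⟨n, rfl⟩ : ∃ m, n = m + 1 := ⟨n - 1, by omega⟩
  ext x
  constructor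
  · intro hx
    have h1 : ∀ i, x ((finRotate (n + 1)).symm i) = x i := fun i => congrFun hx i
    have h2 : ∀ i : Fin (n + 1), x i = x 0 := by
      intro i
      induction i using Fin.induction with
      | zero => rfl
      | succ i ih =>
        rw [← ih, ← h1 i.succ]
        congr 1
        rw [Equiv.symm_apply_eq, finRotate_apply, Fin.coeSucc_eq_succ]
    exact ⟨x 0, funext fun i => (h2 i).symm⟩
  · rintro ⟨y, rfl⟩
    rfl

end BundleK

theorem mainTheorem8 {X : Type*} [TopologicalSpace X] (E : BundleK.ComplexVectorBundle X)
    (n : ℕ) (hn : 1 ≤ n) :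
    MulAction.fixedBy (BundleK.CartPow n X) (finRotate n) = Set.range (BundleK.diagonal n X) ∧
    BundleK.KComplex.pullback (BundleK.diagonalFixed X (finRotate n))
        ((E.externalPower n).phi (finRotate n)) =
      BundleK.adams E n ⊗ₜ[ℤ] (1 : ℂ) :=
  ⟨BundleK.fixedBy_finRotate hn,
    (E.pullback_phi_externalPower (finRotate n)).trans (E.adams_tmul_one hn).symm⟩
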